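/- Let $n\ge 1$ and let $(M,g)$ be a compact connected Kähler manifold of complex dimension $n$. Write the Kähler form locally as $\omega=\frac i2\sum_{\alpha,\beta} g_{\alpha\bar\beta}\,dz_\alpha\wedge d\bar z_\beta$, and let $\rho=-i\,\partial\bar\partial\log\det(g_{\alpha\bar\beta})$ be the Ricci form. Suppose that $(M,g)$ is Kähler–Einstein with Einstein constant $\lambda\in\mathbb R$, i.e. $\rho=\lambda\,\omega$. Suppose also that, for some finite $N$, there is a Kähler immersion $f\colon M\to\mathbb{C}\mathrm{P}^N$, i.e. a holomorphic map with $f^*g_{FS}=g$, where $g_{FS}$ is the Fubini–Study metric of holomorphic sectional curvature $4$, whose Kähler form is $\omega_{FS}=\frac i2\partial\bar\partial\log(1+|z|^2)$ in affine coordinates $z$. Then $\lambda>0$. -/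

import Mathlib

open scoped Manifold ContDiff

noncomputable section

namespace KahlerProj

/-- `ℂⁿ`, the model space of complex `n`-manifolds. -/
abbrev Cn (n : ℕ) : Type := EuclideanSpace ℂ (Fin n)

/-! ### The complex projective space as a complex manifold -/

/-- Complex projective space `ℂPᴺ`: the complex lines of `ℂᴺ⁺¹`. -/
def CP (N : ℕ) : Type := Projectivization ℂ (Fin (N + 1) → ℂ)

namespace CP

variable {N : ℕ}

/-- The point `[Z₀ : … : Z_N]`. -/
def mk (Z : {Z : Fin (N + 1) → ℂ // Z ≠ 0}) : CP N := Projectivization.mk' ℂ Z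

/-- The quotient topology. -/
instance : TopologicalSpace (CP N) := TopologicalSpace.coinduced mk inferInstance

theorem isQuotientMap_mk : Topology.IsQuotientMap (mk (N := N)) :=
  ⟨⟨rfl⟩, fun p => by
    induction p using Projectivization.ind with
    | h v hv => exact ⟨⟨v, hv⟩, rfl⟩⟩

/-- The domain `{Zᵢ ≠ 0}` of the `i`-th affine chart. -/
def affineDomain (i : Fin (N + 1)) : Set (CP N) :=
  {p | Projectivization.lift (fun Z : {Z : Fin (N + 1) → ℂ // Z ≠ 0} => Z.1 i ≠ 0)
    (fun a b t h => by
      have ht : t ≠ 0 := by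
        rintro rfl
        exact a.2 (by simpa using h)
      simp [h, ht]) p}

/-- The affine coordinates `(Z_j / Zᵢ)_{j ≠ i}`. -/
def affineCoord (i : Fin (N + 1)) : CP N → Cn N :=
  Projectivization.lift
    (fun Z : {Z : Fin (N + 1) → ℂ // Z ≠ 0} =>
      WithLp.toLp 2 (fun k : Fin N => Z.1 (i.succAbove k) / Z.1 i))
    (fun a b t h => by
      have ht : t ≠ 0 := by
        rintro rfl
        exact a.2 (by simpa using h)
      ext k
      simp [h, mul_div_mul_left _ _ ht])

/-- The vector of `ℂᴺ⁺¹` with `1` in the `i`-th place and the coordinates of `z` elsewhere. -/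
def homog (i : Fin (N + 1)) (z : Cn N) : {Z : Fin (N + 1) → ℂ // Z ≠ 0} :=
  ⟨i.insertNth (1 : ℂ) (fun k => z k), fun h => by simpa using congrFun h i⟩

theorem mem_affineDomain_mk (i : Fin (N + 1)) (Z : {Z : Fin (N + 1) → ℂ // Z ≠ 0}) :
    mk Z ∈ affineDomain i ↔ Z.1 i ≠ 0 := Iff.rfl

theorem affineCoord_mk (i : Fin (N + 1)) (Z : {Z : Fin (N + 1) → ℂ // Z ≠ 0}) :
    affineCoord i (mk Z) = WithLp.toLp 2 (fun k : Fin N => Z.1 (i.succAbove k) / Z.1 i) := rfl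

theorem continuous_homog (i : Fin (N + 1)) : Continuous (homog (N := N) i) := by
  refine Continuous.subtype_mk ?_ _
  refine continuous_pi fun j => ?_
  refine Fin.succAboveCases i ?_ (fun k => ?_) j
  · simpa using continuous_const
  · simp only [Fin.insertNth_apply_succAbove]
    fun_prop

theorem isOpen_affineDomain (i : Fin (N + 1)) : IsOpen (affineDomain (N := N) i) := by
  rw [← isQuotientMap_mk.isOpen_preimage]
  have : mk ⁻¹' affineDomain (N := N) i = {Z | Z.1 i ≠ 0} := by
    ext Z
    exact mem_affineDomain_mk i Z
  rw [this]
  exact isOpen_ne_fun ((continuous_apply i).comp continuous_subtype_val) continuous_const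

/-- The `i`-th affine chart `[Z] ↦ (Z_j / Zᵢ)_{j ≠ i}` of `ℂPᴺ`. -/
def affineChart (i : Fin (N + 1)) : OpenPartialHomeomorph (CP N) (Cn N) where
  toFun := affineCoord i
  invFun z := mk (homog i z)
  source := affineDomain i
  target := Set.univ
  map_source' _ _ := Set.mem_univ _
  map_target' z _ := by
    rw [mem_affineDomain_mk]
    simp [homog]
  left_inv' p hp := by
    obtain ⟨Z, rfl⟩ := isQuotientMap_mk.surjective p
    rw [mem_affineDomain_mk] at hp
    rw [affineCoord_mk]
    refine (Projectivization.mk_eq_mk_iff' ℂ _ _ _ _).2 ⟨(Z.1 i)⁻¹, ?_⟩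
    ext j
    refine Fin.succAboveCases i ?_ (fun k => ?_) j
    · simp [hp]
    · simp [div_eq_inv_mul]
  right_inv' z _ := by
    rw [affineCoord_mk]
    ext k
    simp [homog]
  open_source := isOpen_affineDomain i
  open_target := isOpen_univ
  continuousOn_toFun := by
    rw [isQuotientMap_mk.continuousOn_isOpen_iff (isOpen_affineDomain i)]
    have h : ContinuousOn (fun Z : {Z : Fin (N + 1) → ℂ // Z ≠ 0} =>
        (WithLp.toLp 2 (fun k : Fin N => Z.1 (i.succAbove k) / Z.1 i) : Cn N))
        (mk ⁻¹' affineDomain i) := by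
      refine (PiLp.continuous_toLp 2 _).comp_continuousOn ?_
      refine continuousOn_pi.2 fun k => ContinuousOn.div ?_ ?_ ?_
      · exact ((continuous_apply _).comp continuous_subtype_val).continuousOn
      · exact ((continuous_apply _).comp continuous_subtype_val).continuousOn
      · intro Z hZ
        exact (mem_affineDomain_mk i Z).1 hZ
    exact h
  continuousOn_invFun :=
    (isQuotientMap_mk.continuous.comp (continuous_homog i)).continuousOn

theorem exists_mem_affineDomain (p : CP N) : ∃ i, p ∈ affineDomain i := by
  obtain ⟨Z, rfl⟩ := isQuotientMap_mk.surjective p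
  obtain ⟨i, hi⟩ := Function.ne_iff.1 Z.2
  exact ⟨i, (mem_affineDomain_mk i Z).2 hi⟩

/-- The atlas of `ℂPᴺ` given by the `N + 1` affine charts. -/
instance : ChartedSpace (Cn N) (CP N) where
  atlas := Set.range affineChart
  chartAt p := affineChart (exists_mem_affineDomain p).choose
  mem_chart_source p := (exists_mem_affineDomain p).choose_spec
  chart_mem_atlas _ := ⟨_, rfl⟩

/-- `ℂPᴺ` is a complex manifold: the changes of affine coordinates are holomorphic. -/
instance : IsManifold 𝓘(ℂ, Cn N) ω (CP N) := by
  refine isManifold_of_contDiffOn _ _ _ ?_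
  rintro _ _ ⟨i, rfl⟩ ⟨j, rfl⟩
  have hs : ∀ z, z ∈ 𝓘(ℂ, Cn N).symm ⁻¹' ((affineChart i).symm ≫ₕ affineChart j).source ∩
      Set.range 𝓘(ℂ, Cn N) → (homog i z).1 j ≠ 0 := by
    rintro z ⟨hz, -⟩
    have hz' : z ∈ ((affineChart i).symm ≫ₕ affineChart j).source := hz
    rw [OpenPartialHomeomorph.trans_source] at hz'
    exact (mem_affineDomain_mk j _).1 hz'.2
  have hc : ∀ l, ContDiff ℂ ω (fun z : Cn N => (homog i z).1 l) := by
    intro l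
    refine Fin.succAboveCases i ?_ (fun k => ?_) l
    · simpa [homog] using contDiff_const
    · simp only [homog, Fin.insertNth_apply_succAbove]
      exact contDiff_piLp_apply 2
  have h : ContDiffOn ℂ ω (fun z : Cn N => (WithLp.toLp 2 (fun k : Fin N =>
      (homog i z).1 (j.succAbove k) / (homog i z).1 j) : Cn N))
      (𝓘(ℂ, Cn N).symm ⁻¹' ((affineChart i).symm ≫ₕ affineChart j).source ∩
      Set.range 𝓘(ℂ, Cn N)) := by
    rw [contDiffOn_piLp]
    exact fun k => (hc _).contDiffOn.div (hc _).contDiffOn hs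
  exact h

end CP

/-! ### Kähler metrics -/

section Kahler

variable {n : ℕ} {M : Type*} [TopologicalSpace M] [ChartedSpace (Cn n) M]

/-- The real manifold underlying a complex manifold. -/
instance isManifold_real [IsManifold 𝓘(ℂ, Cn n) ω M] : IsManifold 𝓘(ℝ, Cn n) ω M := by
  refine isManifold_of_contDiffOn _ _ _ fun e e' he he' => ?_
  have h := (contDiffGroupoid ω 𝓘(ℂ, Cn n)).compatible he he'
  rw [contDiffGroupoid, mem_groupoid_of_pregroupoid] at h
  exact ContDiffOn.restrict_scalars ℝ h.1

/-- The complex structure `J` (multiplication by `i`) on the real tangent spaces. -/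
def J (x : M) : TangentSpace 𝓘(ℝ, Cn n) x →L[ℝ] TangentSpace 𝓘(ℝ, Cn n) x :=
  (Complex.I • ContinuousLinearMap.id ℝ (Cn n) : Cn n →L[ℝ] Cn n)

variable [IsManifold 𝓘(ℂ, Cn n) ω M]

/-- Smooth Riemannian metrics on the real manifold underlying `M`. -/
abbrev Metric (n : ℕ) (M : Type*) [TopologicalSpace M] [ChartedSpace (Cn n) M]
    [IsManifold 𝓘(ℂ, Cn n) ω M] :=
  Bundle.ContMDiffRiemannianMetric 𝓘(ℝ, Cn n) ∞ (Cn n) (fun x : M => TangentSpace 𝓘(ℝ, Cn n) x)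

/-- The holomorphic coordinate systems of `M`. -/
abbrev coords (n : ℕ) (M : Type*) [TopologicalSpace M] [ChartedSpace (Cn n) M] :
    Set (OpenPartialHomeomorph M (Cn n)) :=
  IsManifold.maximalAtlas 𝓘(ℂ, Cn n) ω M

/-- The metric `g` in the coordinate system `e`: the value at the coordinates `z` on `v, w`. -/
def localMetric (g : Metric n M) (e : OpenPartialHomeomorph M (Cn n)) (z v w : Cn n) : ℝ :=
  g.inner (e.symm z) (mfderiv 𝓘(ℝ, Cn n) 𝓘(ℝ, Cn n) e.symm z v)
    (mfderiv 𝓘(ℝ, Cn n) 𝓘(ℝ, Cn n) e.symm z w)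

/-- The fundamental form `ω(v, w) = g(Jv, w)` in the coordinate system `e`. -/
def localForm (g : Metric n M) (e : OpenPartialHomeomorph M (Cn n)) (z v w : Cn n) : ℝ :=
  localMetric g e z (Complex.I • v) w

/-- A Kähler metric: a Riemannian metric which is Hermitian (`J` is an isometry) and whose
fundamental form `ω` is closed. In coordinates, `dω (u, v, w)` for constant `u, v, w` is the cyclic
sum of the derivatives of `ω(v, w)` in the direction `u`. -/
structure IsKahler (g : Metric n M) : Prop where
  hermitian : ∀ (x : M) (v w : TangentSpace 𝓘(ℝ, Cn n) x), g.inner x (J x v) (J x w) = g.inner x v w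
  closed : ∀ e ∈ coords n M, ∀ z ∈ e.target, ∀ u v w : Cn n,
    fderiv ℝ (fun z' => localForm g e z' v w) z u
      + fderiv ℝ (fun z' => localForm g e z' w u) z v
      + fderiv ℝ (fun z' => localForm g e z' u v) z w = 0

/-! ### The Ricci form -/

/-- The coordinate vector `∂/∂x_α`, where `z_α = x_α + i y_α`. -/
def basisVec (α : Fin n) : Cn n := EuclideanSpace.single α 1

/-- The Wirtinger derivative `∂f/∂z_α = (∂f/∂x_α - i ∂f/∂y_α) / 2`. -/
def dz (α : Fin n) (f : Cn n → ℂ) (z : Cn n) : ℂ :=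
  (fderiv ℝ f z (basisVec α) - Complex.I * fderiv ℝ f z (Complex.I • basisVec α)) / 2

/-- The Wirtinger derivative `∂f/∂z̄_α = (∂f/∂x_α + i ∂f/∂y_α) / 2`. -/
def dzbar (α : Fin n) (f : Cn n → ℂ) (z : Cn n) : ℂ :=
  (fderiv ℝ f z (basisVec α) + Complex.I * fderiv ℝ f z (Complex.I • basisVec α)) / 2

/-- The matrix `g_{αβ̄}` of a Hermitian metric in the coordinate system `e`. It is determined by
`g(v, w) = Re ∑ g_{αβ̄} v_α conj w_β` and equivalently by `ω = (i/2) ∑ g_{αβ̄} dz_α ∧ dz̄_β`. -/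
def metricMatrix (g : Metric n M) (e : OpenPartialHomeomorph M (Cn n)) (z : Cn n) :
    Matrix (Fin n) (Fin n) ℂ :=
  Matrix.of fun α β => (localMetric g e z (basisVec α) (basisVec β) : ℂ)
    + Complex.I * (localMetric g e z (basisVec α) (Complex.I • basisVec β) : ℂ)

/-- The matrix `ρ_{αβ̄} = -2 ∂²/∂z_α∂z̄_β log det g` of the Ricci form
`ρ = -i ∂∂̄ log det g = (i/2) ∑ ρ_{αβ̄} dz_α ∧ dz̄_β` in the coordinate system `e`.
The determinant is real and positive on `e.target`. -/
def ricciMatrix (g : Metric n M) (e : OpenPartialHomeomorph M (Cn n)) (z : Cn n) :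
    Matrix (Fin n) (Fin n) ℂ :=
  Matrix.of fun α β =>
    -2 * dz α (dzbar β fun z' => (Real.log (metricMatrix g e z').det.re : ℂ)) z

/-- `g` is Einstein with Einstein constant `c`: the Ricci form is `ρ = c ω`. -/
def IsEinstein (g : Metric n M) (c : ℝ) : Prop :=
  ∀ e ∈ coords n M, ∀ z ∈ e.target, ricciMatrix g e z = (c : ℂ) • metricMatrix g e z

/-! ### The Fubini–Study metric and Kähler immersions -/

/-- The Fubini–Study metric of `ℂPᴺ` of holomorphic sectional curvature `4`, the Kähler metric with
local potential `log (1 + |z|²)` in affine coordinates (`ω_FS = (i/2) ∂∂̄ log (1 + |z|²)`):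
`g_FS(v, w) = Re ∑ ∂²log(1 + |z|²)/∂z_α∂z̄_β v_α conj w_β`. Here `z` are the affine coordinates of
`p` in the affine chart through which the tangent space at `p` is identified with `ℂᴺ`. -/
def fubiniStudy {N : ℕ} (p : CP N) (v w : TangentSpace 𝓘(ℝ, Cn N) p) : ℝ :=
  let z : Cn N := chartAt (Cn N) p p
  let v' : Cn N := v
  let w' : Cn N := w
  (inner ℂ w' v' / (1 + ‖z‖ ^ 2 : ℝ)
    - inner ℂ z v' * inner ℂ w' z / ((1 + ‖z‖ ^ 2 : ℝ) : ℂ) ^ 2 : ℂ).re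

/-- `f : (M, g) → (ℂPᴺ, g_FS)` is a Kähler immersion: it is holomorphic and isometric. -/
structure IsKahlerImmersion (g : Metric n M) {N : ℕ} (f : M → CP N) : Prop where
  holomorphic : ContMDiff 𝓘(ℂ, Cn n) 𝓘(ℂ, Cn N) ω f
  isometric : ∀ (x : M) (v w : TangentSpace 𝓘(ℝ, Cn n) x),
    fubiniStudy (f x) (mfderiv 𝓘(ℝ, Cn n) 𝓘(ℝ, Cn N) f x v)
      (mfderiv 𝓘(ℝ, Cn n) 𝓘(ℝ, Cn N) f x w) = g.inner x v w

end Kahler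

end KahlerProj

end

noncomputable section
set_option linter.unusedSectionVars false

namespace KahlerProj

open Topology

/-! Assume `c ≤ 0`. Fix `p` and a unit vector `a` representing `f p`. Off the hyperplane orthogonal
to `a`, let `F = Z / ⟪a, Z⟫` be the normalized lift of `f`; in coordinates it is a holomorphic map
`Φ`, and the metric is the complex Hessian of `log ‖Φ‖²` (`localMetric_eq`, `metricMatrix_eq_gram`).
Put `b_β = ∂_β Φ` at `p` and `y_β = ⟪b_β, F⟫`, with Jacobian matrix `J = jac b Φ`.

Volume identity (`det_gram_eq_of_einstein`). The Einstein equation makes `θ = log det g + (c/2) log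
‖Φ‖² - log |det J|²` pluriharmonic, so `∂θ` is holomorphic. The normalization `Φ(z₀) = a`, `⟪a, Φ⟫ =
1` puts `∂θ` in the ideal generated by conjugates of holomorphic functions vanishing at `z₀`
(`Flat`). Elements of this ideal have no purely holomorphic Taylor coefficients, so `∂θ = 0` and
`θ`, being real, is constant: `det g · ‖F‖^c = κ |det J|²` with `κ > 0`. By analyticity the set
`volSet`, where this persists, is open, and relatively closed off the hyperplane.

Algebraicity (`exists_linear_relation`, `exists_polynomial_relation`). On a compact manifold,
Siegel's argument shows that more than `O(dⁿ)` forms of degree `d` are linearly dependent. Counting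
monomials in `n + 1` functions, every coordinate of `F` is algebraic over `y₁, …, y_n`, and some
nonzero polynomial `Q` makes `|Q(y)| ‖F‖` grow at most polynomially in `‖y‖` (`exists_denominator`).

Maximum principle. The function `‖F‖² |Q(y)|⁴ exp(-s ‖y‖²)` tends to `0` at the hyperplane, so it
attains a positive maximum on `volSet` (`exists_max_barrier`). As `log |Q(y)|` is pluriharmonic
where `Q(y) ≠ 0`, at the maximum `∂∂̄ log ‖F‖² ≤ s ∂∂̄ ‖y‖²`, hence `det g ≤ sⁿ |det J|²`. But `‖F‖
≥ 1` and `c ≤ 0` turn the volume identity into `κ |det J|² ≤ det g`. Thus `κ ≤ sⁿ`, which fails for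
small `s`. -/

/-- The Hermitian form `∂∂̄ log |q|²` on the tangent vectors `a`, `b` at `q`. -/
def hform {V : Type*} [NormedAddCommGroup V] [InnerProductSpace ℂ V] (q a b : V) : ℂ :=
  inner ℂ b a / ((‖q‖ : ℂ) ^ 2) - inner ℂ q a * inner ℂ b q / ((‖q‖ : ℂ) ^ 2) ^ 2

/-! ### Algebra of the Fubini–Study form on homogeneous vectors -/

section hform

variable {V : Type*} [NormedAddCommGroup V] [InnerProductSpace ℂ V]

theorem hform_smul_right (q a b : V) (t : ℂ) :
    hform q a (t • b) = (starRingEnd ℂ) t * hform q a b := by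
  simp only [hform, inner_smul_left]; ring

theorem hform_smul_left (q a b : V) (t : ℂ) : hform q (t • a) b = t * hform q a b := by
  simp only [hform, inner_smul_right]; ring

theorem hform_add_left (q a a' b : V) : hform q (a + a') b = hform q a b + hform q a' b := by
  simp only [hform, inner_add_right]; ring

theorem hform_add_right (q a b b' : V) : hform q a (b + b') = hform q a b + hform q a b' := by
  simp only [hform, inner_add_left]; ring

theorem hform_conj (q a b : V) : (starRingEnd ℂ) (hform q a b) = hform q b a := by
  simp only [hform, map_sub, map_div₀, map_mul, map_pow, inner_conj_symm, Complex.conj_ofReal]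
  ring

theorem hform_self_left {q : V} (hq : q ≠ 0) (b : V) : hform q q b = 0 := by
  have : (‖q‖ : ℂ) ≠ 0 := by simpa using hq
  rw [hform, inner_self_eq_norm_sq_to_K]
  field_simp
  simp

theorem hform_self_right {q : V} (hq : q ≠ 0) (a : V) : hform q a q = 0 := by
  rw [← hform_conj, hform_self_left hq, map_zero]

/-- In dimension one every vector is a multiple of `q`, the null direction of the form. Applied to
derivatives, this says that `log |h|²` is pluriharmonic where the holomorphic function `h` does not
vanish. -/
theorem hform_eq_zero_of_scalar {q : ℂ} (hq : q ≠ 0) (a b : ℂ) : hform q a b = 0 := by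
  have h := hform_smul_right q a q (b / q)
  rwa [hform_self_right hq, smul_eq_mul, div_mul_cancel₀ _ hq, mul_zero] at h

theorem hform_smul_smul_smul (q a b : V) {t : ℂ} (ht : t ≠ 0) :
    hform (t • q) (t • a) (t • b) = hform q a b := by
  have h1 : (‖t • q‖ : ℂ) ^ 2 = t * (starRingEnd ℂ) t * (‖q‖ : ℂ) ^ 2 := by
    rw [norm_smul, Complex.mul_conj, Complex.normSq_eq_norm_sq]
    push_cast; ring
  have h2 : (starRingEnd ℂ) t ≠ 0 := by simpa using ht
  rw [hform, h1, hform]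
  simp only [inner_smul_left, inner_smul_right]
  congr 1
  · rw [← mul_assoc, mul_comm t, mul_div_mul_left]
    exact mul_ne_zero h2 ht
  · rw [show (t * (starRingEnd ℂ) t * (‖q‖ : ℂ) ^ 2) ^ 2
        = (t * (starRingEnd ℂ) t) ^ 2 * ((‖q‖ : ℂ) ^ 2) ^ 2 by ring,
      show t * ((starRingEnd ℂ) t * inner ℂ q a) * (t * ((starRingEnd ℂ) t * inner ℂ b q))
        = (t * (starRingEnd ℂ) t) ^ 2 * (inner ℂ q a * inner ℂ b q) by ring, mul_div_mul_left]
    exact pow_ne_zero _ (mul_ne_zero ht h2)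

/-- `hform` only depends on the projective data: rescaling the lift does not change it. -/
theorem hform_rescale {q : V} (hq : q ≠ 0) (a b : V) {t : ℂ} (ht : t ≠ 0) (μ ν : ℂ) :
    hform (t • q) (t • a + μ • q) (t • b + ν • q) = hform q a b := by
  have hμ : t • a + μ • q = t • (a + (μ / t) • q) := by
    rw [smul_add, smul_smul, mul_div_cancel₀ _ ht]
  have hν : t • b + ν • q = t • (b + (ν / t) • q) := by
    rw [smul_add, smul_smul, mul_div_cancel₀ _ ht]
  rw [hμ, hν, hform_smul_smul_smul _ _ _ ht]
  simp [hform_add_left, hform_add_right, hform_smul_left, hform_smul_right, hform_self_left hq,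
    hform_self_right hq]

end hform

/-! ### Normalized and affine lifts of points of projective space -/

/-- The space of homogeneous coordinates of `ℂPᴺ`, with its Hermitian inner product. -/
abbrev HV (N : ℕ) : Type := EuclideanSpace ℂ (Fin (N + 1))

/-- A homogeneous coordinate vector of a point. -/
def CP.vec {N : ℕ} (q : CP N) : HV N := WithLp.toLp 2 (Projectivization.rep q)

theorem CP.vec_ne_zero {N : ℕ} (q : CP N) : q.vec ≠ 0 := by
  intro h
  apply Projectivization.rep_nonzero q
  exact (WithLp.toLp_eq_zero 2).1 h

/-- The vector `CP.vec` is an arbitrary choice of representative. This scalar is how facts about it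
are transferred to continuous or holomorphic lifts. -/
theorem CP.vec_mk {N : ℕ} (Z : {Z : Fin (N + 1) → ℂ // Z ≠ 0}) :
    ∃ t : ℂ, t ≠ 0 ∧ (CP.mk Z).vec = t • (WithLp.toLp 2 Z.1 : HV N) := by
  obtain ⟨a, ha⟩ := Projectivization.exists_smul_eq_mk_rep ℂ Z.1 Z.2
  refine ⟨a, a.ne_zero, ?_⟩
  have : (CP.mk Z).vec = WithLp.toLp 2 ((Projectivization.mk ℂ Z.1 Z.2).rep) := rfl
  rw [this, ← ha]
  rfl

/-- The homogeneous coordinates of `q` normalized by `⟪a, Z⟫ = 1` (zero if this is impossible). -/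
def CP.nlift {N : ℕ} (a : HV N) (q : CP N) : HV N := (inner ℂ a q.vec)⁻¹ • q.vec

/-- The complement of the hyperplane orthogonal to `a`. -/
def CP.compl {N : ℕ} (a : HV N) : Set (CP N) := {q | inner ℂ a q.vec ≠ 0}

theorem CP.nlift_of_eq {N : ℕ} (a : HV N) (q : CP N) (Z : HV N) (t : ℂ) (ht : t ≠ 0)
    (h : q.vec = t • Z) : CP.nlift a q = (inner ℂ a Z)⁻¹ • Z := by
  rw [CP.nlift, h, inner_smul_right, smul_smul]
  congr 1
  rw [mul_inv, mul_comm, ← mul_assoc, mul_inv_cancel₀ ht, one_mul]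

theorem CP.mem_compl_of_eq {N : ℕ} (a : HV N) (q : CP N) (Z : HV N) (t : ℂ) (ht : t ≠ 0)
    (h : q.vec = t • Z) : q ∈ CP.compl a ↔ inner ℂ a Z ≠ 0 := by
  change inner ℂ a q.vec ≠ 0 ↔ _
  rw [h, inner_smul_right]
  simp [ht]

theorem CP.isOpen_compl {N : ℕ} (a : HV N) : IsOpen (CP.compl a) := by
  rw [← CP.isQuotientMap_mk.isOpen_preimage]
  have : CP.mk ⁻¹' CP.compl a =
      {Z : {Z : Fin (N + 1) → ℂ // Z ≠ 0} | inner ℂ a (WithLp.toLp 2 Z.1 : HV N) ≠ 0} := by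
    ext Z
    obtain ⟨t, ht, h⟩ := CP.vec_mk Z
    exact CP.mem_compl_of_eq a _ _ t ht h
  rw [this]
  refine isOpen_ne_fun ?_ continuous_const
  exact continuous_const.inner ((PiLp.continuous_toLp 2 _).comp continuous_subtype_val)

theorem CP.inner_nlift {N : ℕ} {a : HV N} {q : CP N} (h : q ∈ CP.compl a) :
    inner ℂ a (CP.nlift a q) = 1 := by
  rw [CP.nlift, inner_smul_right]
  exact inv_mul_cancel₀ h

theorem CP.nlift_ne_zero {N : ℕ} {a : HV N} {q : CP N} (h : q ∈ CP.compl a) :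
    CP.nlift a q ≠ 0 := by
  intro h0
  simpa [h0] using CP.inner_nlift h

/-- The lift of the affine chart `i` with `1` in the `i`-th place. -/
def CP.alift {N : ℕ} (i : Fin (N + 1)) (z : Cn N) : HV N := WithLp.toLp 2 (CP.homog i z).1

theorem CP.vec_alift {N : ℕ} (i : Fin (N + 1)) {q : CP N} (hq : q ∈ CP.affineDomain i) :
    ∃ t : ℂ, t ≠ 0 ∧ q.vec = t • CP.alift i (CP.affineCoord i q) := by
  obtain ⟨t, ht, h⟩ := CP.vec_mk (CP.homog i (CP.affineCoord i q))
  refine ⟨t, ht, ?_⟩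
  have : CP.mk (CP.homog i (CP.affineCoord i q)) = q := (CP.affineChart i).left_inv hq
  rw [this] at h
  exact h

/-- The linear part of `CP.alift`. -/
def CP.insZero {N : ℕ} (i : Fin (N + 1)) : Cn N →L[ℂ] HV N :=
  LinearMap.toContinuousLinearMap
    { toFun := fun z => WithLp.toLp 2 (i.insertNth (0 : ℂ) (fun k => z k))
      map_add' := fun x y => by
        ext j
        refine Fin.succAboveCases i ?_ (fun k => ?_) j <;> simp
      map_smul' := fun c x => by
        ext j
        refine Fin.succAboveCases i ?_ (fun k => ?_) j <;> simp }

theorem CP.insZero_apply {N : ℕ} (i : Fin (N + 1)) (z : Cn N) :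
    CP.insZero i z = WithLp.toLp 2 (i.insertNth (0 : ℂ) (fun k => z k)) := rfl

theorem CP.alift_eq {N : ℕ} (i : Fin (N + 1)) (z : Cn N) :
    CP.alift i z = CP.alift i 0 + CP.insZero i z := by
  ext j
  rw [CP.insZero_apply]
  refine Fin.succAboveCases i ?_ (fun k => ?_) j <;> simp [CP.alift, CP.homog]

theorem CP.hasFDerivAt_alift {N : ℕ} (i : Fin (N + 1)) (z : Cn N) :
    HasFDerivAt (CP.alift i) (CP.insZero i) z := by
  have : CP.alift i = fun z => CP.alift i 0 + CP.insZero i z := funext (CP.alift_eq i)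
  rw [this]
  exact (CP.insZero i).hasFDerivAt.const_add _

theorem CP.analyticAt_alift {N : ℕ} (i : Fin (N + 1)) (z : Cn N) :
    AnalyticAt ℂ (CP.alift i) z := by
  have : CP.alift i = fun z => CP.alift i 0 + CP.insZero i z := funext (CP.alift_eq i)
  rw [this]
  exact analyticAt_const.add ((CP.insZero i).analyticAt z)

theorem CP.alift_ne_zero {N : ℕ} (i : Fin (N + 1)) (z : Cn N) : CP.alift i z ≠ 0 := by
  intro h
  exact (CP.homog i z).2 ((WithLp.toLp_eq_zero 2).1 h)

theorem CP.inner_eq_sum {N : ℕ} (a b : HV N) :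
    inner ℂ a b = ∑ j, (starRingEnd ℂ) (a j) * b j := by
  simp [PiLp.inner_apply, mul_comm]

theorem CP.inner_insZero {N : ℕ} (i : Fin (N + 1)) (v w : Cn N) :
    inner ℂ (CP.insZero i v) (CP.insZero i w) = inner ℂ v w := by
  rw [CP.inner_eq_sum, Fin.sum_univ_succAbove _ i]
  simp [CP.insZero_apply, PiLp.inner_apply, mul_comm]

theorem CP.inner_alift_insZero {N : ℕ} (i : Fin (N + 1)) (z w : Cn N) :
    inner ℂ (CP.alift i z) (CP.insZero i w) = inner ℂ z w := by
  rw [CP.inner_eq_sum, Fin.sum_univ_succAbove _ i]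
  simp [CP.insZero_apply, CP.alift, CP.homog, PiLp.inner_apply, mul_comm]

theorem CP.norm_alift_sq {N : ℕ} (i : Fin (N + 1)) (z : Cn N) :
    ‖CP.alift i z‖ ^ 2 = 1 + ‖z‖ ^ 2 := by
  rw [EuclideanSpace.norm_sq_eq, Fin.sum_univ_succAbove _ i, EuclideanSpace.norm_sq_eq]
  simp [CP.alift, CP.homog]

theorem exists_chartAt_eq {N : ℕ} (q : CP N) :
    ∃ i, q ∈ CP.affineDomain i ∧ chartAt (Cn N) q = CP.affineChart i :=
  ⟨(CP.exists_mem_affineDomain q).choose, (CP.exists_mem_affineDomain q).choose_spec, rfl⟩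

/-- The Fubini–Study metric through the lift of the affine chart. -/
theorem fubiniStudy_eq {N : ℕ} {q : CP N} {i : Fin (N + 1)}
    (hi : chartAt (Cn N) q = CP.affineChart i) (v w : Cn N) :
    fubiniStudy q v w =
      (hform (CP.alift i (CP.affineCoord i q)) (CP.insZero i v) (CP.insZero i w)).re := by
  have h1 : (chartAt (Cn N) q) q = CP.affineCoord i q := by rw [hi]; rfl
  have h2 : ((‖CP.alift i (CP.affineCoord i q)‖ : ℂ)) ^ 2
      = ((1 + ‖CP.affineCoord i q‖ ^ 2 : ℝ) : ℂ) := by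
    rw [← CP.norm_alift_sq i]; push_cast; rfl
  simp only [fubiniStudy, hform, h1, h2, CP.inner_insZero, CP.inner_alift_insZero]
  rw [← inner_conj_symm (CP.insZero i w), CP.inner_alift_insZero, inner_conj_symm]

/-! ### Holomorphic lifts of the immersion -/

section lift

variable {n : ℕ} {M : Type*} [TopologicalSpace M] [ChartedSpace (Cn n) M]
  {N : ℕ} {f : M → CP N}

theorem analyticAt_affineCoord (hf : ContMDiff 𝓘(ℂ, Cn n) 𝓘(ℂ, Cn N) ω f)
    {e : OpenPartialHomeomorph M (Cn n)} (he : e ∈ coords n M) {z : Cn n} (hz : z ∈ e.target)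
    {i : Fin (N + 1)} (hi : f (e.symm z) ∈ CP.affineDomain i) :
    AnalyticAt ℂ (fun z' => CP.affineCoord i (f (e.symm z'))) z := by
  have h1 : ContMDiffAt 𝓘(ℂ, Cn n) 𝓘(ℂ, Cn n) ω e.symm z :=
    contMDiffAt_symm_of_mem_maximalAtlas he hz
  have h2 : ContMDiffAt 𝓘(ℂ, Cn N) 𝓘(ℂ, Cn N) ω (CP.affineChart i) (f (e.symm z)) :=
    contMDiffAt_of_mem_maximalAtlas
      (IsManifold.subset_maximalAtlas (show CP.affineChart i ∈ atlas (Cn N) (CP N) from ⟨i, rfl⟩)) hi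
  have h3 := h2.comp z (hf.contMDiffAt.comp z h1)
  exact (contMDiffAt_iff_contDiffAt.1 h3).analyticAt

theorem eventually_mem_of_mem {M : Type*} [TopologicalSpace M] {f : M → CP N} (hf : Continuous f) {e : OpenPartialHomeomorph M (Cn n)} {z : Cn n}
    (hz : z ∈ e.target) {U : Set (CP N)} (hU : IsOpen U) (h : f (e.symm z) ∈ U) :
    ∀ᶠ z' in 𝓝 z, f (e.symm z') ∈ U :=
  (hf.continuousAt.comp (e.continuousAt_symm hz)).eventually (hU.mem_nhds h)

/-- Near a point, the normalized lift is obtained from the lift of an affine chart. -/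
theorem nlift_eventuallyEq {M : Type*} [TopologicalSpace M] {f : M → CP N} (hf : Continuous f) {e : OpenPartialHomeomorph M (Cn n)} {z : Cn n}
    (hz : z ∈ e.target) {i : Fin (N + 1)} (hi : f (e.symm z) ∈ CP.affineDomain i) (a : HV N) :
    (fun z' => CP.nlift a (f (e.symm z'))) =ᶠ[𝓝 z] fun z' =>
      (inner ℂ a (CP.alift i (CP.affineCoord i (f (e.symm z')))))⁻¹ •
        CP.alift i (CP.affineCoord i (f (e.symm z'))) := by
  filter_upwards [eventually_mem_of_mem hf hz (CP.isOpen_affineDomain i) hi] with z' hz'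
  obtain ⟨t, ht, h⟩ := CP.vec_alift i hz'
  exact CP.nlift_of_eq a _ _ t ht h

theorem analyticAt_alift_comp (hf : ContMDiff 𝓘(ℂ, Cn n) 𝓘(ℂ, Cn N) ω f)
    {e : OpenPartialHomeomorph M (Cn n)} (he : e ∈ coords n M) {z : Cn n} (hz : z ∈ e.target)
    {i : Fin (N + 1)} (hi : f (e.symm z) ∈ CP.affineDomain i) :
    AnalyticAt ℂ (fun z' => CP.alift i (CP.affineCoord i (f (e.symm z')))) z :=
  (CP.analyticAt_alift i _).comp_of_eq (analyticAt_affineCoord hf he hz hi) rfl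

theorem inner_alift_ne_zero {a : HV N} {q : CP N} (h : q ∈ CP.compl a) {i : Fin (N + 1)}
    (hi : q ∈ CP.affineDomain i) : inner ℂ a (CP.alift i (CP.affineCoord i q)) ≠ 0 := by
  obtain ⟨t, ht, h'⟩ := CP.vec_alift i hi
  exact (CP.mem_compl_of_eq a _ _ t ht h').1 h

theorem analyticAt_nlift (hf : ContMDiff 𝓘(ℂ, Cn n) 𝓘(ℂ, Cn N) ω f)
    {e : OpenPartialHomeomorph M (Cn n)} (he : e ∈ coords n M) {z : Cn n} (hz : z ∈ e.target)
    {a : HV N} (ha : f (e.symm z) ∈ CP.compl a) :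
    AnalyticAt ℂ (fun z' => CP.nlift a (f (e.symm z'))) z := by
  obtain ⟨i, hi⟩ := CP.exists_mem_affineDomain (f (e.symm z))
  rw [analyticAt_congr (nlift_eventuallyEq hf.continuous hz hi a)]
  have h := analyticAt_alift_comp hf he hz hi
  have h2 : AnalyticAt ℂ (fun z' =>
      inner ℂ a (CP.alift i (CP.affineCoord i (f (e.symm z'))))) z :=
    ((innerSL ℂ a).analyticAt _).comp_of_eq h rfl
  exact (h2.inv (inner_alift_ne_zero ha hi)).smul h

end lift

/-! ### The induced metric through the normalized lift -/

section metric

variable {n : ℕ} {M : Type*} [TopologicalSpace M] [ChartedSpace (Cn n) M]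
  {N : ℕ} {f : M → CP N}

theorem mdifferentiableAt_real (hf : ContMDiff 𝓘(ℂ, Cn n) 𝓘(ℂ, Cn N) ω f) (x : M) :
    MDifferentiableAt 𝓘(ℝ, Cn n) 𝓘(ℝ, Cn N) f x := by
  have h := (hf.mdifferentiable (by simp)) x
  refine ⟨h.1, ?_⟩
  have h2 := h.2
  exact DifferentiableWithinAt.restrictScalars ℝ h2

theorem mdifferentiableAt_symm_real {e : OpenPartialHomeomorph M (Cn n)}
    (he : e ∈ coords n M) {z : Cn n} (hz : z ∈ e.target) :
    MDifferentiableAt 𝓘(ℝ, Cn n) 𝓘(ℝ, Cn n) e.symm z := by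
  have h1 : ContMDiffAt 𝓘(ℂ, Cn n) 𝓘(ℂ, Cn n) ω e.symm z :=
    contMDiffAt_symm_of_mem_maximalAtlas he hz
  have h := h1.mdifferentiableAt (by simp)
  refine ⟨h.1, ?_⟩
  have h2 := h.2
  exact DifferentiableWithinAt.restrictScalars ℝ h2

/-- The metric in coordinates, through the normalized lift of the immersion. -/
theorem localMetric_eq [IsManifold 𝓘(ℂ, Cn n) ω M] {g : Metric n M} (hf : IsKahlerImmersion g f)
    {e : OpenPartialHomeomorph M (Cn n)} (he : e ∈ coords n M) {z : Cn n} (hz : z ∈ e.target)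
    {a : HV N} (ha : f (e.symm z) ∈ CP.compl a) (v w : Cn n) :
    localMetric g e z v w =
      (hform (CP.nlift a (f (e.symm z)))
        (fderiv ℂ (fun z' => CP.nlift a (f (e.symm z'))) z v)
        (fderiv ℂ (fun z' => CP.nlift a (f (e.symm z'))) z w)).re := by
  obtain ⟨i, hi, hchart⟩ := exists_chartAt_eq (f (e.symm z))
  set ζ : Cn n → Cn N := fun z' => CP.affineCoord i (f (e.symm z')) with hζ
  have hζa : AnalyticAt ℂ ζ z := analyticAt_affineCoord hf.holomorphic he hz hi
  have hcomp : ∀ v : Cn n, mfderiv 𝓘(ℝ, Cn n) 𝓘(ℝ, Cn N) f (e.symm z)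
      (mfderiv 𝓘(ℝ, Cn n) 𝓘(ℝ, Cn n) e.symm z v) = fderiv ℂ ζ z v := by
    intro v
    refine (mfderiv_comp_apply z (mdifferentiableAt_real hf.holomorphic _)
      (mdifferentiableAt_symm_real he hz) v).symm.trans ?_
    have hd := (mdifferentiableAt_real hf.holomorphic _).comp z
      (mdifferentiableAt_symm_real he hz)
    rw [hd.mfderiv]
    -- The chart of `ℂPᴺ` used by the manifold derivative is the one at `f (e.symm z)`, which is the
    -- affine chart `i`; the manifold derivative is thus the ordinary derivative of `ζ`.
    have h1 : writtenInExtChartAt 𝓘(ℝ, Cn n) 𝓘(ℝ, Cn N) z (f ∘ e.symm) = ζ := by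
      ext1 z'
      simp only [writtenInExtChartAt, extChartAt, Function.comp_apply, hζ]
      rw [hchart]
      rfl
    rw [h1]
    simp only [modelWithCornersSelf_coe, Set.range_id, fderivWithin_univ]
    have h2 := (hζa.differentiableAt.hasFDerivAt.restrictScalars ℝ).fderiv
    have h3 : extChartAt 𝓘(ℝ, Cn n) z z = z := rfl
    rw [h3, h2]
    rfl
  rw [localMetric, ← hf.isometric]
  have key := fubiniStudy_eq hchart (fderiv ℂ ζ z v) (fderiv ℂ ζ z w)
  rw [hcomp v, hcomp w]
  refine key.trans ?_
  congr 1
  -- compare the two lifts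
  set A : Cn n → HV N := fun z' => CP.alift i (ζ z') with hA
  have hAd : HasFDerivAt A ((CP.insZero i).comp (fderiv ℂ ζ z)) z :=
    (CP.hasFDerivAt_alift i _).comp z hζa.differentiableAt.hasFDerivAt
  set s : Cn n → ℂ := fun z' => (inner ℂ a (A z'))⁻¹ with hs
  have hA0 : inner ℂ a (A z) ≠ 0 := inner_alift_ne_zero ha hi
  have hsd : DifferentiableAt ℂ s z :=
    DifferentiableAt.inv (((innerSL ℂ a).differentiableAt).comp z hAd.differentiableAt) hA0
  have hev := nlift_eventuallyEq hf.holomorphic.continuous hz hi a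
  -- The normalized lift is `s • A`. The product rule adds a multiple of `A z` to the scaled
  -- derivative, and `hform_rescale` discards it.
  have hder : ∀ u, fderiv ℂ (fun z' => CP.nlift a (f (e.symm z'))) z u
      = s z • CP.insZero i (fderiv ℂ ζ z u) + (fderiv ℂ s z u) • A z := by
    intro u
    rw [hev.fderiv_eq]
    have := (hsd.hasFDerivAt.smul hAd).fderiv
    erw [this]
    simp
  rw [hder v, hder w, hev.eq_of_nhds]
  exact (hform_rescale (CP.alift_ne_zero i _) _ _ (inv_ne_zero hA0) _ _).symm

end metric

/-! ### Wirtinger derivatives in arbitrary directions -/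

section Wirtinger

variable {E : Type*} [NormedAddCommGroup E] [NormedSpace ℂ E] [NormedSpace ℝ E]

/-- The `(1,0)`-part of the derivative of `f` in the direction `v`. -/
def wd (v : E) (f : E → ℂ) (z : E) : ℂ :=
  (fderiv ℝ f z v - Complex.I * fderiv ℝ f z (Complex.I • v)) / 2

/-- The `(0,1)`-part of the derivative of `f` in the direction `v`. -/
def wdbar (v : E) (f : E → ℂ) (z : E) : ℂ :=
  (fderiv ℝ f z v + Complex.I * fderiv ℝ f z (Complex.I • v)) / 2

/-- A real-linear map to `ℂ` is a complex-linear part plus a conjugate-linear part, with values `P`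
and `Q` at `v`. Multiplying `v` by `i` gives `iP - iQ`, so the two hypotheses identify the parts. -/
theorem wd_of_split {f : E → ℂ} {L : E →L[ℝ] ℂ} {z v : E} {P Q : ℂ} (h : HasFDerivAt f L z)
    (h1 : L v = P + Q) (h2 : L (Complex.I • v) = Complex.I * P - Complex.I * Q) :
    wd v f z = P := by
  rw [wd, h.fderiv, h1, h2]
  linear_combination (-P / 2 + Q / 2) * Complex.I_mul_I

theorem wdbar_of_split {f : E → ℂ} {L : E →L[ℝ] ℂ} {z v : E} {P Q : ℂ} (h : HasFDerivAt f L z)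
    (h1 : L v = P + Q) (h2 : L (Complex.I • v) = Complex.I * P - Complex.I * Q) :
    wdbar v f z = Q := by
  rw [wdbar, h.fderiv, h1, h2]
  linear_combination (P / 2 - Q / 2) * Complex.I_mul_I

theorem fderiv_eq_wd_add_wdbar (v : E) (f : E → ℂ) (z : E) :
    fderiv ℝ f z v = wd v f z + wdbar v f z := by
  rw [wd, wdbar]; ring

theorem fderiv_I_smul_eq (v : E) (f : E → ℂ) (z : E) :
    fderiv ℝ f z (Complex.I • v) = Complex.I * wd v f z - Complex.I * wdbar v f z := by
  rw [wd, wdbar]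
  linear_combination (fderiv ℝ f z (Complex.I • v)) * Complex.I_mul_I

theorem wd_congr {v : E} {f g : E → ℂ} {z : E} (h : f =ᶠ[𝓝 z] g) : wd v f z = wd v g z := by
  rw [wd, wd, h.fderiv_eq]

theorem wdbar_congr {v : E} {f g : E → ℂ} {z : E} (h : f =ᶠ[𝓝 z] g) :
    wdbar v f z = wdbar v g z := by
  rw [wdbar, wdbar, h.fderiv_eq]

theorem wd_eventuallyEq {v : E} {f g : E → ℂ} {z : E} (h : f =ᶠ[𝓝 z] g) :
    wd v f =ᶠ[𝓝 z] wd v g :=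
  h.eventuallyEq_nhds.mono fun _ h => wd_congr h

theorem wd_add {v : E} {f g : E → ℂ} {z : E} (hf : DifferentiableAt ℝ f z)
    (hg : DifferentiableAt ℝ g z) :
    wd v (fun x => f x + g x) z = wd v f z + wd v g z := by
  rw [wd, wd, wd, fderiv_fun_add hf hg]
  simp only [add_apply]; ring

theorem wdbar_add {v : E} {f g : E → ℂ} {z : E} (hf : DifferentiableAt ℝ f z)
    (hg : DifferentiableAt ℝ g z) :
    wdbar v (fun x => f x + g x) z = wdbar v f z + wdbar v g z := by
  rw [wdbar, wdbar, wdbar, fderiv_fun_add hf hg]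
  simp only [add_apply]; ring

theorem wd_sub {v : E} {f g : E → ℂ} {z : E} (hf : DifferentiableAt ℝ f z)
    (hg : DifferentiableAt ℝ g z) :
    wd v (fun x => f x - g x) z = wd v f z - wd v g z := by
  rw [wd, wd, wd, fderiv_fun_sub hf hg]
  simp only [sub_apply]; ring

theorem wdbar_sub {v : E} {f g : E → ℂ} {z : E} (hf : DifferentiableAt ℝ f z)
    (hg : DifferentiableAt ℝ g z) :
    wdbar v (fun x => f x - g x) z = wdbar v f z - wdbar v g z := by
  rw [wdbar, wdbar, wdbar, fderiv_fun_sub hf hg]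
  simp only [sub_apply]; ring

theorem wd_const_mul {v : E} {f : E → ℂ} {z : E} (c : ℂ) (hf : DifferentiableAt ℝ f z) :
    wd v (fun x => c * f x) z = c * wd v f z := by
  rw [wd, wd, (hf.hasFDerivAt.const_mul c).fderiv]
  simp only [smul_apply, smul_eq_mul]; ring

theorem wdbar_const_mul {v : E} {f : E → ℂ} {z : E} (c : ℂ) (hf : DifferentiableAt ℝ f z) :
    wdbar v (fun x => c * f x) z = c * wdbar v f z := by
  rw [wdbar, wdbar, (hf.hasFDerivAt.const_mul c).fderiv]
  simp only [smul_apply, smul_eq_mul]; ring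

theorem wd_mul {v : E} {f g : E → ℂ} {z : E} (hf : DifferentiableAt ℝ f z)
    (hg : DifferentiableAt ℝ g z) :
    wd v (fun x => f x * g x) z = wd v f z * g z + f z * wd v g z := by
  rw [wd, wd, wd, fderiv_fun_mul hf hg]
  simp only [add_apply, smul_apply, smul_eq_mul]; ring

theorem conj_wdbar_ofReal {v : E} {f : E → ℝ} {z : E}
    (hf : DifferentiableAt ℝ (fun x => (f x : ℂ)) z) :
    (starRingEnd ℂ) (wdbar v (fun x => (f x : ℂ)) z) = wd v (fun x => (f x : ℂ)) z := by
  have hc : ∀ u, (starRingEnd ℂ) (fderiv ℝ (fun x => (f x : ℂ)) z u)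
      = fderiv ℝ (fun x => (f x : ℂ)) z u := by
    intro u
    have h1 : HasFDerivAt (fun x => (starRingEnd ℂ) (f x : ℂ))
        ((Complex.conjCLE : ℂ →L[ℝ] ℂ).comp (fderiv ℝ (fun x => (f x : ℂ)) z)) z :=
      (Complex.conjCLE : ℂ →L[ℝ] ℂ).hasFDerivAt.comp z hf.hasFDerivAt
    simp only [Complex.conj_ofReal] at h1
    conv_rhs => rw [h1.fderiv]
    rfl
  simp only [wd, wdbar, map_div₀, map_add, map_mul, hc, Complex.conj_I, map_ofNat]
  ring

/-- The logarithmic derivative of a positive function. -/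
theorem hasFDerivAt_log_ofReal {r : E → ℝ} {ρ : E → ℂ} {z : E} (hρ : ∀ᶠ x in 𝓝 z, ρ x = (r x : ℂ))
    (hd : DifferentiableAt ℝ ρ z) (hr : r z ≠ 0) :
    HasFDerivAt (fun x => (Real.log (r x) : ℂ)) ((ρ z)⁻¹ • fderiv ℝ ρ z) z := by
  have h1 : HasFDerivAt (fun x => (r x : ℂ)) (fderiv ℝ ρ z) z :=
    hd.hasFDerivAt.congr_of_eventuallyEq (hρ.mono fun x hx => hx.symm)
  have h2 : HasFDerivAt r (Complex.reCLM.comp (fderiv ℝ ρ z)) z :=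
    Complex.reCLM.hasFDerivAt.comp z h1
  have h3 := (Complex.ofRealCLM.hasFDerivAt (x := r z)).comp z h2
  -- Being real near `z`, `ρ` has a differential with real values, so nothing is lost by passing to
  -- its real part.
  have h4 : fderiv ℝ ρ z = Complex.ofRealCLM.comp (Complex.reCLM.comp (fderiv ℝ ρ z)) :=
    h1.unique h3
  have h5 := (Complex.ofRealCLM.hasFDerivAt (x := Real.log (r z))).comp z (h2.log hr)
  refine h5.congr_fderiv ?_
  ext u
  have h6 : fderiv ℝ ρ z u = (((fderiv ℝ ρ z u).re : ℝ) : ℂ) := DFunLike.congr_fun h4 u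
  simp only [ContinuousLinearMap.comp_apply, smul_apply, smul_eq_mul,
    hρ.self_of_nhds]
  rw [h6]
  simp

theorem wd_log {v : E} {r : E → ℝ} {ρ : E → ℂ} {z : E} (hρ : ∀ᶠ x in 𝓝 z, ρ x = (r x : ℂ))
    (hd : DifferentiableAt ℝ ρ z) (hr : r z ≠ 0) :
    wd v (fun x => (Real.log (r x) : ℂ)) z = wd v ρ z / ρ z := by
  rw [wd, (hasFDerivAt_log_ofReal hρ hd hr).fderiv, wd]
  simp only [smul_apply, smul_eq_mul]; ring

theorem wdbar_log {v : E} {r : E → ℝ} {ρ : E → ℂ} {z : E} (hρ : ∀ᶠ x in 𝓝 z, ρ x = (r x : ℂ))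
    (hd : DifferentiableAt ℝ ρ z) (hr : r z ≠ 0) :
    wdbar v (fun x => (Real.log (r x) : ℂ)) z = wdbar v ρ z / ρ z := by
  rw [wdbar, (hasFDerivAt_log_ofReal hρ hd hr).fderiv, wdbar]
  simp only [smul_apply, smul_eq_mul]; ring

theorem AnalyticAt.wd {v : E} {f : E → ℂ} {z : E} (hf : AnalyticAt ℝ f z) :
    AnalyticAt ℝ (wd v f) z := by
  have h : ∀ u, AnalyticAt ℝ (fun x => fderiv ℝ f x u) z := fun u => by
    have := (ContinuousLinearMap.apply ℝ ℂ u).analyticAt (fderiv ℝ f z)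
    exact this.comp_of_eq hf.fderiv rfl
  exact ((h v).sub (analyticAt_const.mul (h _))).div analyticAt_const two_ne_zero

theorem AnalyticAt.wdbar {v : E} {f : E → ℂ} {z : E} (hf : AnalyticAt ℝ f z) :
    AnalyticAt ℝ (wdbar v f) z := by
  have h : ∀ u, AnalyticAt ℝ (fun x => fderiv ℝ f x u) z := fun u => by
    have := (ContinuousLinearMap.apply ℝ ℂ u).analyticAt (fderiv ℝ f z)
    exact this.comp_of_eq hf.fderiv rfl
  exact ((h v).add (analyticAt_const.mul (h _))).div analyticAt_const two_ne_zero

variable [IsScalarTower ℝ ℂ E]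

theorem wd_hol {v : E} {f : E → ℂ} {z : E} (hf : DifferentiableAt ℂ f z) :
    wd v f z = fderiv ℂ f z v :=
  wd_of_split (Q := 0) (hf.hasFDerivAt.restrictScalars ℝ) (by simp) (by simp)

section inner

variable {V : Type*} [NormedAddCommGroup V] [InnerProductSpace ℂ V] [NormedSpace ℝ V]
  [IsScalarTower ℝ ℂ V]

theorem hasFDerivAt_inner {A B : E → V} {z : E} (hA : DifferentiableAt ℂ A z)
    (hB : DifferentiableAt ℂ B z) :
    HasFDerivAt (fun x => inner ℂ (A x) (B x))
      ((fderivInnerCLM ℂ (A z, B z)).comp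
        (((fderiv ℂ A z).restrictScalars ℝ).prod ((fderiv ℂ B z).restrictScalars ℝ))) z :=
  (hA.hasFDerivAt.restrictScalars ℝ).inner ℂ (hB.hasFDerivAt.restrictScalars ℝ)

theorem wd_inner {v : E} {A B : E → V} {z : E} (hA : DifferentiableAt ℂ A z)
    (hB : DifferentiableAt ℂ B z) :
    wd v (fun x => inner ℂ (A x) (B x)) z = inner ℂ (A z) (fderiv ℂ B z v) := by
  refine wd_of_split (Q := inner ℂ (fderiv ℂ A z v) (B z)) (hasFDerivAt_inner hA hB) ?_ ?_
  · simp
  · simp [inner_smul_left, inner_smul_right]; ring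

theorem wdbar_inner {v : E} {A B : E → V} {z : E} (hA : DifferentiableAt ℂ A z)
    (hB : DifferentiableAt ℂ B z) :
    wdbar v (fun x => inner ℂ (A x) (B x)) z = inner ℂ (fderiv ℂ A z v) (B z) := by
  refine wdbar_of_split (P := inner ℂ (A z) (fderiv ℂ B z v)) (hasFDerivAt_inner hA hB) ?_ ?_
  · simp
  · simp [inner_smul_left, inner_smul_right]; ring

theorem analyticAt_inner [CompleteSpace V] {A B : E → V} {z : E} (hA : AnalyticAt ℝ A z)
    (hB : AnalyticAt ℝ B z) : AnalyticAt ℝ (fun x => inner ℂ (A x) (B x)) z := by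
  have h : AnalyticAt ℝ (fun p : V × V => (inner ℂ p.1 p.2 : ℂ)) (A z, B z) :=
    (contDiffAt_inner (𝕜 := ℂ) (n := ω)).analyticAt
  exact h.comp_of_eq (hA.prod hB) rfl

theorem inner_self_eq_ofReal (q : V) : inner ℂ q q = ((‖q‖ ^ 2 : ℝ) : ℂ) := by
  rw [inner_self_eq_norm_sq_to_K]; norm_cast

theorem analyticAt_fderiv_apply [CompleteSpace V] {A : E → V} {z : E} (hA : AnalyticAt ℂ A z)
    (v : E) : AnalyticAt ℂ (fun x => fderiv ℂ A x v) z := by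
  have := (ContinuousLinearMap.apply ℂ V v).analyticAt (fderiv ℂ A z)
  exact this.comp_of_eq hA.fderiv rfl

/-- The potential `log ‖A‖²`. -/
theorem analyticAt_log_norm_sq [CompleteSpace V] {A : E → V} {z : E} (hA : AnalyticAt ℂ A z)
    (h0 : A z ≠ 0) : AnalyticAt ℝ (fun x => Real.log (‖A x‖ ^ 2)) z := by
  have h1 := Complex.reCLM.analyticAt (inner ℂ (A z) (A z))
  have h2 := h1.comp_of_eq (analyticAt_inner hA.restrictScalars hA.restrictScalars) rfl
  have h3 : (fun x => ‖A x‖ ^ 2) = Complex.reCLM ∘ (fun x => inner ℂ (A x) (A x)) := by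
    ext x
    rw [Function.comp_apply, inner_self_eq_ofReal]
    rfl
  rw [← h3] at h2
  exact (_root_.analyticAt_log (by positivity)).comp_of_eq h2 rfl

theorem analyticAt_ofReal {r : E → ℝ} {z : E} (h : AnalyticAt ℝ r z) :
    AnalyticAt ℝ (fun x => (r x : ℂ)) z :=
  (Complex.ofRealCLM.analyticAt (r z)).comp_of_eq h rfl

theorem wd_log_norm_sq {A : E → V} {z : E} (hA : DifferentiableAt ℂ A z)
    (h0 : A z ≠ 0) (v : E) :
    wd v (fun x => (Real.log (‖A x‖ ^ 2) : ℂ)) z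
      = inner ℂ (A z) (fderiv ℂ A z v) / inner ℂ (A z) (A z) := by
  rw [← wd_inner hA hA]
  exact wd_log (Filter.Eventually.of_forall fun x => inner_self_eq_ofReal (A x))
    (hasFDerivAt_inner hA hA).differentiableAt (by positivity)

theorem wdbar_log_norm_sq {A : E → V} {z : E} (hA : DifferentiableAt ℂ A z)
    (h0 : A z ≠ 0) (v : E) :
    wdbar v (fun x => (Real.log (‖A x‖ ^ 2) : ℂ)) z
      = inner ℂ (fderiv ℂ A z v) (A z) / inner ℂ (A z) (A z) := by
  rw [← wdbar_inner hA hA]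
  exact wdbar_log (Filter.Eventually.of_forall fun x => inner_self_eq_ofReal (A x))
    (hasFDerivAt_inner hA hA).differentiableAt (by positivity)

/-- This identifies the form of the metric with the complex Hessian of the potential `log ‖A‖²`.
With `A` scalar-valued it also yields the pluriharmonicity of `log |A|²`. -/
theorem wd_wdbar_log_norm_sq [CompleteSpace V] {A : E → V} {z : E} (hA : AnalyticAt ℂ A z)
    (h0 : A z ≠ 0) (v w : E) :
    wd v (wdbar w (fun x => (Real.log (‖A x‖ ^ 2) : ℂ))) z
      = hform (A z) (fderiv ℂ A z v) (fderiv ℂ A z w) := by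
  have hAd := hA.differentiableAt
  have hev : wdbar w (fun x => (Real.log (‖A x‖ ^ 2) : ℂ)) =ᶠ[𝓝 z]
      fun x => inner ℂ (fderiv ℂ A x w) (A x) * (inner ℂ (A x) (A x))⁻¹ := by
    filter_upwards [hA.eventually_analyticAt, hA.continuousAt.eventually_ne h0] with x hx hx0
    rw [wdbar_log_norm_sq hx.differentiableAt hx0, div_eq_mul_inv]
  have hq : inner ℂ (A z) (A z) ≠ 0 := inner_self_ne_zero.2 h0
  have hB := (analyticAt_fderiv_apply hA w).differentiableAt
  have hi1 := hasFDerivAt_inner hB hAd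
  have hi2 := hasFDerivAt_inner hAd hAd
  have hinv : DifferentiableAt ℝ (fun x => (inner ℂ (A x) (A x))⁻¹) z := hi2.differentiableAt.inv hq
  rw [wd_congr hev, wd_mul hi1.differentiableAt hinv, wd_inner hB hAd]
  have h3 : wd v (fun x => (inner ℂ (A x) (A x))⁻¹) z
      = - inner ℂ (A z) (fderiv ℂ A z v) / (inner ℂ (A z) (A z)) ^ 2 := by
    -- The derivative of the reciprocal comes from the product rule applied to `q · q⁻¹ = 1`.
    have h4 : wd v (fun x => inner ℂ (A x) (A x) * (inner ℂ (A x) (A x))⁻¹) z = 0 := by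
      have h5 : (fun x => inner ℂ (A x) (A x) * (inner ℂ (A x) (A x))⁻¹) =ᶠ[𝓝 z]
          fun _ => (1 : ℂ) := by
        filter_upwards [hA.continuousAt.eventually_ne h0] with x hx
        exact mul_inv_cancel₀ (inner_self_ne_zero.2 hx)
      rw [wd_congr h5]
      simp [wd]
    rw [wd_mul hi2.differentiableAt hinv, wd_inner hAd hAd] at h4
    field_simp
    field_simp at h4
    linear_combination h4
  rw [h3, hform, show ((‖A z‖ : ℂ) ^ 2) = inner ℂ (A z) (A z) by
    rw [inner_self_eq_norm_sq_to_K]; rfl]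
  field_simp
  ring

end inner

end Wirtinger

/-! ### Functions without pure holomorphic Taylor coefficients -/

section Flat

variable {E : Type*} [NormedAddCommGroup E] [NormedSpace ℂ E] [NormedSpace ℝ E]

/-- The ideal of germs at `z₀` generated by the conjugates of the holomorphic functions
vanishing at `z₀`. -/
inductive Flat (z₀ : E) : (E → ℂ) → Prop
  | conj (a : E → ℂ) : AnalyticAt ℂ a z₀ → a z₀ = 0 → Flat z₀ (fun z => (starRingEnd ℂ) (a z))
  | add (f g : E → ℂ) : Flat z₀ f → Flat z₀ g → Flat z₀ (fun z => f z + g z)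
  | mul (u f : E → ℂ) : AnalyticAt ℝ u z₀ → Flat z₀ f → Flat z₀ (fun z => u z * f z)
  | congr (f g : E → ℂ) : f =ᶠ[𝓝 z₀] g → Flat z₀ f → Flat z₀ g

namespace Flat

variable {z₀ : E} {f g : E → ℂ}

theorem eq_zero (h : Flat z₀ f) : f z₀ = 0 := by
  induction h with
  | conj a _ h => simp [h]
  | add f g _ _ h1 h2 => simp [h1, h2]
  | mul u f _ _ h => simp [h]
  | congr f g h _ h1 => rw [← h.eq_of_nhds, h1]

theorem zero : Flat z₀ (fun _ => 0) := by
  simpa using Flat.conj (z₀ := z₀) (fun _ => 0) analyticAt_const rfl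

theorem neg (h : Flat z₀ f) : Flat z₀ (fun z => - f z) := by
  simpa using Flat.mul (fun _ => -1) f analyticAt_const h

theorem sub (hf : Flat z₀ f) (hg : Flat z₀ g) : Flat z₀ (fun z => f z - g z) := by
  simpa [sub_eq_add_neg] using Flat.add _ _ hf hg.neg

theorem mul_right {u : E → ℂ} (hf : Flat z₀ f) (hu : AnalyticAt ℝ u z₀) :
    Flat z₀ (fun z => f z * u z) := by
  simpa [mul_comm] using Flat.mul _ _ hu hf

theorem sum {ι : Type*} (s : Finset ι) (F : ι → E → ℂ) (h : ∀ i ∈ s, Flat z₀ (F i)) :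
    Flat z₀ (fun z => ∑ i ∈ s, F i z) := by
  classical
  induction s using Finset.induction_on with
  | empty => simpa using zero
  | insert i s hi ih =>
    simp only [Finset.sum_insert hi]
    exact Flat.add _ _ (h i (Finset.mem_insert_self _ _))
      (ih fun j hj => h j (Finset.mem_insert_of_mem hj))

variable [IsScalarTower ℝ ℂ E]

theorem analyticAt (h : Flat z₀ f) : AnalyticAt ℝ f z₀ := by
  induction h with
  | conj a h _ =>
    exact ((Complex.conjCLE : ℂ →L[ℝ] ℂ).analyticAt _).comp_of_eq h.restrictScalars rfl
  | add f g _ _ h1 h2 => exact h1.add h2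
  | mul u f h _ h1 => exact h.mul h1
  | congr f g h _ h1 => exact h1.congr h

/-- The operator `∂` kills the generators, which are antiholomorphic, and obeys the Leibniz rule;
hence it preserves the ideal. -/
theorem wd (h : Flat z₀ f) (v : E) : Flat z₀ (wd v f) := by
  induction h with
  | conj a h _ =>
    refine Flat.congr _ _ ?_ zero
    filter_upwards [h.eventually_analyticAt] with z hz
    -- Writing the conjugate as an inner product with the constant `1` reduces the claim to the
    -- derivative of a constant.
    have h1 : (fun x => (starRingEnd ℂ) (a x)) = fun x => inner ℂ (a x) (1 : ℂ) := by
      ext x; simp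
    rw [h1, wd_inner hz.differentiableAt (differentiableAt_const _)]
    simp
  | add f g hf hg h1 h2 =>
    refine Flat.congr _ _ ?_ (Flat.add _ _ h1 h2)
    filter_upwards [hf.analyticAt.eventually_analyticAt, hg.analyticAt.eventually_analyticAt]
      with z hz hz'
    rw [wd_add hz.differentiableAt hz'.differentiableAt]
  | mul u f hu hf h1 =>
    refine Flat.congr _ _ ?_ (Flat.add _ _ (Flat.mul _ _ (AnalyticAt.wd (v := v) hu) hf)
      (Flat.mul _ _ hu h1))
    filter_upwards [hf.analyticAt.eventually_analyticAt, hu.eventually_analyticAt]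
      with z hz hz'
    rw [wd_mul hz'.differentiableAt hz.differentiableAt]
  | congr f g h hf h1 => exact Flat.congr _ _ (wd_eventuallyEq h) h1

theorem comp_line (h : Flat z₀ f) (v : E) : Flat (0 : ℂ) (fun t => f (z₀ + t • v)) := by
  have hl : AnalyticAt ℂ (fun t : ℂ => z₀ + t • v) 0 := by fun_prop
  induction h with
  | conj a h h0 =>
    exact Flat.conj (fun t => a (z₀ + t • v)) (h.comp_of_eq hl (by simp)) (by simp [h0])
  | add f g _ _ h1 h2 => exact Flat.add _ _ h1 h2
  | mul u f h _ h1 =>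
    exact Flat.mul (fun t => u (z₀ + t • v)) _
      (h.comp_of_eq (hl.restrictScalars (𝕜 := ℝ)) (by simp)) h1
  | congr f g h _ h1 =>
    refine Flat.congr _ _ ?_ h1
    have : Filter.Tendsto (fun t : ℂ => z₀ + t • v) (𝓝 0) (𝓝 z₀) := by
      simpa using hl.continuousAt.tendsto
    exact this.eventually h

/-- For holomorphic `f` the derivative is `∂f`, which stays in the ideal by `Flat.wd`, and members
of the ideal vanish at the base point. -/
theorem iteratedDeriv_eq_zero (k : ℕ) : ∀ {f : ℂ → ℂ}, Flat (0 : ℂ) f → AnalyticAt ℂ f 0 →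
    iteratedDeriv k f 0 = 0 := by
  induction k with
  | zero => intro f h _; simpa using h.eq_zero
  | succ k ih =>
    intro f h hf
    rw [iteratedDeriv_succ']
    refine ih (Flat.congr _ _ ?_ (h.wd 1)) hf.deriv
    filter_upwards [hf.eventually_analyticAt] with z hz
    rw [wd_hol hz.differentiableAt]
    rfl

/-- A holomorphic function in the ideal vanishes. -/
theorem eventually_eq_zero (h : Flat z₀ f) (hf : ∀ᶠ z in 𝓝 z₀, DifferentiableAt ℂ f z) :
    ∀ᶠ z in 𝓝 z₀, f z = 0 := by
  obtain ⟨r, hr, hball⟩ := Metric.eventually_nhds_iff_ball.1 hf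
  refine Metric.eventually_nhds_iff_ball.2 ⟨r, hr, fun z hz => ?_⟩
  set v := z - z₀ with hv
  have hvr : ‖v‖ < r := by simpa [dist_eq_norm] using hz
  -- The part of the complex line through `z₀` and `z` lying in the ball: a convex open set of
  -- parameters containing `0` (for `z₀`) and `1` (for `z`). The one-variable identity theorem is
  -- applied there.
  set U : Set ℂ := {t | ‖t • v‖ < r} with hU
  have hUo : IsOpen U := isOpen_lt (by fun_prop) continuous_const
  have hUc : Convex ℝ U := by
    have : U = (fun t : ℂ => t • v) ⁻¹' Metric.ball 0 r := by ext; simp [hU]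
    rw [this]
    exact (convex_ball (0 : E) r).is_linear_preimage
      (IsLinearMap.mk (fun x y => add_smul x y v) (fun c x => smul_assoc c x v))
  have hd : DifferentiableOn ℂ (fun t : ℂ => f (z₀ + t • v)) U := by
    intro t ht
    have h1 : DifferentiableAt ℂ f (z₀ + t • v) := hball _ (by
      rw [Metric.mem_ball, dist_eq_norm, add_sub_cancel_left]; exact ht)
    have h2 : DifferentiableAt ℂ (fun t : ℂ => z₀ + t • v) t := by fun_prop
    exact (DifferentiableAt.comp t h1 h2).differentiableWithinAt
  have han := hd.analyticOnNhd hUo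
  have h0U : (0 : ℂ) ∈ U := by simpa [hU] using hr
  have h1U : (1 : ℂ) ∈ U := by simpa [hU] using hvr
  have hz0 : ∀ᶠ t in 𝓝 (0 : ℂ), f (z₀ + t • v) = 0 := by
    rw [← analyticOrderAt_eq_top]
    rw [ENat.eq_top_iff_forall_ge]
    intro k
    rw [natCast_le_analyticOrderAt_iff_iteratedDeriv_eq_zero (han 0 h0U)]
    exact fun i _ => iteratedDeriv_eq_zero i (h.comp_line v) (han 0 h0U)
  have := han.eqOn_zero_of_preconnected_of_eventuallyEq_zero hUc.isPreconnected h0U hz0 h1U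
  simpa [hv] using this

end Flat

end Flat

/-! ### The local volume identity of a Kähler–Einstein metric -/

theorem sum_basisVec {n : ℕ} (v : Cn n) : ∑ α, v α • basisVec α = v := by
  ext i
  simp [basisVec, Pi.single_apply]

/-- A function whose `(1,0)`-derivatives vanish is antiholomorphic. -/
theorem differentiableAt_conj_of_wd_eq_zero {n : ℕ} {k : Cn n → ℂ} {z : Cn n}
    (hk : DifferentiableAt ℝ k z) (h : ∀ α, wd (basisVec α) k z = 0) :
    DifferentiableAt ℂ (fun x => (starRingEnd ℂ) (k x)) z := by
  have hd : HasFDerivAt (fun x => (starRingEnd ℂ) (k x))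
      ((Complex.conjCLE : ℂ →L[ℝ] ℂ).comp (fderiv ℝ k z)) z :=
    (Complex.conjCLE : ℂ →L[ℝ] ℂ).hasFDerivAt.comp z hk.hasFDerivAt
  rw [differentiableAt_iff_restrictScalars ℝ hd.differentiableAt, hd.fderiv]
  -- The candidate for the complex differential, fixed by its values on the coordinate vectors. The
  -- vanishing of the `(1,0)`-derivatives makes `fderiv ℝ k z` conjugate-linear, so its conjugate
  -- agrees with `g`.
  let g : Cn n →L[ℂ] ℂ := ∑ α, (EuclideanSpace.proj α : Cn n →L[ℂ] ℂ).smulRight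
    ((starRingEnd ℂ) (fderiv ℝ k z (basisVec α)))
  refine ⟨g, ?_⟩
  ext v
  have hI : ∀ α, fderiv ℝ k z (Complex.I • basisVec α)
      = - (Complex.I * fderiv ℝ k z (basisVec α)) := by
    intro α
    have h1 := fderiv_I_smul_eq (basisVec α) k z
    have h2 := fderiv_eq_wd_add_wdbar (basisVec α) k z
    rw [h α] at h1 h2
    rw [h1, h2]; ring
  have hc : ∀ (c : ℂ) α, fderiv ℝ k z (c • basisVec α)
      = (starRingEnd ℂ) c * fderiv ℝ k z (basisVec α) := by
    intro c α
    have : c • basisVec α = c.re • basisVec α + c.im • (Complex.I • basisVec (n := n) α) := by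
      conv_lhs => rw [← Complex.re_add_im c]
      rw [add_smul, mul_smul]
      rfl
    rw [this, map_add, map_smul, map_smul, hI]
    conv_rhs => rw [← Complex.re_add_im c]
    simp only [Complex.real_smul, map_add, map_mul, Complex.conj_ofReal, Complex.conj_I]
    ring
  have hg : g v = ∑ α, v α * (starRingEnd ℂ) (fderiv ℝ k z (basisVec α)) := by
    simp [g]
  change g v = (starRingEnd ℂ) (fderiv ℝ k z v)
  rw [hg]
  conv_rhs => rw [← sum_basisVec v]
  simp [map_sum, hc]

/-- A function with vanishing Wirtinger derivatives has zero differential. -/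
theorem fderiv_eq_zero_of_wd_eq_zero {n : ℕ} {k : Cn n → ℂ} {z : Cn n}
    (h : ∀ α, wd (basisVec α) k z = 0) (h' : ∀ α, wdbar (basisVec α) k z = 0) :
    fderiv ℝ k z = 0 := by
  ext v
  have h1 : ∀ α, fderiv ℝ k z (basisVec α) = 0 := fun α => by
    rw [fderiv_eq_wd_add_wdbar, h, h', add_zero]
  have h2 : ∀ α, fderiv ℝ k z (Complex.I • basisVec α) = 0 := fun α => by
    rw [fderiv_I_smul_eq, h, h']; simp
  have hc : ∀ (c : ℂ) α, fderiv ℝ k z (c • basisVec α) = 0 := by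
    intro c α
    have : c • basisVec α = c.re • basisVec α + c.im • (Complex.I • basisVec (n := n) α) := by
      conv_lhs => rw [← Complex.re_add_im c]
      rw [add_smul, mul_smul]
      rfl
    rw [this, map_add, map_smul, map_smul, h1, h2]; simp
  rw [← sum_basisVec v, map_sum]
  simp [hc]

/-! ### Gram and Jacobian matrices, and the volume identity at a normalized point -/

section gram

variable {n N : ℕ}

/-- The matrix `∂_α ∂̄_β log ‖Φ‖²`. -/
def gram (Φ : Cn n → HV N) (z : Cn n) : Matrix (Fin n) (Fin n) ℂ :=
  Matrix.of fun α β =>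
    hform (Φ z) (fderiv ℂ Φ z (basisVec α)) (fderiv ℂ Φ z (basisVec β))

/-- The Jacobian matrix of the functions `⟪b_β, Φ⟫`. -/
def jac (b : Fin n → HV N) (Φ : Cn n → HV N) (z : Cn n) : Matrix (Fin n) (Fin n) ℂ :=
  Matrix.of fun α β => inner ℂ (b β) (fderiv ℂ Φ z (basisVec α))

theorem gram_isHermitian (Φ : Cn n → HV N) (z : Cn n) : (gram Φ z).IsHermitian := by
  ext α β
  simp [gram, Matrix.conjTranspose_apply, hform_conj]

theorem gram_det_eq_ofReal (Φ : Cn n → HV N) (z : Cn n) :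
    (gram Φ z).det = (((gram Φ z).det.re : ℝ) : ℂ) := by
  have h : star (gram Φ z).det = (gram Φ z).det := by
    rw [← Matrix.det_conjTranspose, (gram_isHermitian Φ z).eq]
  exact (Complex.conj_eq_iff_re.1 h).symm

variable {Φ : Cn n → HV N} {z₀ : Cn n}

theorem analyticAt_matrix_det {E : Type*} [NormedAddCommGroup E] {𝕜 : Type*}
    [NontriviallyNormedField 𝕜] [NormedSpace 𝕜 E] [NormedAlgebra 𝕜 ℂ] {z₀ : E}
    {A : E → Matrix (Fin n) (Fin n) ℂ} (h : ∀ i j, AnalyticAt 𝕜 (fun z => A z i j) z₀) :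
    AnalyticAt 𝕜 (fun z => (A z).det) z₀ := by
  simp only [Matrix.det_apply']
  refine Finset.analyticAt_fun_sum _ fun σ _ => ?_
  exact analyticAt_const.mul (Finset.analyticAt_fun_prod _ fun i _ => h _ _)

theorem analyticAt_gram (hΦ : AnalyticAt ℂ Φ z₀) (h0 : Φ z₀ ≠ 0) (α β : Fin n) :
    AnalyticAt ℝ (fun z => gram Φ z α β) z₀ := by
  have h1 : AnalyticAt ℝ (fun z => (Real.log (‖Φ z‖ ^ 2) : ℂ)) z₀ :=
    analyticAt_ofReal (analyticAt_log_norm_sq hΦ h0)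
  refine (AnalyticAt.wd (v := basisVec α) (AnalyticAt.wdbar (v := basisVec β) h1)).congr ?_
  filter_upwards [hΦ.eventually_analyticAt, hΦ.continuousAt.eventually_ne h0] with z hz hz0
  rw [wd_wdbar_log_norm_sq hz hz0]
  rfl

theorem analyticAt_jac (b : Fin n → HV N) (hΦ : AnalyticAt ℂ Φ z₀) (α β : Fin n) :
    AnalyticAt ℂ (fun z => jac b Φ z α β) z₀ :=
  ((innerSL ℂ (b β)).analyticAt _).comp_of_eq (analyticAt_fderiv_apply hΦ (basisVec α)) rfl

namespace Flat

/-- The inner product is a sum of products `conj (A_j) B_j`, and each `conj (A_j)` is a generator of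
the ideal. -/
theorem inner_of_eq_zero {A B : Cn n → HV N} (hA : AnalyticAt ℂ A z₀) (h0 : A z₀ = 0)
    (hB : AnalyticAt ℂ B z₀) : Flat z₀ (fun z => inner ℂ (A z) (B z)) := by
  have hc : ∀ {C : Cn n → HV N}, AnalyticAt ℂ C z₀ → ∀ j, AnalyticAt ℂ (fun z => C z j) z₀ :=
    fun hC j => ((EuclideanSpace.proj j : HV N →L[ℂ] ℂ).analyticAt _).comp_of_eq hC rfl
  simp only [CP.inner_eq_sum]
  refine Flat.sum _ _ fun j _ => ?_
  exact (Flat.conj (fun z => A z j) (hc hA j) (by simp [h0])).mul_right (hc hB j).restrictScalars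

theorem prod_sub {ι : Type*} (s : Finset ι) (F G : ι → Cn n → ℂ)
    (hF : ∀ i, AnalyticAt ℝ (F i) z₀) (hG : ∀ i, AnalyticAt ℝ (G i) z₀)
    (h : ∀ i, Flat z₀ (fun z => F i z - G i z)) :
    Flat z₀ (fun z => ∏ i ∈ s, F i z - ∏ i ∈ s, G i z) := by
  classical
  induction s using Finset.induction_on with
  | empty => simpa using zero
  | insert i s hi ih =>
    simp only [Finset.prod_insert hi]
    have h1 := Flat.add _ _ (Flat.mul _ _ (hF i) ih)
      ((h i).mul_right (Finset.analyticAt_fun_prod s fun j _ => hG j))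
    refine Flat.congr _ _ (Filter.Eventually.of_forall fun z => ?_) h1
    simp only []; ring

/-- Congruence modulo an ideal passes through products and sums, hence through the Leibniz expansion
of the determinant. -/
theorem det_sub {A B : Cn n → Matrix (Fin n) (Fin n) ℂ}
    (hA : ∀ i j, AnalyticAt ℝ (fun z => A z i j) z₀)
    (hB : ∀ i j, AnalyticAt ℝ (fun z => B z i j) z₀)
    (h : ∀ i j, Flat z₀ (fun z => A z i j - B z i j)) :
    Flat z₀ (fun z => (A z).det - (B z).det) := by
  simp only [Matrix.det_apply', ← Finset.sum_sub_distrib, ← mul_sub]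
  refine Flat.sum _ _ fun σ _ => Flat.mul (fun _ => _) _ analyticAt_const ?_
  exact prod_sub _ _ _ (fun i => hA _ _) (fun i => hB _ _) (fun i => h _ _)

end Flat

variable {a : HV N}

/-- Since `⟪a, Φ⟫ = 1`, the difference equals `⟪Φ - a, Φ⟫`, whose conjugated slot vanishes at `z₀`.
-/
theorem flat_inner_self_sub_one (hΦ : AnalyticAt ℂ Φ z₀)
    (ha : ∀ᶠ z in 𝓝 z₀, inner ℂ a (Φ z) = 1) (h0 : Φ z₀ = a) :
    Flat z₀ (fun z => inner ℂ (Φ z) (Φ z) - 1) := by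
  refine Flat.congr _ _ ?_ (Flat.inner_of_eq_zero (hΦ.sub (analyticAt_const (v := a)))
    (by simp [h0]) hΦ)
  filter_upwards [ha] with z hz
  simp [hz]

/-- Modulo the ideal, each vector in a conjugated slot may be replaced by its value at `z₀`. So
`‖Φ‖²` becomes `1`, `⟪Φ, ∂_α Φ⟫` becomes `⟪a, ∂_α Φ⟫ = 0`, and `⟪∂_β Φ, ∂_α Φ⟫` becomes the
holomorphic entry of `jac`. -/
theorem flat_gram_sub_jac (hΦ : AnalyticAt ℂ Φ z₀)
    (ha : ∀ᶠ z in 𝓝 z₀, inner ℂ a (Φ z) = 1) (h0 : Φ z₀ = a) (α β : Fin n) :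
    Flat z₀ (fun z => gram Φ z α β
      - jac (fun β => fderiv ℂ Φ z₀ (basisVec β)) Φ z α β) := by
  have hne : Φ z₀ ≠ 0 := by
    intro h
    have := ha.self_of_nhds
    rw [h, inner_zero_right] at this
    exact zero_ne_one this
  have hα := analyticAt_fderiv_apply hΦ (basisVec α)
  have hβ := analyticAt_fderiv_apply hΦ (basisVec β)
  have hs : AnalyticAt ℝ (fun z => (inner ℂ (Φ z) (Φ z))⁻¹) z₀ :=
    (analyticAt_inner hΦ.restrictScalars hΦ.restrictScalars).inv (inner_self_ne_zero.2 hne)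
  have f1 : Flat z₀ (fun z => inner ℂ (fderiv ℂ Φ z (basisVec β) - fderiv ℂ Φ z₀ (basisVec β))
      (fderiv ℂ Φ z (basisVec α))) :=
    Flat.inner_of_eq_zero (hβ.sub analyticAt_const) (by simp) hα
  have f2 : Flat z₀ (fun z => inner ℂ (Φ z - a) (fderiv ℂ Φ z (basisVec α))) :=
    Flat.inner_of_eq_zero (hΦ.sub analyticAt_const) (by simp [h0]) hα
  have f3 := flat_inner_self_sub_one hΦ ha h0
  have j1 := (analyticAt_jac (fun β => fderiv ℂ Φ z₀ (basisVec β)) hΦ α β).restrictScalars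
    (𝕜 := ℝ)
  have i1 := analyticAt_inner hβ.restrictScalars hΦ.restrictScalars
  -- With `σ = ‖Φ‖⁻²` and `j` the entry of `jac`, the first two terms combine to `σ ⟪∂_β Φ, ∂_α Φ⟫ -
  -- j`; the third is the correction term of `hform`, thanks to `⟪a, ∂_α Φ⟫ = 0`.
  have key := Flat.sub (Flat.sub (f1.mul_right hs) ((f3.mul_right hs).mul_right j1))
    (((f2.mul_right i1).mul_right hs).mul_right hs)
  refine Flat.congr _ _ ?_ key
  -- Differentiate `⟪a, Φ⟫ = 1`.
  have hder : ∀ᶠ z in 𝓝 z₀, inner ℂ a (fderiv ℂ Φ z (basisVec α)) = 0 := by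
    filter_upwards [ha.eventually_nhds, hΦ.eventually_analyticAt] with z hz hz'
    have h1 : HasFDerivAt (fun x => inner ℂ a (Φ x)) ((innerSL ℂ a).comp (fderiv ℂ Φ z)) z :=
      (innerSL ℂ a).hasFDerivAt.comp z hz'.differentiableAt.hasFDerivAt
    have h2 : HasFDerivAt (fun x => inner ℂ a (Φ x)) (0 : Cn n →L[ℂ] ℂ) z :=
      (hasFDerivAt_const (1 : ℂ) z).congr_of_eventuallyEq hz
    exact DFunLike.congr_fun (h1.unique h2) (basisVec α)
  filter_upwards [hder, hΦ.continuousAt.eventually_ne hne] with z hz hz0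
  have hq : inner ℂ (Φ z) (Φ z) ≠ 0 := inner_self_ne_zero.2 hz0
  simp only [gram, jac, Matrix.of_apply, hform, inner_sub_left, hz]
  rw [show ((‖Φ z‖ : ℂ) ^ 2) = inner ℂ (Φ z) (Φ z) by rw [inner_self_eq_norm_sq_to_K]; rfl]
  field_simp
  ring

/-- The volume identity: for a Kähler–Einstein metric with potential `log ‖Φ‖²`, with `Φ`
normalized at `z₀`. -/
theorem det_gram_eq_of_einstein (hΦ : AnalyticAt ℂ Φ z₀)
    (ha : ∀ᶠ z in 𝓝 z₀, inner ℂ a (Φ z) = 1) (h0 : Φ z₀ = a)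
    (hpos : 0 < (gram Φ z₀).det.re) {c : ℝ}
    (hE : ∀ᶠ z in 𝓝 z₀, ∀ α β, -2 * dz α (dzbar β fun z' => (Real.log (gram Φ z').det.re : ℂ)) z
      = c * gram Φ z α β) :
    ∀ᶠ z in 𝓝 z₀, (gram Φ z).det.re * Real.exp (c / 2 * Real.log (‖Φ z‖ ^ 2))
      = ((gram Φ z₀).det.re)⁻¹
        * ‖(jac (fun β => fderiv ℂ Φ z₀ (basisVec β)) Φ z).det‖ ^ 2 := by
  set b : Fin n → HV N := fun β => fderiv ℂ Φ z₀ (basisVec β) with hb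
  set ρ : Cn n → ℂ := fun z => (gram Φ z).det with hρ
  set Jd : Cn n → ℂ := fun z => (jac b Φ z).det with hJd
  have hne : Φ z₀ ≠ 0 := by
    intro h
    have := ha.self_of_nhds
    rw [h, inner_zero_right] at this
    exact zero_ne_one this
  have hnorm : inner ℂ (Φ z₀) (Φ z₀) = 1 := by
    have := ha.self_of_nhds
    rwa [h0] at this ⊢
  have hρa : AnalyticAt ℝ ρ z₀ := analyticAt_matrix_det (analyticAt_gram hΦ hne)
  have hJa : AnalyticAt ℂ Jd z₀ := analyticAt_matrix_det (analyticAt_jac b hΦ)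
  have hflat : Flat z₀ (fun z => ρ z - Jd z) :=
    Flat.det_sub (analyticAt_gram hΦ hne) (fun i j => (analyticAt_jac b hΦ i j).restrictScalars)
      (flat_gram_sub_jac hΦ ha h0)
  have hJ0 : Jd z₀ = ρ z₀ := (sub_eq_zero.1 hflat.eq_zero).symm
  have hρre : ∀ z, ρ z = (((ρ z).re : ℝ) : ℂ) := gram_det_eq_ofReal Φ
  have hρ0 : ρ z₀ ≠ 0 := by
    intro h
    have : (ρ z₀).re = 0 := by rw [h]; rfl
    exact hpos.ne' this
  have hJ0' : Jd z₀ ≠ 0 := by rwa [hJ0]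
  have hρpos : ∀ᶠ z in 𝓝 z₀, 0 < (ρ z).re :=
    (Complex.continuous_re.continuousAt.comp hρa.continuousAt).eventually (lt_mem_nhds hpos)
  have hrea : AnalyticAt ℝ (fun z => (ρ z).re) z₀ :=
    (Complex.reCLM.analyticAt _).comp_of_eq hρa rfl
  -- the three terms of `θ`
  set T₁ : Cn n → ℂ := fun z => (Real.log (ρ z).re : ℂ) with hT₁
  set T₂ : Cn n → ℂ := fun z => (Real.log (‖Φ z‖ ^ 2) : ℂ) with hT₂
  set T₃ : Cn n → ℂ := fun z => (Real.log (‖Jd z‖ ^ 2) : ℂ) with hT₃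
  have a₁ : AnalyticAt ℝ T₁ z₀ :=
    analyticAt_ofReal ((_root_.analyticAt_log hpos).comp_of_eq hrea rfl)
  have a₂ : AnalyticAt ℝ T₂ z₀ := analyticAt_ofReal (analyticAt_log_norm_sq hΦ hne)
  have a₃ : AnalyticAt ℝ T₃ z₀ := analyticAt_ofReal (analyticAt_log_norm_sq hJa hJ0')
  set θ : Cn n → ℝ := fun z =>
    Real.log (ρ z).re + (c / 2 * Real.log (‖Φ z‖ ^ 2) - Real.log (‖Jd z‖ ^ 2)) with hθ
  have hθT : (fun z => (θ z : ℂ)) = fun z => T₁ z + ((c / 2 : ℂ) * T₂ z - T₃ z) := by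
    ext z; simp [hθ, hT₁, hT₂, hT₃]
  have aθ : AnalyticAt ℝ (fun z => (θ z : ℂ)) z₀ := by
    rw [hθT]; exact a₁.add ((analyticAt_const.mul a₂).sub a₃)
  have split_wd : ∀ v, ∀ᶠ z in 𝓝 z₀, wd v (fun z => (θ z : ℂ)) z
      = wd v T₁ z + ((c / 2 : ℂ) * wd v T₂ z - wd v T₃ z) := by
    intro v
    filter_upwards [a₁.eventually_analyticAt, a₂.eventually_analyticAt, a₃.eventually_analyticAt]
      with z h₁ h₂ h₃
    have d₁ := h₁.differentiableAt
    have d₂ := h₂.differentiableAt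
    have d₃ := h₃.differentiableAt
    have d₂' : DifferentiableAt ℝ (fun z => (c / 2 : ℂ) * T₂ z) z := d₂.const_mul _
    have d₂₃ : DifferentiableAt ℝ (fun z => (c / 2 : ℂ) * T₂ z - T₃ z) z := d₂'.sub d₃
    rw [hθT, wd_add d₁ d₂₃, wd_sub d₂' d₃, wd_const_mul _ d₂]
  have split_wdbar : ∀ v, wdbar v (fun z => (θ z : ℂ)) =ᶠ[𝓝 z₀]
      fun z => wdbar v T₁ z + ((c / 2 : ℂ) * wdbar v T₂ z - wdbar v T₃ z) := by
    intro v
    filter_upwards [a₁.eventually_analyticAt, a₂.eventually_analyticAt, a₃.eventually_analyticAt]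
      with z h₁ h₂ h₃
    have d₁ := h₁.differentiableAt
    have d₂ := h₂.differentiableAt
    have d₃ := h₃.differentiableAt
    have d₂' : DifferentiableAt ℝ (fun z => (c / 2 : ℂ) * T₂ z) z := d₂.const_mul _
    have d₂₃ : DifferentiableAt ℝ (fun z => (c / 2 : ℂ) * T₂ z - T₃ z) z := d₂'.sub d₃
    rw [hθT, wdbar_add d₁ d₂₃, wdbar_sub d₂' d₃, wdbar_const_mul _ d₂]
  -- `θ` is pluriharmonic
  have hph : ∀ β, ∀ᶠ z in 𝓝 z₀, ∀ α,
      wd (basisVec α) (wdbar (basisVec β) (fun z => (θ z : ℂ))) z = 0 := by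
    intro β
    filter_upwards [hE, (split_wdbar (basisVec β)).eventuallyEq_nhds, a₁.eventually_analyticAt,
      a₂.eventually_analyticAt, a₃.eventually_analyticAt, hΦ.eventually_analyticAt,
      hΦ.continuousAt.eventually_ne hne, hJa.eventually_analyticAt,
      hJa.continuousAt.eventually_ne hJ0'] with z hEz hz h₁ h₂ h₃ hΦz hΦ0 hJz hJz0 α
    have d₁ := (AnalyticAt.wdbar (v := basisVec β) h₁).differentiableAt
    have d₂ := (AnalyticAt.wdbar (v := basisVec β) h₂).differentiableAt
    have d₃ := (AnalyticAt.wdbar (v := basisVec β) h₃).differentiableAt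
    have d₂' : DifferentiableAt ℝ (fun z => (c / 2 : ℂ) * wdbar (basisVec β) T₂ z) z :=
      d₂.const_mul _
    have d₂₃ : DifferentiableAt ℝ
        (fun z => (c / 2 : ℂ) * wdbar (basisVec β) T₂ z - wdbar (basisVec β) T₃ z) z := d₂'.sub d₃
    rw [wd_congr hz, wd_add d₁ d₂₃, wd_sub d₂' d₃, wd_const_mul _ d₂,
      wd_wdbar_log_norm_sq hΦz hΦ0, wd_wdbar_log_norm_sq hJz hJz0]
    -- By the Einstein equation `∂∂̄ log det g = -(c/2) g`, cancelling the `c/2` times the Hessian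
    -- of `log ‖Φ‖²`; the term in `log |Jd|²` contributes nothing.
    have e1 : -2 * wd (basisVec α) (wdbar (basisVec β) T₁) z = c * gram Φ z α β := hEz α β
    have e2 := hform_eq_zero_of_scalar hJz0 (fderiv ℂ Jd z (basisVec α))
      (fderiv ℂ Jd z (basisVec β))
    have e3 : gram Φ z α β
      = hform (Φ z) (fderiv ℂ Φ z (basisVec α)) (fderiv ℂ Φ z (basisVec β)) := rfl
    rw [e2, ← e3]
    linear_combination (-1 / 2) * e1
  -- its `(1,0)`-derivatives are holomorphic and have no pure Taylor coefficients
  have hzero : ∀ β, ∀ᶠ z in 𝓝 z₀, wd (basisVec β) (fun z => (θ z : ℂ)) z = 0 := by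
    intro β
    refine Flat.eventually_eq_zero ?_ ?_
    · have f1 : Flat z₀ (fun z => wd (basisVec β) ρ z - fderiv ℂ Jd z (basisVec β)) := by
        refine Flat.congr _ _ ?_ (hflat.wd (basisVec β))
        filter_upwards [hρa.eventually_analyticAt, hJa.eventually_analyticAt] with z hz hz'
        rw [wd_sub hz.differentiableAt (hz'.differentiableAt.restrictScalars ℝ),
          wd_hol hz'.differentiableAt]
      have f2 : Flat z₀ (fun z => inner ℂ (Φ z) (fderiv ℂ Φ z (basisVec β))) := by
        refine Flat.congr _ _ ?_ ((flat_inner_self_sub_one hΦ ha h0).wd (basisVec β))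
        filter_upwards [hΦ.eventually_analyticAt] with z hz
        have d1 := (hasFDerivAt_inner hz.differentiableAt hz.differentiableAt).differentiableAt
        rw [wd_sub d1 (differentiableAt_const _), wd_inner hz.differentiableAt hz.differentiableAt]
        simp [wd]
      have aJ := hJa.restrictScalars (𝕜 := ℝ)
      have aJ' := (analyticAt_fderiv_apply hJa (basisVec β)).restrictScalars (𝕜 := ℝ)
      have inv1 : AnalyticAt ℝ (fun z => (ρ z)⁻¹) z₀ := hρa.inv hρ0
      have inv2 : AnalyticAt ℝ (fun z => (inner ℂ (Φ z) (Φ z))⁻¹) z₀ :=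
        (analyticAt_inner hΦ.restrictScalars hΦ.restrictScalars).inv (inner_self_ne_zero.2 hne)
      have inv3 : AnalyticAt ℝ (fun z => (Jd z)⁻¹) z₀ := aJ.inv hJ0'
      -- This is `∂ρ/ρ - ∂J/J + (c/2) ⟪Φ, ∂Φ⟫/‖Φ‖²`, arranged as `(∂ρ - ∂J)/ρ - (ρ - J) ∂J/(ρJ)`
      -- plus the last term, so that each summand visibly lies in the ideal.
      have key := Flat.add _ _ (Flat.sub (f1.mul_right inv1)
        (((hflat.mul_right aJ').mul_right inv1).mul_right inv3))
        (Flat.mul (fun _ => (c / 2 : ℂ)) _ analyticAt_const (f2.mul_right inv2))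
      refine Flat.congr _ _ ?_ key
      filter_upwards [split_wd (basisVec β), hρa.eventually_analyticAt, hJa.eventually_analyticAt,
        hΦ.eventually_analyticAt, hΦ.continuousAt.eventually_ne hne,
        hJa.continuousAt.eventually_ne hJ0', hρpos, hρa.continuousAt.eventually_ne hρ0]
        with z hz hρz hJz hΦz hΦ0 hJz0 hpz hρz0
      rw [hz, hT₁, wd_log (Filter.Eventually.of_forall hρre) hρz.differentiableAt hpz.ne', hT₂,
        wd_log_norm_sq hΦz.differentiableAt hΦ0, hT₃, wd_log_norm_sq hJz.differentiableAt hJz0]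
      have hq : inner ℂ (Φ z) (Φ z) ≠ 0 := inner_self_ne_zero.2 hΦ0
      have hJJ : inner ℂ (Jd z) (fderiv ℂ Jd z (basisVec β)) / inner ℂ (Jd z) (Jd z)
          = fderiv ℂ Jd z (basisVec β) / Jd z := by
        have : (starRingEnd ℂ) (Jd z) ≠ 0 := by simpa using hJz0
        simp only [RCLike.inner_apply]
        field_simp
      rw [hJJ]
      field_simp
      ring
    · filter_upwards [hph β, aθ.eventually_analyticAt,
        aθ.eventually_analyticAt.eventually_nhds] with z hz hz' hz''
      -- Pluriharmonicity makes `∂̄θ` antiholomorphic; for real `θ` its conjugate is `∂θ`, which is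
      -- therefore holomorphic.
      have h1 := differentiableAt_conj_of_wd_eq_zero
        (AnalyticAt.wdbar (v := basisVec β) hz').differentiableAt hz
      refine h1.congr_of_eventuallyEq ?_
      filter_upwards [hz''] with x hx
      exact (conj_wdbar_ofReal hx.differentiableAt).symm
  -- hence `θ` is constant
  have hfd : ∀ᶠ z in 𝓝 z₀, DifferentiableAt ℝ (fun z => (θ z : ℂ)) z
      ∧ fderiv ℝ (fun z => (θ z : ℂ)) z = 0 := by
    filter_upwards [Filter.eventually_all.2 hzero, aθ.eventually_analyticAt] with z hz hz'
    refine ⟨hz'.differentiableAt, fderiv_eq_zero_of_wd_eq_zero hz fun α => ?_⟩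
    have := conj_wdbar_ofReal (v := basisVec α) hz'.differentiableAt
    rw [hz α] at this
    simpa using this
  obtain ⟨r, hr, hball⟩ := Metric.eventually_nhds_iff_ball.1 hfd
  have hconst : ∀ z ∈ Metric.ball z₀ r, θ z = θ z₀ := by
    intro z hz
    have := (convex_ball z₀ r).is_const_of_fderivWithin_eq_zero (𝕜 := ℝ)
      (f := fun z => (θ z : ℂ)) (fun x hx => (hball x hx).1.differentiableWithinAt)
      (fun x hx => by
        rw [fderivWithin_of_isOpen Metric.isOpen_ball hx, (hball x hx).2])
      hz (Metric.mem_ball_self hr)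
    exact_mod_cast this
  filter_upwards [Metric.ball_mem_nhds z₀ hr, hρpos, hJa.continuousAt.eventually_ne hJ0']
    with z hz hpz hJz
  have hc := hconst z hz
  have hΦn : ‖Φ z₀‖ ^ 2 = 1 := by
    have := inner_self_eq_ofReal (Φ z₀)
    rw [hnorm] at this
    exact_mod_cast this.symm
  -- At `z₀` the norm of `Φ` is `1` and `Jd = ρ`, so `θ(z₀) = -log ρ(z₀)`. This is where the
  -- constant `ρ(z₀)⁻¹` comes from.
  have hJn : ‖Jd z₀‖ ^ 2 = (ρ z₀).re ^ 2 := by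
    rw [hJ0, hρre z₀]; simp
  rw [hθ] at hc
  simp only [hΦn, hJn, Real.log_one, Real.log_pow] at hc
  have hJz' : 0 < ‖Jd z‖ := norm_pos_iff.2 hJz
  have : (ρ z).re * Real.exp (c / 2 * Real.log (‖Φ z‖ ^ 2)) = ((ρ z₀).re)⁻¹ * ‖Jd z‖ ^ 2 := by
    have l1 : (ρ z).re = Real.exp (Real.log (ρ z).re) := (Real.exp_log hpz).symm
    have l2 : ((ρ z₀).re)⁻¹ = Real.exp (-Real.log (ρ z₀).re) := by
      rw [Real.exp_neg, Real.exp_log hpos]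
    have l3 : ‖Jd z‖ ^ 2 = Real.exp (2 * Real.log ‖Jd z‖) := by
      rw [← Real.log_rpow hJz', Real.exp_log (by positivity)]; norm_num
    rw [l1, l2, l3, ← Real.exp_add, ← Real.exp_add, Real.log_pow]
    congr 1
    push_cast at hc ⊢
    linarith
  exact this

end gram

/-! ### Positivity and propagation of the volume identity -/

section bilin

variable {n N : ℕ}

theorem hform_sum_left {V ι : Type*} [NormedAddCommGroup V] [InnerProductSpace ℂ V] (q b : V)
    (s : Finset ι) (u : ι → V) : hform q (∑ i ∈ s, u i) b = ∑ i ∈ s, hform q (u i) b := by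
  simp only [hform, inner_sum, Finset.sum_div, Finset.sum_sub_distrib, Finset.sum_mul]

theorem hform_sum_right {V ι : Type*} [NormedAddCommGroup V] [InnerProductSpace ℂ V] (q a : V)
    (s : Finset ι) (u : ι → V) : hform q a (∑ i ∈ s, u i) = ∑ i ∈ s, hform q a (u i) := by
  simp only [hform, sum_inner, Finset.sum_div, Finset.sum_sub_distrib, Finset.mul_sum]

theorem map_eq_sum_basisVec {V : Type*} [NormedAddCommGroup V] [NormedSpace ℂ V]
    (L : Cn n →L[ℂ] V) (v : Cn n) : L v = ∑ α, v α • L (basisVec α) := by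
  conv_lhs => rw [← sum_basisVec v]
  simp [map_sum]

theorem hform_fderiv_eq_sum (Φ : Cn n → HV N) (z v w : Cn n) :
    hform (Φ z) (fderiv ℂ Φ z v) (fderiv ℂ Φ z w)
      = ∑ α, ∑ β, v α * (starRingEnd ℂ) (w β) * gram Φ z α β := by
  rw [map_eq_sum_basisVec _ v, hform_sum_left]
  refine Finset.sum_congr rfl fun α _ => ?_
  rw [map_eq_sum_basisVec _ w, hform_sum_right]
  refine Finset.sum_congr rfl fun β _ => ?_
  rw [hform_smul_left, hform_smul_right, gram, Matrix.of_apply]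
  ring

/-- The entries of `gram` are linear in the first index and conjugate-linear in the second, opposite
to the convention `star x ⬝ᵥ A x`; hence `x` enters through its conjugate. -/
theorem star_dotProduct_gram (Φ : Cn n → HV N) (z : Cn n) (x : Fin n → ℂ) :
    star x ⬝ᵥ (gram Φ z).mulVec x
      = hform (Φ z) (fderiv ℂ Φ z (WithLp.toLp 2 (star x))) (fderiv ℂ Φ z (WithLp.toLp 2 (star x))) := by
  rw [hform_fderiv_eq_sum]
  simp only [dotProduct, Matrix.mulVec, Finset.mul_sum]
  refine Finset.sum_congr rfl fun α _ => Finset.sum_congr rfl fun β _ => ?_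
  simp
  ring

open scoped ComplexOrder in
theorem gram_posDef {Φ : Cn n → HV N} {z : Cn n}
    (h : ∀ v ≠ 0, 0 < (hform (Φ z) (fderiv ℂ Φ z v) (fderiv ℂ Φ z v)).re) :
    (gram Φ z).PosDef := by
  refine Matrix.PosDef.of_dotProduct_mulVec_pos (gram_isHermitian Φ z) fun x hx => ?_
  rw [star_dotProduct_gram]
  set v : Cn n := WithLp.toLp 2 (star x)
  have hv : v ≠ 0 := by
    intro h0
    apply hx
    have := (WithLp.toLp_eq_zero 2).1 h0
    simpa using this
  have him : (starRingEnd ℂ) (hform (Φ z) (fderiv ℂ Φ z v) (fderiv ℂ Φ z v))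
    = hform (Φ z) (fderiv ℂ Φ z v) (fderiv ℂ Φ z v) := hform_conj _ _ _
  rw [← Complex.conj_eq_iff_re.1 him]
  exact_mod_cast h v hv

open scoped ComplexOrder in
theorem gram_det_re_pos {Φ : Cn n → HV N} {z : Cn n}
    (h : ∀ v ≠ 0, 0 < (hform (Φ z) (fderiv ℂ Φ z v) (fderiv ℂ Φ z v)).re) :
    0 < (gram Φ z).det.re := by
  have := (gram_posDef h).det_pos
  rw [gram_det_eq_ofReal] at this
  exact_mod_cast this

/-- The volume identity at `z`. -/
def VolId (κ c : ℝ) (b : Fin n → HV N) (Φ : Cn n → HV N) (z : Cn n) : Prop :=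
  (gram Φ z).det.re * Real.exp (c / 2 * Real.log (‖Φ z‖ ^ 2)) = κ * ‖(jac b Φ z).det‖ ^ 2

/-- By the chain rule, a holomorphic change of variables with Jacobian matrix `P` turns `gram` into
`P · gram · Pᴴ` and `jac` into `P · jac`. Both sides acquire the factor `|det P|²`. -/
theorem VolId.comp {κ c : ℝ} {b : Fin n → HV N} {Φ : Cn n → HV N} {T : Cn n → Cn n} {z : Cn n}
    (hT : DifferentiableAt ℂ T z) (hΦ : DifferentiableAt ℂ Φ (T z)) (h : VolId κ c b Φ (T z)) :
    VolId κ c b (Φ ∘ T) z := by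
  set P : Matrix (Fin n) (Fin n) ℂ := Matrix.of fun α γ => (fderiv ℂ T z (basisVec α)) γ with hP
  have hd : ∀ v, fderiv ℂ (Φ ∘ T) z v = fderiv ℂ Φ (T z) (fderiv ℂ T z v) := by
    intro v
    rw [fderiv_comp z hΦ hT]; rfl
  have h1 : gram (Φ ∘ T) z = P * gram Φ (T z) * P.conjTranspose := by
    ext α β
    rw [gram, Matrix.of_apply, hd, hd, Function.comp_apply, hform_fderiv_eq_sum]
    simp only [Matrix.mul_apply, Finset.sum_mul, Matrix.conjTranspose_apply, hP, Matrix.of_apply]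
    rw [Finset.sum_comm]
    refine Finset.sum_congr rfl fun β _ => Finset.sum_congr rfl fun α _ => ?_
    simp only [RCLike.star_def]
    ring
  have h2 : jac b (Φ ∘ T) z = P * jac b Φ (T z) := by
    ext α β
    rw [jac, Matrix.of_apply, hd, map_eq_sum_basisVec, inner_sum]
    simp [Matrix.mul_apply, hP, jac, inner_smul_right]
  have h3 : (gram (Φ ∘ T) z).det.re = ‖P.det‖ ^ 2 * (gram Φ (T z)).det.re := by
    rw [h1, Matrix.det_mul, Matrix.det_mul, Matrix.det_conjTranspose, mul_right_comm,
      RCLike.star_def, Complex.mul_conj, Complex.normSq_eq_norm_sq, Complex.re_ofReal_mul]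
  rw [VolId, h3, h2, Matrix.det_mul, norm_mul, mul_pow, Function.comp_apply]
  rw [VolId] at h
  linear_combination ‖P.det‖ ^ 2 * h

theorem analyticAt_volId_sub {κ c : ℝ} {b : Fin n → HV N} {Φ : Cn n → HV N} {z : Cn n}
    (hΦ : AnalyticAt ℂ Φ z) (h0 : Φ z ≠ 0) :
    AnalyticAt ℝ (fun z => (gram Φ z).det.re * Real.exp (c / 2 * Real.log (‖Φ z‖ ^ 2))
      - κ * ‖(jac b Φ z).det‖ ^ 2) z := by
  have h1 : AnalyticAt ℝ (fun z => (gram Φ z).det.re) z :=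
    (Complex.reCLM.analyticAt _).comp_of_eq (analyticAt_matrix_det (analyticAt_gram hΦ h0)) rfl
  have h2 : AnalyticAt ℝ (fun z => Real.exp (c / 2 * Real.log (‖Φ z‖ ^ 2))) z :=
    (analyticAt_const.mul (analyticAt_log_norm_sq hΦ h0)).rexp
  have hJ := (analyticAt_matrix_det (analyticAt_jac b hΦ)).restrictScalars (𝕜 := ℝ)
  have h3 : AnalyticAt ℝ (fun z => ‖(jac b Φ z).det‖ ^ 2) z := by
    have := (Complex.reCLM.analyticAt _).comp_of_eq (analyticAt_inner hJ hJ) rfl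
    refine this.congr (Filter.Eventually.of_forall fun x => ?_)
    rw [Function.comp_apply, inner_self_eq_ofReal]
    rfl
  exact (h1.mul h2).sub (analyticAt_const.mul h3)

end bilin

/-! ### The volume identity on the manifold -/

section manifold

variable {n : ℕ} {M : Type*} [TopologicalSpace M] [ChartedSpace (Cn n) M]
  [IsManifold 𝓘(ℂ, Cn n) ω M] {N : ℕ} {f : M → CP N}

/-- The normalized lift of `f` in the coordinate system `e`. -/
def clift (a : HV N) (f : M → CP N) (e : OpenPartialHomeomorph M (Cn n)) (z : Cn n) : HV N :=
  CP.nlift a (f (e.symm z))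

theorem analyticAt_clift (hf : ContMDiff 𝓘(ℂ, Cn n) 𝓘(ℂ, Cn N) ω f)
    {e : OpenPartialHomeomorph M (Cn n)} (he : e ∈ coords n M) {z : Cn n} (hz : z ∈ e.target)
    {a : HV N} (ha : f (e.symm z) ∈ CP.compl a) : AnalyticAt ℂ (clift a f e) z :=
  analyticAt_nlift hf he hz ha

theorem chart_mem_coords (x : M) : chartAt (Cn n) x ∈ coords n M :=
  IsManifold.chart_mem_maximalAtlas x

theorem mfderiv_symm_ne_zero {e : OpenPartialHomeomorph M (Cn n)} (he : e ∈ coords n M)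
    {z : Cn n} (hz : z ∈ e.target) {v : Cn n} (hv : v ≠ 0) :
    mfderiv 𝓘(ℝ, Cn n) 𝓘(ℝ, Cn n) e.symm z v ≠ 0 := by
  intro h0
  have hx : e.symm z ∈ e.source := e.map_target hz
  have h1 : ContMDiffAt 𝓘(ℂ, Cn n) 𝓘(ℂ, Cn n) ω e (e.symm z) :=
    contMDiffAt_of_mem_maximalAtlas he hx
  have h2 : MDifferentiableAt 𝓘(ℝ, Cn n) 𝓘(ℝ, Cn n) e (e.symm z) := by
    have h := h1.mdifferentiableAt (by simp)
    exact ⟨h.1, DifferentiableWithinAt.restrictScalars ℝ h.2⟩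
  have h3 := mfderiv_comp_apply z h2 (mdifferentiableAt_symm_real he hz) v
  rw [h0, map_zero] at h3
  have h4 : (e ∘ e.symm) =ᶠ[𝓝 z] id := by
    filter_upwards [e.open_target.mem_nhds hz] with x hx using e.right_inv hx
  rw [h4.mfderiv_eq, mfderiv_id] at h3
  exact hv h3

theorem hform_clift_re_pos {g : Metric n M} (hf : IsKahlerImmersion g f)
    {e : OpenPartialHomeomorph M (Cn n)} (he : e ∈ coords n M) {z : Cn n} (hz : z ∈ e.target)
    {a : HV N} (ha : f (e.symm z) ∈ CP.compl a) (v : Cn n) (hv : v ≠ 0) :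
    0 < (hform (clift a f e z) (fderiv ℂ (clift a f e) z v)
      (fderiv ℂ (clift a f e) z v)).re := by
  have h := localMetric_eq hf he hz ha v v
  refine lt_of_lt_of_eq ?_ h
  exact g.pos _ _ (mfderiv_symm_ne_zero he hz hv)

/-- For the Hermitian form `h` one has `h(v, iw) = -i h(v, w)`, so `Re h(v, iw) = Im h(v, w)`, and
the two real entries of `metricMatrix` reassemble `h`. -/
theorem metricMatrix_eq_gram {g : Metric n M} (hf : IsKahlerImmersion g f)
    {e : OpenPartialHomeomorph M (Cn n)} (he : e ∈ coords n M) {z : Cn n} (hz : z ∈ e.target)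
    {a : HV N} (ha : f (e.symm z) ∈ CP.compl a) :
    metricMatrix g e z = gram (clift a f e) z := by
  ext α β
  rw [metricMatrix, Matrix.of_apply, localMetric_eq hf he hz ha, localMetric_eq hf he hz ha,
    map_smul, hform_smul_right, gram, Matrix.of_apply]
  change ((hform (clift a f e z) (fderiv ℂ (clift a f e) z (basisVec α))
    (fderiv ℂ (clift a f e) z (basisVec β))).re : ℂ) + Complex.I *
    (((starRingEnd ℂ) Complex.I * hform (clift a f e z) (fderiv ℂ (clift a f e) z (basisVec α))
    (fderiv ℂ (clift a f e) z (basisVec β))).re : ℂ) = _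
  set w := hform (clift a f e z) (fderiv ℂ (clift a f e) z (basisVec α))
    (fderiv ℂ (clift a f e) z (basisVec β))
  have : ((starRingEnd ℂ) Complex.I * w).re = w.im := by simp
  rw [this, mul_comm, Complex.re_add_im]

/-- The volume identity near a point does not depend on the coordinates. -/
theorem eventually_volId_congr (hf : ContMDiff 𝓘(ℂ, Cn n) 𝓘(ℂ, Cn N) ω f)
    {e e' : OpenPartialHomeomorph M (Cn n)} (he : e ∈ coords n M) (he' : e' ∈ coords n M)
    {x : M} (hx : x ∈ e.source) (hx' : x ∈ e'.source) {a : HV N} (ha : f x ∈ CP.compl a)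
    {κ c : ℝ} {b : Fin n → HV N} (h : ∀ᶠ z in 𝓝 (e x), VolId κ c b (clift a f e) z) :
    ∀ᶠ z in 𝓝 (e' x), VolId κ c b (clift a f e') z := by
  have hz' : e' x ∈ e'.target := e'.map_source hx'
  have hs : Filter.Tendsto e'.symm (𝓝 (e' x)) (𝓝 x) := e'.tendsto_symm hx'
  have hT : Filter.Tendsto (fun z => e (e'.symm z)) (𝓝 (e' x)) (𝓝 (e x)) :=
    (e.continuousAt hx).tendsto.comp hs
  have hcompl : ∀ᶠ y in 𝓝 x, f y ∈ CP.compl a :=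
    hf.continuous.continuousAt.eventually ((CP.isOpen_compl a).mem_nhds ha)
  have hmem : ∀ᶠ z in 𝓝 (e' x), z ∈ e'.target ∧ e'.symm z ∈ e.source
      ∧ f (e'.symm z) ∈ CP.compl a :=
    (e'.open_target.eventually_mem hz').and
      ((hs.eventually (e.open_source.mem_nhds hx)).and (hs.eventually hcompl))
  filter_upwards [hmem.eventually_nhds, hT.eventually h] with z hz hzv
  obtain ⟨hz1, hz2, hz3⟩ := hz.self_of_nhds
  have hTd : DifferentiableAt ℂ (fun z => e (e'.symm z)) z := by
    have h1 : ContMDiffAt 𝓘(ℂ, Cn n) 𝓘(ℂ, Cn n) ω e'.symm z :=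
      contMDiffAt_symm_of_mem_maximalAtlas he' hz1
    have h2 : ContMDiffAt 𝓘(ℂ, Cn n) 𝓘(ℂ, Cn n) ω e (e'.symm z) :=
      contMDiffAt_of_mem_maximalAtlas he hz2
    exact (contMDiffAt_iff_contDiffAt.1 (h2.comp z h1)).differentiableAt (by simp)
  have hΦ : DifferentiableAt ℂ (clift a f e) (e (e'.symm z)) := by
    refine (analyticAt_clift hf he (e.map_source hz2) ?_).differentiableAt
    rwa [e.left_inv hz2]
  have key := VolId.comp hTd hΦ hzv
  have heq : clift a f e ∘ (fun z => e (e'.symm z)) =ᶠ[𝓝 z] clift a f e' := by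
    filter_upwards [hz] with y hy
    simp only [clift, Function.comp_apply]
    rw [e.left_inv hy.2.1]
  have hg : gram (clift a f e ∘ fun z => e (e'.symm z)) z = gram (clift a f e') z := by
    simp only [gram, heq.fderiv_eq, heq.eq_of_nhds]
  have hj : jac b (clift a f e ∘ fun z => e (e'.symm z)) z = jac b (clift a f e') z := by
    simp only [jac, heq.fderiv_eq]
  rw [VolId, hg, hj, heq.eq_of_nhds] at key
  exact key

/-- The points outside the hyperplane near which the volume identity holds. -/
def volSet (κ c : ℝ) (b : Fin n → HV N) (a : HV N) (f : M → CP N) : Set M :=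
  {x | f x ∈ CP.compl a ∧
    ∀ᶠ z in 𝓝 (chartAt (Cn n) x x), VolId κ c b (clift a f (chartAt (Cn n) x)) z}

variable {κ c : ℝ} {b : Fin n → HV N} {a : HV N}

theorem isOpen_volSet (hf : ContMDiff 𝓘(ℂ, Cn n) 𝓘(ℂ, Cn N) ω f) :
    IsOpen (volSet κ c b a f) := by
  rw [isOpen_iff_mem_nhds]
  rintro x ⟨hx, hv⟩
  have hs := mem_chart_source (Cn n) x
  have h1 := ((chartAt (Cn n) x).continuousAt hs).eventually hv.eventually_nhds
  have h2 : ∀ᶠ y in 𝓝 x, f y ∈ CP.compl a :=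
    hf.continuous.continuousAt.eventually ((CP.isOpen_compl a).mem_nhds hx)
  filter_upwards [h1, h2, (chartAt (Cn n) x).open_source.mem_nhds hs] with y hy1 hy2 hy3
  exact ⟨hy2, eventually_volId_congr hf (chart_mem_coords x) (chart_mem_coords y) hy3
    (mem_chart_source _ y) hy2 hy1⟩

/-- The defect of the volume identity is real analytic on a coordinate ball around `x` mapped off
the hyperplane. That ball contains a point of `volSet`, near which the defect vanishes, so it
vanishes on the whole ball. -/
theorem mem_volSet_of_mem_closure (hf : ContMDiff 𝓘(ℂ, Cn n) 𝓘(ℂ, Cn N) ω f) {x : M}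
    (hx : x ∈ closure (volSet κ c b a f)) (ha : f x ∈ CP.compl a) : x ∈ volSet κ c b a f := by
  refine ⟨ha, ?_⟩
  set e := chartAt (Cn n) x with he
  have hs : x ∈ e.source := mem_chart_source (Cn n) x
  have hez : e x ∈ e.target := e.map_source hs
  have hcoords : e ∈ coords n M := chart_mem_coords x
  have h1 : ∀ᶠ z in 𝓝 (e x), z ∈ e.target ∧ f (e.symm z) ∈ CP.compl a :=
    (e.open_target.eventually_mem hez).and
      (eventually_mem_of_mem hf.continuous hez (CP.isOpen_compl a) (by rwa [e.left_inv hs]))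
  obtain ⟨r, hr, hball⟩ := Metric.eventually_nhds_iff_ball.1 h1
  have hnb : ∀ᶠ y in 𝓝 x, y ∈ e.source ∧ e y ∈ Metric.ball (e x) r :=
    (e.open_source.eventually_mem hs).and
      ((e.continuousAt hs).eventually (Metric.ball_mem_nhds _ hr))
  obtain ⟨y, ⟨hy1, hy2⟩, hy3⟩ := mem_closure_iff_nhds.1 hx _ hnb
  have hyv := eventually_volId_congr hf (chart_mem_coords y) hcoords (mem_chart_source _ y) hy1
    hy3.1 hy3.2
  have han : AnalyticOnNhd ℝ (fun z => (gram (clift a f e) z).det.re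
      * Real.exp (c / 2 * Real.log (‖clift a f e z‖ ^ 2)) - κ * ‖(jac b (clift a f e) z).det‖ ^ 2)
      (Metric.ball (e x) r) := fun z hz =>
    analyticAt_volId_sub (analyticAt_clift hf hcoords (hball z hz).1 (hball z hz).2)
      (CP.nlift_ne_zero (hball z hz).2)
  have h0 := han.eqOn_zero_of_preconnected_of_eventuallyEq_zero
    (convex_ball (e x) r).isPreconnected hy2 (hyv.mono fun z hz => sub_eq_zero.2 hz)
  filter_upwards [Metric.ball_mem_nhds (e x) hr] with z hz
  exact sub_eq_zero.1 (h0 hz)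

/-- The normalization at a point and the volume identity there. -/
theorem exists_mem_volSet {g : Metric n M} (hf : IsKahlerImmersion g f) (hc : IsEinstein g c)
    (p : M) : ∃ (a : HV N) (b : Fin n → HV N) (κ : ℝ), ‖a‖ = 1 ∧ 0 < κ ∧
      p ∈ volSet κ c b a f := by
  set q := (f p).vec with hq
  have hq0 : ‖q‖ ≠ 0 := norm_ne_zero_iff.2 (CP.vec_ne_zero _)
  -- With this choice `⟪a, q⟫ = ‖q‖`, so the normalized lift takes the value `a` itself at `p`, as
  -- the local volume identity requires.
  set a : HV N := ((‖q‖ : ℂ)⁻¹) • q with ha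
  have hna : ‖a‖ = 1 := by rw [ha, norm_smul]; simp [hq0]
  have haq : inner ℂ a q = (‖q‖ : ℂ) := by
    have : (‖q‖ : ℂ) ≠ 0 := by exact_mod_cast hq0
    rw [ha, inner_smul_left, inner_self_eq_norm_sq_to_K]
    simp only [map_inv₀, Complex.conj_ofReal, Complex.coe_algebraMap]
    field_simp
  have hcompl : f p ∈ CP.compl a := by
    change inner ℂ a q ≠ 0
    rw [haq]; exact_mod_cast hq0
  set e := chartAt (Cn n) p with he
  have hs : p ∈ e.source := mem_chart_source (Cn n) p
  have hez : e p ∈ e.target := e.map_source hs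
  have hcoords : e ∈ coords n M := chart_mem_coords p
  have hcompl' : f (e.symm (e p)) ∈ CP.compl a := by rwa [e.left_inv hs]
  have h1 : ∀ᶠ z in 𝓝 (e p), z ∈ e.target ∧ f (e.symm z) ∈ CP.compl a :=
    (e.open_target.eventually_mem hez).and
      (eventually_mem_of_mem hf.holomorphic.continuous hez (CP.isOpen_compl a) hcompl')
  have hpos : 0 < (gram (clift a f e) (e p)).det.re :=
    gram_det_re_pos (hform_clift_re_pos hf hcoords hez hcompl')
  refine ⟨a, fun β => fderiv ℂ (clift a f e) (e p) (basisVec β),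
    ((gram (clift a f e) (e p)).det.re)⁻¹, hna, inv_pos.2 hpos, hcompl, ?_⟩
  refine det_gram_eq_of_einstein (a := a) (analyticAt_clift hf.holomorphic hcoords hez hcompl')
    ?_ ?_ hpos ?_
  · filter_upwards [h1] with z hz using CP.inner_nlift hz.2
  · rw [clift, e.left_inv hs, CP.nlift, ← hq, haq]
  · filter_upwards [h1.eventually_nhds] with z hz α β
    obtain ⟨hz1, hz2⟩ := hz.self_of_nhds
    have h2 := congrFun (congrFun (hc e hcoords z hz1) α) β
    rw [metricMatrix_eq_gram hf hcoords hz1 hz2] at h2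
    have h3 : (fun z' => (Real.log (gram (clift a f e) z').det.re : ℂ)) =ᶠ[𝓝 z]
        fun z' => (Real.log (metricMatrix g e z').det.re : ℂ) := by
      filter_upwards [hz] with y hy
      rw [metricMatrix_eq_gram hf hcoords hy.1 hy.2]
    have h4 : dzbar β (fun z' => (Real.log (gram (clift a f e) z').det.re : ℂ)) =ᶠ[𝓝 z]
        dzbar β fun z' => (Real.log (metricMatrix g e z').det.re : ℂ) :=
      h3.eventuallyEq_nhds.mono fun y hy => wdbar_congr (v := basisVec β) hy
    refine Eq.trans ?_ h2
    rw [ricciMatrix, Matrix.of_apply]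
    congr 1
    exact wd_congr (v := basisVec α) h4

end manifold

/-! ### Siegel's lemma -/

section jets

variable {n : ℕ}

/-- The sum of the Taylor coefficients of multidegree `γ` in the terms of degree `< m`. -/
def jetCoeff (m : ℕ) (p : FormalMultilinearSeries ℂ (Cn n) ℂ) (γ : Fin n → Fin m) : ℂ :=
  ∑ k ∈ Finset.range m, ∑ r : Fin k → Fin n,
    if ∀ α, (Finset.univ.filter fun j => r j = α).card = (γ α : ℕ) then
      p k (fun j => basisVec (r j)) else 0

/-- Expand each homogeneous term over words in the basis vectors. A word contributes the monomial
given by its letter counts, all below `m`, so words can be grouped by multidegree. -/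
theorem partialSum_eq_sum_jetCoeff (m : ℕ) (p : FormalMultilinearSeries ℂ (Cn n) ℂ) (y : Cn n) :
    p.partialSum m y = ∑ γ : Fin n → Fin m, (∏ α, y α ^ (γ α : ℕ)) * jetCoeff m p γ := by
  simp only [jetCoeff, Finset.mul_sum]
  rw [Finset.sum_comm, FormalMultilinearSeries.partialSum]
  refine Finset.sum_congr rfl fun k hk => ?_
  rw [Finset.sum_comm]
  have h1 : p k (fun _ => y)
      = ∑ r : Fin k → Fin n, (∏ j, y (r j)) * p k (fun j => basisVec (r j)) := by
    conv_lhs => rw [← sum_basisVec y]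
    rw [ContinuousMultilinearMap.map_sum]
    refine Finset.sum_congr rfl fun r _ => ?_
    rw [ContinuousMultilinearMap.map_smul_univ, smul_eq_mul]
  rw [h1]
  refine Finset.sum_congr rfl fun r _ => ?_
  have hcard : ∀ α, (Finset.univ.filter fun j => r j = α).card < m := fun α =>
    ((Finset.card_le_univ _).trans_eq (Fintype.card_fin k)).trans_lt (Finset.mem_range.1 hk)
  rw [Finset.sum_eq_single (fun α => ⟨_, hcard α⟩)]
  · rw [if_pos fun α => rfl]
    congr 1
    rw [← Finset.prod_fiberwise (s := Finset.univ) (g := r)]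
    refine Finset.prod_congr rfl fun α _ => ?_
    rw [Finset.prod_congr rfl (g := fun _ => y α)
      (fun j hj => by rw [(Finset.mem_filter.1 hj).2]), Finset.prod_const]
  · intro γ _ hγ
    rw [if_neg, mul_zero]
    intro h
    apply hγ
    ext α
    exact (h α).symm
  · intro h
    exact absurd (Finset.mem_univ _) h

/-- The linear conditions cancel the Taylor polynomials of degree `< m`, leaving only the
remainders. -/
theorem isBigO_of_jetCoeff_eq_zero {ι : Type*} [Fintype ι] {m : ℕ} {z₀ : Cn n}
    {G : ι → Cn n → ℂ} {p : ι → FormalMultilinearSeries ℂ (Cn n) ℂ}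
    (hp : ∀ i, HasFPowerSeriesAt (G i) (p i) z₀) {C : ι → ℂ}
    (hC : ∀ γ : Fin n → Fin m, ∑ i, C i * jetCoeff m (p i) γ = 0) :
    (fun z => ∑ i, C i * G i z) =O[𝓝 z₀] fun z => ‖z - z₀‖ ^ m := by
  have h1 : ∀ i, (fun z => C i * (G i z - (p i).partialSum m (z - z₀))) =O[𝓝 z₀]
      fun z => ‖z - z₀‖ ^ m := by
    intro i
    have h2 := (hp i).isBigO_sub_partialSum_pow m
    have h3 : Filter.Tendsto (fun z => z - z₀) (𝓝 z₀) (𝓝 0) := by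
      have : Filter.Tendsto (fun z => z - z₀) (𝓝 z₀) (𝓝 (z₀ - z₀)) :=
        (continuous_id.sub continuous_const).continuousAt.tendsto
      simpa using this
    have h4 := h2.comp_tendsto h3
    simp only [Function.comp_def, add_sub_cancel] at h4
    exact h4.const_mul_left _
  have h2 := Asymptotics.IsBigO.sum (s := Finset.univ) fun i _ => h1 i
  refine h2.congr_left fun z => ?_
  simp only [Finset.sum_apply, mul_sub, Finset.sum_sub_distrib]
  have h3 : ∑ i, C i * (p i).partialSum m (z - z₀) = 0 := by
    simp only [partialSum_eq_sum_jetCoeff, Finset.mul_sum]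
    rw [Finset.sum_comm]
    refine Finset.sum_eq_zero fun γ _ => ?_
    rw [← mul_zero (∏ α, (z - z₀) α ^ (γ α : ℕ)), ← hC γ, Finset.mul_sum]
    exact Finset.sum_congr rfl fun i _ => by ring
  rw [h3, sub_zero]

/-- The Schwarz lemma for functions vanishing to order `m + 1`. -/
theorem norm_le_of_isBigO {m : ℕ} {z₀ z : Cn n} {r B : ℝ} {G : Cn n → ℂ} (hr : 0 < r)
    (hG : DifferentiableOn ℂ G (Metric.ball z₀ r)) (hB : ∀ z ∈ Metric.ball z₀ r, ‖G z‖ ≤ B)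
    (hO : G =O[𝓝 z₀] fun z => ‖z - z₀‖ ^ (m + 1)) (hz : z ∈ Metric.ball z₀ (r / 2)) :
    ‖G z‖ ≤ B * (1 / 2) ^ (m + 1) := by
  have h0 : G z₀ = 0 := by
    obtain ⟨K, hK⟩ := hO.bound
    simpa using hK.self_of_nhds
  -- The Schwarz lemma takes the order of vanishing as a little-o with exponent `m`, and returns the
  -- exponent `m + 1`.
  have ho : (G · - G z₀) =o[𝓝 z₀] fun z => ‖z - z₀‖ ^ m := by
    simp only [h0, sub_zero]
    refine hO.trans_isLittleO ?_
    have h1 : (fun z : Cn n => ‖z - z₀‖) =o[𝓝 z₀] fun _ => (1 : ℝ) := by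
      rw [Asymptotics.isLittleO_one_iff]
      have : Continuous fun z : Cn n => ‖z - z₀‖ := by fun_prop
      simpa using this.tendsto z₀
    have h2 := (Asymptotics.isBigO_refl (fun z : Cn n => ‖z - z₀‖ ^ m) (𝓝 z₀)).mul_isLittleO h1
    simpa [pow_succ] using h2
  have hz' : z ∈ Metric.ball z₀ r := Metric.ball_subset_ball (by linarith) hz
  have hB0 : 0 ≤ B := (norm_nonneg _).trans (hB z hz')
  have key := Complex.dist_le_mul_div_pow_of_mapsTo_ball_of_isLittleO hG
    (R₂ := B) (fun w hw => by simpa [h0] using hB w hw) ho hz'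
  rw [h0, dist_zero_right] at key
  refine key.trans (mul_le_mul_of_nonneg_left ?_ hB0)
  refine pow_le_pow_left₀ (by positivity) ?_ _
  rw [div_le_iff₀ hr]
  have := Metric.mem_ball.1 hz
  linarith

end jets

/-! ### Linear dependence of forms restricted to a compact manifold -/

section siegel

variable {n : ℕ} {M : Type*} [TopologicalSpace M] [ChartedSpace (Cn n) M]
  [IsManifold 𝓘(ℂ, Cn n) ω M] {N : ℕ} {f : M → CP N}

/-- Near every point of `M`, finitely many linear conditions force a homogeneous form of degree
`d` on `ℂPᴺ` to be small on `M`. -/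
theorem exists_nhds_jet_conditions (hf : ContMDiff 𝓘(ℂ, Cn n) 𝓘(ℂ, Cn N) ω f) (x : M) :
    ∃ U ∈ 𝓝 x, ∀ {ι : Type} [Fintype ι] (P : ι → HV N → ℂ) (d m : ℕ),
      (∀ i Z, AnalyticAt ℂ (P i) Z) → (∀ i (t : ℂ) Z, P i (t • Z) = t ^ d * P i Z) →
      ∃ T : (ι → ℂ) →ₗ[ℂ] ((Fin n → Fin (m + 1)) → ℂ), ∀ C, T C = 0 → ∀ B : ℝ,
        (∀ y, ‖∑ i, C i * P i (f y).vec‖ ≤ B * ‖(f y).vec‖ ^ d) →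
        ∀ y ∈ U, ‖∑ i, C i * P i (f y).vec‖
          ≤ B * (4 ^ d * (1 / 2) ^ (m + 1)) * ‖(f y).vec‖ ^ d := by
  obtain ⟨i₀, hi₀⟩ := CP.exists_mem_affineDomain (f x)
  set e := chartAt (Cn n) x with he
  have hs : x ∈ e.source := mem_chart_source (Cn n) x
  have hez : e x ∈ e.target := e.map_source hs
  have hcoords : e ∈ coords n M := chart_mem_coords x
  set A : Cn n → HV N := fun z => CP.alift i₀ (CP.affineCoord i₀ (f (e.symm z))) with hA
  have hAan : ∀ z ∈ e.target, f (e.symm z) ∈ CP.affineDomain i₀ → AnalyticAt ℂ A z :=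
    fun z hz hz' => analyticAt_alift_comp hf hcoords hz hz'
  have hx' : f (e.symm (e x)) ∈ CP.affineDomain i₀ := by rwa [e.left_inv hs]
  set q := ‖A (e x)‖ with hq
  have hq0 : 0 < q := norm_pos_iff.2 (CP.alift_ne_zero _ _)
  have hAc : ContinuousAt (fun z => ‖A z‖) (e x) := (hAan _ hez hx').continuousAt.norm
  -- On this ball `‖A‖` varies by a factor less than `4`, which produces the factor `4 ^ d` when
  -- bounds on forms of degree `d` are compared at two points.
  have hev : ∀ᶠ z in 𝓝 (e x), (z ∈ e.target ∧ f (e.symm z) ∈ CP.affineDomain i₀)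
      ∧ (‖A z‖ < 2 * q ∧ q / 2 < ‖A z‖) :=
    ((e.open_target.eventually_mem hez).and
      (eventually_mem_of_mem hf.continuous hez (CP.isOpen_affineDomain i₀) hx')).and
      ((hAc.eventually (gt_mem_nhds (by linarith))).and
        (hAc.eventually (lt_mem_nhds (by linarith))))
  obtain ⟨r, hr, hball⟩ := Metric.eventually_nhds_iff_ball.1 hev
  refine ⟨e.source ∩ e ⁻¹' Metric.ball (e x) (r / 2), Filter.inter_mem (e.open_source.mem_nhds hs)
    ((e.continuousAt hs).preimage_mem_nhds (Metric.ball_mem_nhds _ (by linarith))), ?_⟩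
  intro ι _ P d m hP hhom
  have hPA : ∀ i, ∀ z ∈ Metric.ball (e x) r, AnalyticAt ℂ (fun z => P i (A z)) z :=
    fun i z hz => (hP i _).comp_of_eq (hAan z (hball z hz).1.1 (hball z hz).1.2) rfl
  choose p hp using fun i => hPA i (e x) (Metric.mem_ball_self hr)
  -- The Taylor coefficients of degree at most `m` at the centre, for the combination of forms
  -- pulled back by the affine lift: `(m + 1)ⁿ` linear conditions.
  let T : (ι → ℂ) →ₗ[ℂ] ((Fin n → Fin (m + 1)) → ℂ) :=
    { toFun := fun C γ => ∑ i, C i * jetCoeff (m + 1) (p i) γ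
      map_add' := fun C D => by
        ext γ; simp [add_mul, Finset.sum_add_distrib]
      map_smul' := fun c C => by
        ext γ; simp [Finset.mul_sum, mul_assoc] }
  refine ⟨T, fun C hC B hB => ?_⟩
  have hO := isBigO_of_jetCoeff_eq_zero (m := m + 1) hp (C := C) fun γ => congrFun hC γ
  -- transfer between the two lifts
  have htrans : ∀ y, f y ∈ CP.affineDomain i₀ → ∃ t : ℂ, t ≠ 0 ∧
      (f y).vec = t • CP.alift i₀ (CP.affineCoord i₀ (f y)) ∧ ∑ i, C i * P i (f y).vec
        = t ^ d * ∑ i, C i * P i (CP.alift i₀ (CP.affineCoord i₀ (f y))) := by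
    intro y hy
    obtain ⟨t, ht, h⟩ := CP.vec_alift i₀ hy
    refine ⟨t, ht, h, ?_⟩
    rw [h, Finset.mul_sum]
    exact Finset.sum_congr rfl fun i _ => by rw [hhom]; ring
  have hbound : ∀ z ∈ Metric.ball (e x) r, ‖∑ i, C i * P i (A z)‖ ≤ B * (2 * q) ^ d := by
    intro z hz
    obtain ⟨⟨hz1, hz2⟩, hz3, hz4⟩ := hball z hz
    obtain ⟨t, ht, h1, h2⟩ := htrans (e.symm z) hz2
    have h3 := hB (e.symm z)
    rw [h2, h1, norm_mul, norm_smul, mul_pow, norm_pow] at h3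
    have ht' : 0 < ‖t‖ ^ d := pow_pos (norm_pos_iff.2 ht) d
    have hAz : 0 < ‖A z‖ ^ d := pow_pos (norm_pos_iff.2 (CP.alift_ne_zero _ _)) d
    have h4 : ‖∑ i, C i * P i (A z)‖ ≤ B * ‖A z‖ ^ d := by
      refine le_of_mul_le_mul_left ?_ ht'
      refine h3.trans_eq ?_
      simp only [hA]; ring
    have hB0 : 0 ≤ B := by
      by_contra hneg
      have := (norm_nonneg _).trans h4
      nlinarith
    exact h4.trans (mul_le_mul_of_nonneg_left (pow_le_pow_left₀ (norm_nonneg _) hz3.le _) hB0)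
  rintro y ⟨hy1, hy2⟩
  have hyr : e y ∈ Metric.ball (e x) r := Metric.ball_subset_ball (by linarith) hy2
  have hd : DifferentiableOn ℂ (fun z => ∑ i, C i * P i (A z)) (Metric.ball (e x) r) := by
    intro z hz
    refine DifferentiableAt.differentiableWithinAt ?_
    exact DifferentiableAt.fun_sum fun i _ => ((hPA i z hz).differentiableAt).const_mul _
  have key := norm_le_of_isBigO hr hd hbound hO hy2
  obtain ⟨⟨hz1, hz2⟩, hz3, hz4⟩ := hball _ hyr
  have hB0 : 0 ≤ B := by
    have h := (norm_nonneg _).trans (hbound _ hyr)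
    have : 0 < (2 * q) ^ d := by positivity
    by_contra hneg
    nlinarith
  rw [e.left_inv hy1] at hz2
  obtain ⟨t, ht, h1, h2⟩ := htrans y hz2
  have hAy : A (e y) = CP.alift i₀ (CP.affineCoord i₀ (f y)) := by
    simp only [hA]; rw [e.left_inv hy1]
  rw [hAy] at key hz4
  rw [h2, h1, norm_mul, norm_smul, mul_pow, norm_pow]
  have h5 : (2 * q) ^ d ≤ 4 ^ d * ‖CP.alift i₀ (CP.affineCoord i₀ (f y))‖ ^ d := by
    rw [← mul_pow]
    exact pow_le_pow_left₀ (by positivity) (by linarith) _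
  calc _ ≤ ‖t‖ ^ d * (B * (2 * q) ^ d * (1 / 2) ^ (m + 1)) := by gcongr
    _ ≤ ‖t‖ ^ d * (B * (4 ^ d * ‖CP.alift i₀ (CP.affineCoord i₀ (f y))‖ ^ d)
        * (1 / 2) ^ (m + 1)) := by gcongr
    _ = _ := by ring

theorem continuous_norm_form_div (hf : Continuous f) {P : HV N → ℂ} {d : ℕ}
    (hP : Continuous P) (hhom : ∀ (t : ℂ) Z, P (t • Z) = t ^ d * P Z) :
    Continuous fun y => ‖P (f y).vec‖ / ‖(f y).vec‖ ^ d := by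
  have h : Continuous fun q : CP N => ‖P q.vec‖ / ‖q.vec‖ ^ d := by
    rw [CP.isQuotientMap_mk.continuous_iff]
    have h1 : Continuous fun Z : {Z : Fin (N + 1) → ℂ // Z ≠ 0} => (WithLp.toLp 2 Z.1 : HV N) :=
      (PiLp.continuous_toLp 2 _).comp continuous_subtype_val
    have h2 : ((fun q : CP N => ‖P q.vec‖ / ‖q.vec‖ ^ d) ∘ CP.mk) =
        fun Z : {Z : Fin (N + 1) → ℂ // Z ≠ 0} =>
          ‖P (WithLp.toLp 2 Z.1)‖ / ‖(WithLp.toLp 2 Z.1 : HV N)‖ ^ d := by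
      ext Z
      obtain ⟨t, ht, h⟩ := CP.vec_mk Z
      rw [Function.comp_apply, h, hhom, norm_mul, norm_smul, mul_pow, norm_pow,
        mul_div_mul_left _ _ (pow_ne_zero _ (norm_ne_zero_iff.2 ht))]
    rw [h2]
    refine ((hP.comp h1).norm).div (h1.norm.pow d) fun Z => ?_
    refine pow_ne_zero _ (norm_ne_zero_iff.2 fun h0 => Z.2 ((WithLp.toLp_eq_zero 2).1 h0))
  exact h.comp hf

/-- Siegel's lemma: more forms of degree `d` than jet conditions are linearly dependent on `M`. -/
theorem exists_linear_relation [CompactSpace M] (hf : ContMDiff 𝓘(ℂ, Cn n) 𝓘(ℂ, Cn N) ω f) :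
    ∃ s : ℕ, ∀ {ι : Type} [Fintype ι] (P : ι → HV N → ℂ) (d : ℕ),
      (∀ i Z, AnalyticAt ℂ (P i) Z) → (∀ i (t : ℂ) Z, P i (t • Z) = t ^ d * P i Z) →
      s * (2 * d + 1) ^ n < Fintype.card ι →
      ∃ C : ι → ℂ, C ≠ 0 ∧ ∀ y, ∑ i, C i * P i (f y).vec = 0 := by
  choose U hU hjet using fun x => exists_nhds_jet_conditions hf x
  obtain ⟨t, ht⟩ := CompactSpace.elim_nhds_subcover U hU
  refine ⟨t.card, ?_⟩
  intro ι _ P d hP hhom hcard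
  -- The order `2 * d` is chosen so that the Schwarz gain beats the distortion: `4 ^ d * (1 / 2) ^
  -- (2 * d + 1) = 1 / 2`.
  choose T hT using fun x => hjet x P d (2 * d) hP hhom
  let L : (ι → ℂ) →ₗ[ℂ] (t → (Fin n → Fin (2 * d + 1)) → ℂ) :=
    LinearMap.pi fun x => T x.1
  have hker : LinearMap.ker L ≠ ⊥ := by
    refine LinearMap.ker_ne_bot_of_finrank_lt ?_
    rw [Module.finrank_pi_fintype]
    simpa using hcard
  obtain ⟨C, hC, hC0⟩ := (Submodule.ne_bot_iff _).1 hker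
  refine ⟨C, hC0, ?_⟩
  by_cases hne : Nonempty M
  swap
  · exact fun y => absurd ⟨y⟩ hne
  set S : HV N → ℂ := fun Z => ∑ i, C i * P i Z with hS
  have hSc : Continuous S := by
    refine continuous_finsetSum _ fun i _ => continuous_const.mul ?_
    exact continuous_iff_continuousAt.2 fun Z => (hP i Z).continuousAt
  have hShom : ∀ (t : ℂ) Z, S (t • Z) = t ^ d * S Z := by
    intro t Z
    simp only [hS, hhom, Finset.mul_sum]
    exact Finset.sum_congr rfl fun i _ => by ring
  -- At a maximum of the scale-invariant norm the jet estimate gives `B ≤ B / 2`, so the form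
  -- vanishes on all of `M`.
  obtain ⟨y₀, -, hy₀⟩ := isCompact_univ.exists_isMaxOn (Set.univ_nonempty (α := M))
    (continuous_norm_form_div hf.continuous hSc hShom).continuousOn
  set B := ‖S (f y₀).vec‖ / ‖(f y₀).vec‖ ^ d with hB
  have hv : ∀ y, 0 < ‖(f y).vec‖ ^ d := fun y => pow_pos (norm_pos_iff.2 (CP.vec_ne_zero _)) d
  have hle : ∀ y, ‖S (f y).vec‖ ≤ B * ‖(f y).vec‖ ^ d := by
    intro y
    have := hy₀ (Set.mem_univ y)
    exact (div_le_iff₀ (hv y)).1 this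
  obtain ⟨x, hx, hxU⟩ : ∃ x ∈ t, y₀ ∈ U x := by
    have : y₀ ∈ ⋃ x ∈ t, U x := by rw [ht]; trivial
    simpa using this
  have hTC : T x C = 0 := congrFun (LinearMap.mem_ker.1 hC) ⟨x, hx⟩
  have h1 := hT x C hTC B hle y₀ hxU
  have h2 : (4 : ℝ) ^ d * (1 / 2) ^ (2 * d + 1) = 1 / 2 := by
    rw [pow_succ, pow_mul, ← mul_assoc, ← mul_pow]; norm_num
  have h3 : B ≤ B * (1 / 2) := by
    rw [h2] at h1
    exact (div_le_iff₀ (hv y₀)).2 h1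
  have hB0 : B ≤ 0 := by linarith
  intro y
  have h4 := (hle y).trans (mul_nonpos_of_nonpos_of_nonneg hB0 (hv y).le)
  exact norm_le_zero_iff.1 h4

end siegel

/-! ### Polynomial bounds -/

section PolyBdd

variable {X : Type*} {n : ℕ}

/-- `h` is bounded on `S` by a polynomial in `‖Y‖`. -/
def PolyBdd (S : Set X) (Y : X → Cn n) (h : X → ℝ) : Prop :=
  ∃ (K : ℝ) (m : ℕ), 0 ≤ K ∧ ∀ x ∈ S, h x ≤ K * (1 + ‖Y x‖) ^ m

variable {S : Set X} {Y : X → Cn n} {h k : X → ℝ}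

theorem PolyBdd.mono (hk : PolyBdd S Y k) (hle : ∀ x ∈ S, h x ≤ k x) : PolyBdd S Y h := by
  obtain ⟨K, m, hK, hb⟩ := hk
  exact ⟨K, m, hK, fun x hx => (hle x hx).trans (hb x hx)⟩

theorem PolyBdd.const (c : ℝ) : PolyBdd S Y (fun _ => c) :=
  ⟨|c|, 0, abs_nonneg c, fun x _ => by simpa using le_abs_self c⟩

theorem PolyBdd.add (hh : PolyBdd S Y h) (hk : PolyBdd S Y k) :
    PolyBdd S Y (fun x => h x + k x) := by
  obtain ⟨K, m, hK, hb⟩ := hh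
  obtain ⟨K', m', hK', hb'⟩ := hk
  refine ⟨K + K', m + m', by positivity, fun x hx => ?_⟩
  have h1 : (1 : ℝ) ≤ 1 + ‖Y x‖ := by linarith [norm_nonneg (Y x)]
  have h2 := pow_le_pow_right₀ h1 (Nat.le_add_right m m')
  have h3 := pow_le_pow_right₀ h1 (Nat.le_add_left m' m)
  calc h x + k x ≤ K * (1 + ‖Y x‖) ^ m + K' * (1 + ‖Y x‖) ^ m' := add_le_add (hb x hx) (hb' x hx)
    _ ≤ K * (1 + ‖Y x‖) ^ (m + m') + K' * (1 + ‖Y x‖) ^ (m + m') := by gcongr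
    _ = _ := by ring

theorem PolyBdd.mul (hh : PolyBdd S Y h) (hk : PolyBdd S Y k) (h0 : ∀ x, 0 ≤ h x)
    (k0 : ∀ x, 0 ≤ k x) : PolyBdd S Y (fun x => h x * k x) := by
  obtain ⟨K, m, hK, hb⟩ := hh
  obtain ⟨K', m', hK', hb'⟩ := hk
  refine ⟨K * K', m + m', by positivity, fun x hx => ?_⟩
  calc h x * k x ≤ (K * (1 + ‖Y x‖) ^ m) * (K' * (1 + ‖Y x‖) ^ m') :=
        mul_le_mul (hb x hx) (hb' x hx) (k0 x) ((h0 x).trans (hb x hx))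
    _ = _ := by ring

theorem PolyBdd.pow (hh : PolyBdd S Y h) (h0 : ∀ x, 0 ≤ h x) (k : ℕ) :
    PolyBdd S Y (fun x => h x ^ k) := by
  induction k with
  | zero => simpa using PolyBdd.const 1
  | succ k ih =>
    simp only [pow_succ]
    exact ih.mul hh (fun x => pow_nonneg (h0 x) k) h0

theorem PolyBdd.sum {ι : Type*} (s : Finset ι) {F : ι → X → ℝ} (hF : ∀ i ∈ s, PolyBdd S Y (F i)) :
    PolyBdd S Y (fun x => ∑ i ∈ s, F i x) := by
  classical
  induction s using Finset.induction_on with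
  | empty => simpa using PolyBdd.const 0
  | insert i s hi ih =>
    simp only [Finset.sum_insert hi]
    exact (hF i (Finset.mem_insert_self _ _)).add
      (ih fun j hj => hF j (Finset.mem_insert_of_mem hj))

theorem PolyBdd.eval (p : MvPolynomial (Fin n) ℂ) :
    PolyBdd S Y (fun x => ‖MvPolynomial.eval (fun α => Y x α) p‖) := by
  induction p using MvPolynomial.induction_on with
  | C c => simpa using PolyBdd.const ‖c‖
  | add p q hp hq =>
    refine (hp.add hq).mono fun x _ => ?_
    rw [map_add]
    exact norm_add_le _ _
  | mul_X p α hp =>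
    have h1 : PolyBdd S Y (fun x => ‖Y x α‖) := ⟨1, 1, zero_le_one, fun x _ => by
      have := PiLp.norm_apply_le (Y x) α
      simp only [pow_one, one_mul]
      linarith⟩
    refine (hp.mul h1 (fun _ => norm_nonneg _) fun _ => norm_nonneg _).mono fun x _ => ?_
    rw [map_mul, MvPolynomial.eval_X, norm_mul]

/-- Exponential decay in `‖Y‖²` beats polynomial growth. -/
theorem PolyBdd.exists_le_mul_exp (hh : PolyBdd S Y h) {s : ℝ} (hs : 0 < s) :
    ∃ K : ℝ, 0 < K ∧ ∀ x ∈ S, h x * Real.exp (-s * ‖Y x‖ ^ 2) ≤ K := by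
  obtain ⟨K, m, hK, hb⟩ := hh
  have h1 : Filter.Tendsto (fun t : ℝ => (1 + t) ^ m * Real.exp (-(s * t))) Filter.atTop (𝓝 0) := by
    have h2 : Filter.Tendsto (fun t : ℝ => t ^ m * Real.exp (-s * t)) Filter.atTop (𝓝 0) := by
      have := tendsto_rpow_mul_exp_neg_mul_atTop_nhds_zero (m : ℝ) s hs
      simpa using this
    -- Substitute `1 + t` for `t`, which costs the factor `exp s`.
    have h3 := (h2.comp (Filter.tendsto_atTop_add_const_left Filter.atTop (1 : ℝ)
      Filter.tendsto_id)).const_mul (Real.exp s)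
    rw [mul_zero] at h3
    refine h3.congr fun t => ?_
    simp only [Function.comp_apply, id]
    rw [mul_left_comm, ← Real.exp_add]
    congr 2
    ring
  have hcont : Continuous fun t : ℝ => (1 + t) ^ m * Real.exp (-(s * t)) := by fun_prop
  obtain ⟨T, hT⟩ := Filter.eventually_atTop.1 (h1.eventually (gt_mem_nhds zero_lt_one))
  obtain ⟨D, hD⟩ := (isCompact_Icc (a := (0 : ℝ)) (b := T)).bddAbove_image hcont.continuousOn
  have hbd : ∀ t : ℝ, 0 ≤ t → (1 + t) ^ m * Real.exp (-(s * t)) ≤ max D 1 := by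
    intro t ht
    rcases le_total t T with h | h
    · exact (hD ⟨t, ⟨ht, h⟩, rfl⟩).trans (le_max_left _ _)
    · exact (hT t h).le.trans (le_max_right _ _)
  have hmax : 0 < max D 1 := lt_max_of_lt_right zero_lt_one
  refine ⟨K * (Real.exp s * max D 1) + 1, by positivity, fun x hx => ?_⟩
  set t := ‖Y x‖ with ht
  have ht0 : 0 ≤ t := norm_nonneg _
  -- This is `t² - t + 1 = (t - 1)² + t ≥ 0`, multiplied by `s`.
  have h4 : Real.exp (-s * t ^ 2) ≤ Real.exp s * Real.exp (-(s * t)) := by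
    rw [← Real.exp_add]
    refine Real.exp_le_exp.2 ?_
    nlinarith [mul_nonneg hs.le (sq_nonneg (t - 1)), mul_nonneg hs.le ht0]
  calc h x * Real.exp (-s * t ^ 2) ≤ K * (1 + t) ^ m * Real.exp (-s * t ^ 2) :=
        mul_le_mul_of_nonneg_right (hb x hx) (Real.exp_pos _).le
    _ ≤ K * (1 + t) ^ m * (Real.exp s * Real.exp (-(s * t))) := by gcongr
    _ = K * (Real.exp s * ((1 + t) ^ m * Real.exp (-(s * t)))) := by ring
    _ ≤ K * (Real.exp s * max D 1) := by gcongr; exact hbd t ht0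
    _ ≤ _ := by linarith

/-- The leading coefficient is a denominator for a root. -/
theorem norm_leadingCoeff_mul_le {R : Type*} [CommRing R] (ev : R →+* ℂ) (p : Polynomial R) {φ : ℂ}
    (hφ : Polynomial.eval₂ ev φ p = 0) :
    ‖ev p.leadingCoeff * φ‖ ≤ ∑ i ∈ Finset.range (p.natDegree + 1), ‖ev (p.coeff i)‖ := by
  rw [Polynomial.eval₂_eq_sum_range] at hφ
  rw [norm_mul, Polynomial.leadingCoeff]
  rcases le_total ‖φ‖ 1 with h1 | h1
  · refine (mul_le_of_le_one_right (norm_nonneg _) h1).trans ?_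
    exact Finset.single_le_sum (f := fun i => ‖ev (p.coeff i)‖) (fun _ _ => norm_nonneg _)
      (Finset.self_mem_range_succ _)
  rw [Finset.sum_range_succ] at hφ ⊢
  rcases Nat.eq_zero_or_pos p.natDegree with h0 | h0
  · rw [h0] at hφ ⊢
    have : ev (p.coeff 0) = 0 := by simpa using hφ
    simp [this]
  obtain ⟨k, hk⟩ : ∃ k, p.natDegree = k + 1 := ⟨_, (Nat.succ_pred_eq_of_pos h0).symm⟩
  have hpos : 0 < ‖φ‖ ^ k := pow_pos (by linarith) k
  -- For `‖φ‖ ≥ 1` and positive degree, isolate the leading term and divide by `‖φ‖ ^ (deg - 1)`,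
  -- which bounds every lower power.
  have h2 : ‖ev (p.coeff p.natDegree)‖ * ‖φ‖ * ‖φ‖ ^ k
      ≤ (∑ i ∈ Finset.range p.natDegree, ‖ev (p.coeff i)‖) * ‖φ‖ ^ k := by
    have h3 : ev (p.coeff p.natDegree) * φ ^ p.natDegree
        = -∑ i ∈ Finset.range p.natDegree, ev (p.coeff i) * φ ^ i := by
      linear_combination hφ
    calc ‖ev (p.coeff p.natDegree)‖ * ‖φ‖ * ‖φ‖ ^ k = ‖ev (p.coeff p.natDegree) * φ ^ p.natDegree‖ := by
          rw [norm_mul, norm_pow]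
          conv_rhs => rw [hk, pow_succ]
          rw [hk]; ring
      _ = ‖∑ i ∈ Finset.range p.natDegree, ev (p.coeff i) * φ ^ i‖ := by rw [h3, norm_neg]
      _ ≤ ∑ i ∈ Finset.range p.natDegree, ‖ev (p.coeff i)‖ * ‖φ‖ ^ k := by
          refine (norm_sum_le _ _).trans (Finset.sum_le_sum fun i hi => ?_)
          rw [norm_mul, norm_pow]
          refine mul_le_mul_of_nonneg_left (pow_le_pow_right₀ h1 ?_) (norm_nonneg _)
          have := Finset.mem_range.1 hi
          omega
      _ = _ := by rw [Finset.sum_mul]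
  have h4 := le_of_mul_le_mul_right h2 hpos
  linarith [norm_nonneg (ev (p.coeff p.natDegree))]

end PolyBdd

/-! ### Algebraic dependence of the coordinates -/

section algebraic

variable {n : ℕ} {M : Type*} [TopologicalSpace M] [ChartedSpace (Cn n) M]
  [IsManifold 𝓘(ℂ, Cn n) ω M] {N : ℕ} {f : M → CP N}

/-- The coordinates `⟪b_α, F⟫` of the normalized lift `F`. -/
def ycoord (b : Fin n → HV N) (F : HV N) : Cn n := WithLp.toLp 2 fun α => inner ℂ (b α) F

/-- A homogeneous monomial of degree `d` in the linear forms `⟪ℓ i, ·⟫` and `⟪a, ·⟫`. -/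
def homMono {k K : ℕ} (ℓ : Fin k → HV N) (a : HV N) (d : ℕ) (κ : Fin k → Fin K) (Z : HV N) : ℂ :=
  (∏ i, inner ℂ (ℓ i) Z ^ (κ i : ℕ)) * inner ℂ a Z ^ (d - ∑ i, (κ i : ℕ))

theorem homMono_smul {k K : ℕ} (ℓ : Fin k → HV N) (a : HV N) {d : ℕ} (κ : Fin k → Fin K)
    (hd : ∑ i, (κ i : ℕ) ≤ d) (t : ℂ) (Z : HV N) :
    homMono ℓ a d κ (t • Z) = t ^ d * homMono ℓ a d κ Z := by
  simp only [homMono, inner_smul_right, mul_pow, Finset.prod_mul_distrib, Finset.prod_pow_eq_pow_sum]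
  conv_rhs => rw [← Nat.add_sub_cancel' hd, pow_add]
  rw [Nat.add_sub_cancel' hd]
  ring

theorem analyticAt_homMono {k K : ℕ} (ℓ : Fin k → HV N) (a : HV N) (d : ℕ) (κ : Fin k → Fin K)
    (Z : HV N) : AnalyticAt ℂ (homMono ℓ a d κ) Z := by
  have h : ∀ u : HV N, AnalyticAt ℂ (fun Z => inner ℂ u Z) Z := fun u => (innerSL ℂ u).analyticAt Z
  exact (Finset.analyticAt_fun_prod _ fun i _ => (h _).pow _).mul ((h a).pow _)

/-- Any further coordinate is algebraic over the coordinates `⟪b_α, F⟫`. -/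
theorem exists_polynomial_relation [CompactSpace M]
    (hf : ContMDiff 𝓘(ℂ, Cn n) 𝓘(ℂ, Cn N) ω f) (a : HV N) (b : Fin n → HV N) (u : HV N) :
    ∃ p : Polynomial (MvPolynomial (Fin n) ℂ), p ≠ 0 ∧ ∀ x, f x ∈ CP.compl a →
      Polynomial.eval₂ (MvPolynomial.eval fun α => ycoord b (CP.nlift a (f x)) α)
        (inner ℂ u (CP.nlift a (f x))) p = 0 := by
  obtain ⟨s, hs⟩ := exists_linear_relation hf
  -- There are `K ^ (n + 1)` monomials with exponents below `K` in `n + 1` forms, all of degree at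
  -- most `d = (n + 1) K`. Since `2d + 1 ≤ (2n + 3) K`, the number of conditions is at most `s (2n +
  -- 3)ⁿ Kⁿ < K ^ (n + 1)`.
  set K := s * (2 * n + 3) ^ n + 1 with hK
  set d := (n + 1) * K with hd
  set ℓ : Fin (n + 1) → HV N := Fin.snoc (α := fun _ => HV N) b u with hℓ
  have hsum : ∀ κ : Fin (n + 1) → Fin K, ∑ i, (κ i : ℕ) ≤ d := by
    intro κ
    refine (Finset.sum_le_sum fun i _ => (κ i).2.le).trans_eq ?_
    simp [hd]
  have hcard : s * (2 * d + 1) ^ n < Fintype.card (Fin (n + 1) → Fin K) := by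
    rw [Fintype.card_fun, Fintype.card_fin, Fintype.card_fin, pow_succ]
    have h1 : 2 * d + 1 ≤ (2 * n + 3) * K := by
      rw [hd]; nlinarith [Nat.succ_pos (s * (2 * n + 3) ^ n)]
    calc s * (2 * d + 1) ^ n ≤ s * ((2 * n + 3) * K) ^ n := by gcongr
      _ = K ^ n * (s * (2 * n + 3) ^ n) := by rw [mul_pow]; ring
      _ < K ^ n * K := by
          refine Nat.mul_lt_mul_of_pos_left (by omega) (pow_pos (by omega) _)
  obtain ⟨C, hC0, hC⟩ := hs (homMono ℓ a d) d (fun κ Z => analyticAt_homMono ℓ a d κ Z)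
    (fun κ t Z => homMono_smul ℓ a κ (hsum κ) t Z) hcard
  set γ : (Fin (n + 1) → Fin K) → (Fin n →₀ ℕ) := fun κ =>
    Finsupp.equivFunOnFinite.symm fun α => (κ α.castSucc : ℕ) with hγ
  refine ⟨∑ κ, Polynomial.monomial (κ (Fin.last n) : ℕ) (MvPolynomial.monomial (γ κ) (C κ)),
    ?_, ?_⟩
  · intro h0
    apply hC0
    ext κ₀
    -- Distinct exponent vectors give distinct monomials, so the coefficient at `κ₀` is exactly `C
    -- κ₀`.
    have h1 := congrArg (fun p => MvPolynomial.coeff (γ κ₀)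
      (Polynomial.coeff p (κ₀ (Fin.last n) : ℕ))) h0
    simp only [Polynomial.finsetSum_coeff, Polynomial.coeff_monomial, MvPolynomial.coeff_sum,
      Polynomial.coeff_zero, MvPolynomial.coeff_zero] at h1
    rw [Finset.sum_eq_single κ₀] at h1
    · simpa using h1
    · intro κ _ hκ
      split_ifs with h2
      · rw [MvPolynomial.coeff_monomial, if_neg]
        intro h3
        apply hκ
        ext i
        refine Fin.lastCases ?_ (fun α => ?_) i
        · exact h2
        · exact DFunLike.congr_fun h3 α
      · rfl
    · intro h; exact absurd (Finset.mem_univ _) h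
  · intro x hx
    set F := CP.nlift a (f x) with hF
    have hw : inner ℂ a (f x).vec ≠ 0 := hx
    have h1 : (f x).vec = inner ℂ a (f x).vec • F := by
      rw [hF, CP.nlift, smul_smul, mul_inv_cancel₀ hw, one_smul]
    have h2 := hC x
    rw [h1] at h2
    simp only [homMono_smul ℓ a _ (hsum _)] at h2
    have h3 : ∑ κ, C κ * homMono ℓ a d κ F = 0 := by
      have h4 : inner ℂ a (f x).vec ^ d * ∑ κ, C κ * homMono ℓ a d κ F = 0 := by
        rw [← h2, Finset.mul_sum]
        exact Finset.sum_congr rfl fun κ _ => by ring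
      exact (mul_eq_zero.1 h4).resolve_left (pow_ne_zero _ hw)
    rw [← h3, Polynomial.eval₂_finsetSum]
    refine Finset.sum_congr rfl fun κ _ => ?_
    rw [Polynomial.eval₂_monomial, MvPolynomial.eval_monomial, homMono, CP.inner_nlift hx, one_pow,
      mul_one, Fin.prod_univ_castSucc, mul_assoc]
    congr 2
    · rw [Finsupp.prod_fintype _ _ (fun i => pow_zero _)]
      refine Finset.prod_congr rfl fun α _ => ?_
      simp [hℓ, hγ, ycoord]
    · simp [hℓ]

/-- A polynomial in the coordinates `⟪b_α, F⟫` whose product with `F` has polynomial growth. -/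
theorem exists_denominator [CompactSpace M]
    (hf : ContMDiff 𝓘(ℂ, Cn n) 𝓘(ℂ, Cn N) ω f) (a : HV N) (b : Fin n → HV N) :
    ∃ Q : MvPolynomial (Fin n) ℂ, Q ≠ 0 ∧
      PolyBdd {x | f x ∈ CP.compl a} (fun x => ycoord b (CP.nlift a (f x))) (fun x =>
        ‖MvPolynomial.eval (fun α => ycoord b (CP.nlift a (f x)) α) Q‖ * ‖CP.nlift a (f x)‖) := by
  choose p hp0 hp using fun j : Fin (N + 1) =>
    exists_polynomial_relation hf a b (EuclideanSpace.single j (1 : ℂ))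
  -- The product of the leading coefficients is a common denominator for all coordinates of the
  -- lift.
  refine ⟨∏ j, (p j).leadingCoeff, Finset.prod_ne_zero_iff.2 fun j _ =>
    Polynomial.leadingCoeff_ne_zero.2 (hp0 j), ?_⟩
  have h1 : ∀ j, PolyBdd {x | f x ∈ CP.compl a} (fun x => ycoord b (CP.nlift a (f x))) (fun x =>
      ‖MvPolynomial.eval (fun α => ycoord b (CP.nlift a (f x)) α) (∏ i, (p i).leadingCoeff)‖
        * ‖CP.nlift a (f x) j‖) := by
    intro j
    have h2 : PolyBdd {x | f x ∈ CP.compl a} (fun x => ycoord b (CP.nlift a (f x))) (fun x =>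
        ‖MvPolynomial.eval (fun α => ycoord b (CP.nlift a (f x)) α) (p j).leadingCoeff
          * CP.nlift a (f x) j‖) := by
      refine (PolyBdd.sum (Finset.range ((p j).natDegree + 1)) fun i _ =>
        PolyBdd.eval ((p j).coeff i)).mono fun x hx => ?_
      have := norm_leadingCoeff_mul_le _ _ (hp j x hx)
      rwa [EuclideanSpace.inner_single_left, map_one, one_mul] at this
    refine ((PolyBdd.eval (∏ i ∈ Finset.univ.erase j, (p i).leadingCoeff)).mul h2
      (fun _ => norm_nonneg _) fun _ => norm_nonneg _).mono fun x _ => ?_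
    rw [← Finset.mul_prod_erase _ _ (Finset.mem_univ j), map_mul, norm_mul, norm_mul]
    refine le_of_eq ?_
    ring
  refine (PolyBdd.sum Finset.univ fun j _ => h1 j).mono fun x _ => ?_
  rw [← Finset.mul_sum]
  refine mul_le_mul_of_nonneg_left ?_ (norm_nonneg _)
  have h3 : CP.nlift a (f x) = ∑ j, EuclideanSpace.single j (CP.nlift a (f x) j) := by
    ext i; simp [Pi.single_apply]
  conv_lhs => rw [h3]
  refine (norm_sum_le _ _).trans_eq ?_
  simp

end algebraic

/-! ### The maximum principle -/

section maximum

variable {E : Type*} [NormedAddCommGroup E] [NormedSpace ℝ E]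

/-- If the second derivative along the line were positive, the point would also be a local minimum
there. The restriction would then be locally constant, with zero second derivative. -/
theorem fderiv_fderiv_apply_nonpos {ψ : E → ℝ} {z : E} (hψ : AnalyticAt ℝ ψ z)
    (hmax : IsLocalMax ψ z) (v : E) : fderiv ℝ (fun x => fderiv ℝ ψ x v) z v ≤ 0 := by
  by_contra! hpos
  have hl : ∀ t : ℝ, HasDerivAt (fun t : ℝ => z + t • v) v t := fun t => by
    simpa using ((hasDerivAt_id t).smul_const v).const_add z
  have hlc : Filter.Tendsto (fun t : ℝ => z + t • v) (𝓝 0) (𝓝 z) := by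
    simpa using (hl 0).continuousAt.tendsto
  set χ : ℝ → ℝ := fun t => ψ (z + t • v) with hχ
  have hder : deriv χ =ᶠ[𝓝 0] fun t => fderiv ℝ ψ (z + t • v) v := by
    filter_upwards [hlc.eventually hψ.eventually_analyticAt] with t ht
    exact (ht.differentiableAt.hasFDerivAt.comp_hasDerivAt t (hl t)).deriv
  have han : DifferentiableAt ℝ (fun x => fderiv ℝ ψ x v) z :=
    (((ContinuousLinearMap.apply ℝ ℝ v).analyticAt _).comp_of_eq hψ.fderiv rfl).differentiableAt
  have hdd : deriv (deriv χ) 0 = fderiv ℝ (fun x => fderiv ℝ ψ x v) z v := by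
    rw [hder.deriv_eq]
    have h1 : HasFDerivAt (fun x => fderiv ℝ ψ x v) (fderiv ℝ (fun x => fderiv ℝ ψ x v) z)
        (z + (0 : ℝ) • v) := by simpa using han.hasFDerivAt
    exact (h1.comp_hasDerivAt (0 : ℝ) (hl 0)).deriv
  have hχmax : IsLocalMax χ 0 := by
    have := hlc.eventually hmax
    simpa [hχ, IsLocalMax, IsMaxFilter] using this
  have hd0 : deriv χ 0 = 0 := hχmax.deriv_eq_zero
  have hc : ContinuousAt χ 0 := by
    have h1 : ContinuousAt ψ (z + (0 : ℝ) • v) := by simpa using hψ.continuousAt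
    exact ContinuousAt.comp (f := fun t : ℝ => z + t • v) h1 (hl 0).continuousAt
  have hχmin : IsLocalMin χ 0 := isLocalMin_of_deriv_deriv_pos (by rw [hdd]; exact hpos) hd0 hc
  have hconst : χ =ᶠ[𝓝 0] fun _ => χ 0 := by
    filter_upwards [hχmin, hχmax] with t h1 h2 using le_antisymm h2 h1
  have hderiv0 : deriv χ =ᶠ[𝓝 0] fun _ => (0 : ℝ) := by
    filter_upwards [hconst.eventuallyEq_nhds] with t ht
    rw [ht.deriv_eq, deriv_const]
  rw [← hdd, hderiv0.deriv_eq, deriv_const] at hpos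
  exact lt_irrefl _ hpos

variable [NormedSpace ℂ E]

/-- The real part is a quarter of the Laplacian of `ψ` on the complex line spanned by `v`. -/
theorem wd_wdbar_re_nonpos {ψ : E → ℝ} {z : E} (hψ : AnalyticAt ℝ ψ z)
    (hmax : IsLocalMax ψ z) (v : E) :
    (wd v (wdbar v (fun x => (ψ x : ℂ))) z).re ≤ 0 := by
  have han : ∀ u, DifferentiableAt ℝ (fun x => fderiv ℝ ψ x u) z := fun u =>
    (((ContinuousLinearMap.apply ℝ ℝ u).analyticAt _).comp_of_eq hψ.fderiv rfl).differentiableAt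
  have h1 : wdbar v (fun x => (ψ x : ℂ)) =ᶠ[𝓝 z] fun x =>
      ((fderiv ℝ ψ x v : ℂ) + Complex.I * (fderiv ℝ ψ x (Complex.I • v) : ℂ)) / 2 := by
    filter_upwards [hψ.eventually_analyticAt] with x hx
    have h2 := (Complex.ofRealCLM.hasFDerivAt (x := ψ x)).comp x hx.differentiableAt.hasFDerivAt
    have h3 : HasFDerivAt (fun x => (ψ x : ℂ)) (Complex.ofRealCLM.comp (fderiv ℝ ψ x)) x := h2
    rw [wdbar, h3.fderiv]
    rfl
  have h4 : ∀ u, HasFDerivAt (fun x => (fderiv ℝ ψ x u : ℂ))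
      (Complex.ofRealCLM.comp (fderiv ℝ (fun x => fderiv ℝ ψ x u) z)) z := fun u =>
    (Complex.ofRealCLM.hasFDerivAt (x := fderiv ℝ ψ z u)).comp z (han u).hasFDerivAt
  have h5 := ((h4 v).add ((h4 (Complex.I • v)).const_mul Complex.I)).mul_const (2 : ℂ)⁻¹
  have h6 : HasFDerivAt (wdbar v (fun x => (ψ x : ℂ))) _ z :=
    h5.congr_of_eventuallyEq (h1.trans (Filter.Eventually.of_forall fun x => div_eq_mul_inv _ _))
  have h7 := fderiv_fderiv_apply_nonpos hψ hmax v
  have h8 := fderiv_fderiv_apply_nonpos hψ hmax (Complex.I • v)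
  rw [wd, h6.fderiv]
  simp only [smul_apply, add_apply, ContinuousLinearMap.comp_apply, Complex.ofRealCLM_apply,
    smul_eq_mul]
  simp
  linarith

end maximum

/-- Comparison of determinants of Hermitian forms. -/
theorem det_re_le_of_form_le {n : ℕ} {G J : Matrix (Fin n) (Fin n) ℂ} (hG : G.IsHermitian)
    (hG0 : ∀ x : Fin n → ℂ, 0 ≤ (star x ⬝ᵥ G.mulVec x).re) (hJ : IsUnit J.det) {s : ℝ}
    (h : ∀ x : Fin n → ℂ, (star x ⬝ᵥ G.mulVec x).re
      ≤ s * (star (J.conjTranspose.mulVec x) ⬝ᵥ J.conjTranspose.mulVec x).re) :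
    G.det.re ≤ s ^ n * ‖J.det‖ ^ 2 := by
  -- In the frame straightened by `J` the hypothesis compares `H` with `s` times the identity. Its
  -- eigenvalues therefore lie in `[0, s]`, and `det G = |det J|² det H`.
  set H := J⁻¹ * G * (J⁻¹).conjTranspose with hH
  have hHh : H.IsHermitian := Matrix.isHermitian_mul_mul_conjTranspose _ hG
  have hGH : G = J * H * J.conjTranspose := by
    have h1 : (J⁻¹).conjTranspose * J.conjTranspose = 1 := by
      rw [← Matrix.conjTranspose_mul, Matrix.mul_nonsing_inv _ hJ, Matrix.conjTranspose_one]
    rw [hH]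
    calc G = (J * J⁻¹) * G * ((J⁻¹).conjTranspose * J.conjTranspose) := by
          rw [h1, Matrix.mul_nonsing_inv _ hJ, Matrix.one_mul, Matrix.mul_one]
      _ = _ := by simp only [Matrix.mul_assoc]
  have hquad : ∀ x : Fin n → ℂ, star x ⬝ᵥ H.mulVec x
      = star ((J⁻¹).conjTranspose.mulVec x) ⬝ᵥ G.mulVec ((J⁻¹).conjTranspose.mulVec x) := by
    intro x
    rw [hH, Matrix.star_mulVec, Matrix.conjTranspose_conjTranspose, ← Matrix.dotProduct_mulVec,
      Matrix.mulVec_mulVec, Matrix.mulVec_mulVec, Matrix.mul_assoc]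
  have heig : ∀ i, 0 ≤ hHh.eigenvalues i ∧ hHh.eigenvalues i ≤ s := by
    intro i
    rw [hHh.eigenvalues_eq, hquad]
    refine ⟨hG0 _, (h _).trans_eq ?_⟩
    rw [Matrix.mulVec_mulVec, ← Matrix.conjTranspose_mul, Matrix.nonsing_inv_mul _ hJ,
      Matrix.conjTranspose_one, Matrix.one_mulVec]
    have h1 := hHh.eigenvectorBasis.orthonormal.1 i
    have h2 : star (hHh.eigenvectorBasis i).ofLp ⬝ᵥ (hHh.eigenvectorBasis i).ofLp = 1 := by
      rw [dotProduct_comm, ← EuclideanSpace.inner_eq_star_dotProduct, inner_self_eq_norm_sq_to_K, h1]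
      simp
    rw [h2]; simp
  have hdet : H.det.re ≤ s ^ n := by
    rw [hHh.det_eq_prod_eigenvalues]
    have : (∏ i, (hHh.eigenvalues i : ℂ)) = ((∏ i, hHh.eigenvalues i : ℝ) : ℂ) := by push_cast; rfl
    erw [this]
    rw [Complex.ofReal_re]
    refine (Finset.prod_le_prod (fun i _ => (heig i).1) fun i _ => (heig i).2).trans_eq ?_
    simp
  have h3 : G.det.re = ‖J.det‖ ^ 2 * H.det.re := by
    conv_lhs => rw [hGH]
    rw [Matrix.det_mul, Matrix.det_mul, Matrix.det_conjTranspose, mul_right_comm,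
      RCLike.star_def, Complex.mul_conj, Complex.normSq_eq_norm_sq, Complex.re_ofReal_mul]
  rw [h3, mul_comm]
  exact mul_le_mul_of_nonneg_right hdet (by positivity)

/-! ### Comparing the metric with `s ‖y‖²` at a maximum -/

section coordinates

variable {n N : ℕ}

/-- `ycoord` as a linear map. -/
def ycoordL (b : Fin n → HV N) : HV N →L[ℂ] Cn n :=
  LinearMap.toContinuousLinearMap
    { toFun := ycoord b
      map_add' := fun x y => by ext α; simp [ycoord]
      map_smul' := fun c x => by ext α; simp [ycoord] }

theorem fderiv_ycoord {b : Fin n → HV N} {Φ : Cn n → HV N} {z : Cn n}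
    (hΦ : DifferentiableAt ℂ Φ z) (v : Cn n) :
    fderiv ℂ (fun x => ycoord b (Φ x)) z v = ycoord b (fderiv ℂ Φ z v) := by
  have : HasFDerivAt (fun x => ycoord b (Φ x)) ((ycoordL b).comp (fderiv ℂ Φ z)) z :=
    (ycoordL b).hasFDerivAt.comp z hΦ.hasFDerivAt
  rw [this.fderiv]; rfl

theorem analyticAt_eval (Q : MvPolynomial (Fin n) ℂ) (y : Cn n) :
    AnalyticAt ℂ (fun y : Cn n => MvPolynomial.eval (fun α => y α) Q) y := by
  induction Q using MvPolynomial.induction_on with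
  | C c => simpa using analyticAt_const
  | add p q hp hq =>
    simp only [map_add]
    exact hp.add hq
  | mul_X p α hp =>
    simp only [map_mul, MvPolynomial.eval_X]
    exact hp.mul ((EuclideanSpace.proj α : Cn n →L[ℂ] ℂ).analyticAt y)

/-- At a maximum of `log ‖Φ‖² + 2 log ‖q‖² - s ‖y‖²` the Hermitian form of `log ‖Φ‖²` is bounded
by that of `s ‖y‖²`. -/
theorem hform_re_le_of_isLocalMax {b : Fin n → HV N} {Φ : Cn n → HV N} {q : Cn n → ℂ} {z : Cn n}
    {s : ℝ} (hΦ : AnalyticAt ℂ Φ z) (h0 : Φ z ≠ 0) (hq : AnalyticAt ℂ q z) (hq0 : q z ≠ 0)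
    (hmax : IsLocalMax (fun x => Real.log (‖Φ x‖ ^ 2) + (2 * Real.log (‖q x‖ ^ 2)
      - s * ‖ycoord b (Φ x)‖ ^ 2)) z) (v : Cn n) :
    (hform (Φ z) (fderiv ℂ Φ z v) (fderiv ℂ Φ z v)).re
      ≤ s * ‖ycoord b (fderiv ℂ Φ z v)‖ ^ 2 := by
  have hy : AnalyticAt ℂ (fun x => ycoord b (Φ x)) z := ((ycoordL b).analyticAt _).comp_of_eq hΦ rfl
  set T₁ : Cn n → ℂ := fun x => (Real.log (‖Φ x‖ ^ 2) : ℂ) with hT₁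
  set T₂ : Cn n → ℂ := fun x => (Real.log (‖q x‖ ^ 2) : ℂ) with hT₂
  set T₃ : Cn n → ℂ := fun x => inner ℂ (ycoord b (Φ x)) (ycoord b (Φ x)) with hT₃
  have a₁ : AnalyticAt ℝ T₁ z := analyticAt_ofReal (analyticAt_log_norm_sq hΦ h0)
  have a₂ : AnalyticAt ℝ T₂ z := analyticAt_ofReal (analyticAt_log_norm_sq hq hq0)
  have a₃ : AnalyticAt ℝ T₃ z := analyticAt_inner hy.restrictScalars hy.restrictScalars
  set ψ : Cn n → ℝ := fun x => Real.log (‖Φ x‖ ^ 2) + (2 * Real.log (‖q x‖ ^ 2)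
      - s * ‖ycoord b (Φ x)‖ ^ 2) with hψ
  have hψT : (fun x => (ψ x : ℂ)) = fun x => T₁ x + ((2 : ℂ) * T₂ x - (s : ℂ) * T₃ x) := by
    ext x
    simp only [hψ, hT₁, hT₂, hT₃, inner_self_eq_ofReal]
    push_cast; ring
  have aψ : AnalyticAt ℝ ψ z := by
    have h1 : AnalyticAt ℝ (fun x => (ψ x : ℂ)) z := by
      rw [hψT]
      exact a₁.add ((analyticAt_const.mul a₂).sub (analyticAt_const.mul a₃))
    exact (Complex.reCLM.analyticAt _).comp_of_eq h1 rfl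
  have key := wd_wdbar_re_nonpos aψ hmax v
  have split : wdbar v (fun x => (ψ x : ℂ)) =ᶠ[𝓝 z]
      fun x => wdbar v T₁ x + ((2 : ℂ) * wdbar v T₂ x - (s : ℂ) * wdbar v T₃ x) := by
    filter_upwards [a₁.eventually_analyticAt, a₂.eventually_analyticAt, a₃.eventually_analyticAt]
      with x h₁ h₂ h₃
    have d₂ : DifferentiableAt ℝ (fun z => (2 : ℂ) * T₂ z) x := h₂.differentiableAt.const_mul _
    have d₃ : DifferentiableAt ℝ (fun z => (s : ℂ) * T₃ z) x := h₃.differentiableAt.const_mul _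
    have d₂₃ : DifferentiableAt ℝ (fun z => (2 : ℂ) * T₂ z - (s : ℂ) * T₃ z) x := d₂.sub d₃
    rw [hψT, wdbar_add h₁.differentiableAt d₂₃, wdbar_sub d₂ d₃,
      wdbar_const_mul _ h₂.differentiableAt, wdbar_const_mul _ h₃.differentiableAt]
  have d₁ := (AnalyticAt.wdbar (v := v) a₁).differentiableAt
  have e₂ := (AnalyticAt.wdbar (v := v) a₂).differentiableAt
  have e₃ := (AnalyticAt.wdbar (v := v) a₃).differentiableAt
  have d₂ : DifferentiableAt ℝ (fun x => (2 : ℂ) * wdbar v T₂ x) z := e₂.const_mul _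
  have d₃ : DifferentiableAt ℝ (fun x => (s : ℂ) * wdbar v T₃ x) z := e₃.const_mul _
  have d₂₃ : DifferentiableAt ℝ
      (fun x => (2 : ℂ) * wdbar v T₂ x - (s : ℂ) * wdbar v T₃ x) z := d₂.sub d₃
  -- The term in `log ‖q‖²` drops out by pluriharmonicity, so the denominator does not affect the
  -- Hessian comparison.
  rw [wd_congr split, wd_add d₁ d₂₃, wd_sub d₂ d₃, wd_const_mul _ e₂, wd_const_mul _ e₃,
    wd_wdbar_log_norm_sq hΦ h0, wd_wdbar_log_norm_sq hq hq0, hform_eq_zero_of_scalar hq0] at key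
  have h3 : wd v (wdbar v T₃) z = ((‖ycoord b (fderiv ℂ Φ z v)‖ ^ 2 : ℝ) : ℂ) := by
    have h4 : wdbar v T₃ =ᶠ[𝓝 z] fun x =>
        inner ℂ (fderiv ℂ (fun x => ycoord b (Φ x)) x v) (ycoord b (Φ x)) := by
      filter_upwards [hy.eventually_analyticAt] with x hx
      exact wdbar_inner hx.differentiableAt hx.differentiableAt
    rw [wd_congr h4, wd_inner (analyticAt_fderiv_apply hy v).differentiableAt hy.differentiableAt,
      fderiv_ycoord hΦ.differentiableAt, inner_self_eq_ofReal]
  rw [h3, mul_zero, zero_sub, Complex.add_re, Complex.neg_re, ← Complex.ofReal_mul,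
    Complex.ofReal_re] at key
  linarith

/-- The Jacobian matrix computes the differential of `ycoord b ∘ Φ`. -/
theorem jac_conjTranspose_mulVec (b : Fin n → HV N) (Φ : Cn n → HV N) (z : Cn n)
    (x : Fin n → ℂ) :
    (jac b Φ z).conjTranspose.mulVec x
      = star (ycoord b (fderiv ℂ Φ z (WithLp.toLp 2 (star x)))).ofLp := by
  ext β
  rw [map_eq_sum_basisVec]
  simp [Matrix.mulVec, dotProduct, jac, ycoord, mul_comm]

theorem det_gram_re_le_of_form_le {b : Fin n → HV N} {Φ : Cn n → HV N} {z : Cn n} {s : ℝ}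
    (hpos : ∀ v ≠ 0, 0 < (hform (Φ z) (fderiv ℂ Φ z v) (fderiv ℂ Φ z v)).re)
    (hJ : (jac b Φ z).det ≠ 0)
    (h : ∀ v, (hform (Φ z) (fderiv ℂ Φ z v) (fderiv ℂ Φ z v)).re
      ≤ s * ‖ycoord b (fderiv ℂ Φ z v)‖ ^ 2) :
    (gram Φ z).det.re ≤ s ^ n * ‖(jac b Φ z).det‖ ^ 2 := by
  refine det_re_le_of_form_le (gram_isHermitian Φ z) (fun x => ?_) (isUnit_iff_ne_zero.2 hJ)
    fun x => ?_
  · rw [star_dotProduct_gram]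
    rcases eq_or_ne (WithLp.toLp 2 (star x) : Cn n) 0 with h0 | h0
    · rw [h0]; simp [hform]
    · exact (hpos _ h0).le
  · rw [star_dotProduct_gram, jac_conjTranspose_mulVec, star_star]
    refine (h _).trans_eq ?_
    set y := ycoord b (fderiv ℂ Φ z (WithLp.toLp 2 (star x)))
    have h1 : y.ofLp ⬝ᵥ star y.ofLp = ((‖y‖ ^ 2 : ℝ) : ℂ) := by
      rw [← inner_self_eq_ofReal, EuclideanSpace.inner_eq_star_dotProduct]
    rw [h1, Complex.ofReal_re]

end coordinates

/-! ### The barrier and the contradiction -/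

section main

variable {n : ℕ} {M : Type*} [TopologicalSpace M] [ChartedSpace (Cn n) M]
  [IsManifold 𝓘(ℂ, Cn n) ω M] {N : ℕ} {f : M → CP N} {κ c : ℝ} {b : Fin n → HV N} {a : HV N}

theorem volId_of_mem_volSet {x : M} (hx : x ∈ volSet κ c b a f) :
    VolId κ c b (clift a f (chartAt (Cn n) x)) (chartAt (Cn n) x x) :=
  hx.2.self_of_nhds

theorem symm_chartAt_apply (x : M) : (chartAt (Cn n) x).symm (chartAt (Cn n) x x) = x :=
  (chartAt (Cn n) x).left_inv (mem_chart_source _ x)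

theorem hform_clift_chartAt_re_pos {g : Metric n M} (hf : IsKahlerImmersion g f) {x : M}
    (hx : f x ∈ CP.compl a) (v : Cn n) (hv : v ≠ 0) :
    0 < (hform (clift a f (chartAt (Cn n) x) (chartAt (Cn n) x x))
      (fderiv ℂ (clift a f (chartAt (Cn n) x)) (chartAt (Cn n) x x) v)
      (fderiv ℂ (clift a f (chartAt (Cn n) x)) (chartAt (Cn n) x x) v)).re :=
  hform_clift_re_pos hf (chart_mem_coords x) (mem_chart_target _ x)
    (by rwa [symm_chartAt_apply]) v hv

theorem analyticAt_clift_chartAt (hf : ContMDiff 𝓘(ℂ, Cn n) 𝓘(ℂ, Cn N) ω f) {x : M}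
    (hx : f x ∈ CP.compl a) :
    AnalyticAt ℂ (clift a f (chartAt (Cn n) x)) (chartAt (Cn n) x x) :=
  analyticAt_clift hf (chart_mem_coords x) (mem_chart_target _ x) (by rwa [symm_chartAt_apply])

/-- The left side of the volume identity is positive because the metric is. Hence the functions
`y_α` are local coordinates on `volSet`. -/
theorem jac_det_ne_zero {g : Metric n M} (hf : IsKahlerImmersion g f) {x : M}
    (hx : x ∈ volSet κ c b a f) :
    (jac b (clift a f (chartAt (Cn n) x)) (chartAt (Cn n) x x)).det ≠ 0 := by
  intro h0
  have h1 := volId_of_mem_volSet hx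
  rw [VolId, h0] at h1
  have h2 := gram_det_re_pos (hform_clift_chartAt_re_pos hf hx.1)
  have h3 := mul_pos h2 (Real.exp_pos (c / 2 * Real.log
    (‖clift a f (chartAt (Cn n) x) (chartAt (Cn n) x x)‖ ^ 2)))
  rw [h1] at h3
  simp at h3

theorem continuousAt_nlift (hf : ContMDiff 𝓘(ℂ, Cn n) 𝓘(ℂ, Cn N) ω f) {x : M}
    (hx : f x ∈ CP.compl a) : ContinuousAt (fun y => CP.nlift a (f y)) x := by
  have hs := mem_chart_source (Cn n) x
  have h1 : ContinuousAt (fun y => clift a f (chartAt (Cn n) x) (chartAt (Cn n) x y)) x :=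
    ContinuousAt.comp (f := chartAt (Cn n) x) (analyticAt_clift_chartAt hf hx).continuousAt
      ((chartAt (Cn n) x).continuousAt hs)
  refine h1.congr ?_
  filter_upwards [(chartAt (Cn n) x).open_source.mem_nhds hs] with y hy
  rw [clift, (chartAt (Cn n) x).left_inv hy]

/-- The coordinates `⟪b_α, F⟫` take a dense-enough set of values for polynomials. -/
theorem exists_eval_ne_zero {g : Metric n M} (hf : IsKahlerImmersion g f) {p : M}
    (hp : p ∈ volSet κ c b a f) {Q : MvPolynomial (Fin n) ℂ} (hQ : Q ≠ 0) :
    ∃ x ∈ volSet κ c b a f,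
      MvPolynomial.eval (fun α => ycoord b (CP.nlift a (f x)) α) Q ≠ 0 := by
  by_contra! hzero
  apply hQ
  set e := chartAt (Cn n) p with he
  have hΦ : AnalyticAt ℂ (clift a f e) (e p) := analyticAt_clift_chartAt hf.holomorphic hp.1
  have hy : AnalyticAt ℂ (fun z => ycoord b (clift a f e z)) (e p) :=
    ((ycoordL b).analyticAt _).comp_of_eq hΦ rfl
  set L := fderiv ℂ (fun z => ycoord b (clift a f e z)) (e p) with hL
  have hLinj : Function.Injective L := by
    rw [injective_iff_map_eq_zero]
    intro v hv
    rw [hL, fderiv_ycoord hΦ.differentiableAt] at hv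
    have h1 := jac_conjTranspose_mulVec b (clift a f e) (e p) (star v.ofLp)
    rw [star_star] at h1
    have h2 : (WithLp.toLp 2 v.ofLp : Cn n) = v := rfl
    rw [h2, hv] at h1
    have h3 : (jac b (clift a f e) (e p)).conjTranspose.det ≠ 0 := by
      rw [Matrix.det_conjTranspose]
      simpa using jac_det_ne_zero hf hp
    have h4 := Matrix.eq_zero_of_mulVec_eq_zero h3 (by rw [h1]; simp)
    ext α
    simpa using congrFun h4 α
  -- An injective differential is invertible, so by the inverse function theorem `y` maps
  -- neighbourhoods of `p` onto neighbourhoods, and `Q` vanishes on an open set.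
  let Le : Cn n ≃L[ℂ] Cn n :=
    (LinearEquiv.ofInjectiveEndo (L : Cn n →ₗ[ℂ] Cn n) hLinj).toContinuousLinearEquiv
  have hstrict : HasStrictFDerivAt (fun z => ycoord b (clift a f e z)) (Le : Cn n →L[ℂ] Cn n)
      (e p) := by
    have h1 := hy.hasStrictFDerivAt
    have h2 : (Le : Cn n →L[ℂ] Cn n) = L := by ext v; rfl
    rwa [h2]
  have hmap := hstrict.map_nhds_eq_of_equiv
  have hev : ∀ᶠ z in 𝓝 (e p), e.symm z ∈ volSet κ c b a f := by
    have h1 : Filter.Tendsto e.symm (𝓝 (e p)) (𝓝 p) := e.tendsto_symm (mem_chart_source _ p)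
    exact h1.eventually ((isOpen_volSet hf.holomorphic).mem_nhds hp)
  have hev2 : ∀ᶠ y in 𝓝 (ycoord b (clift a f e (e p))),
      MvPolynomial.eval (fun α => y α) Q = 0 := by
    rw [← hmap, Filter.eventually_map]
    filter_upwards [hev] with z hz using hzero _ hz
  set y₀ := ycoord b (clift a f e (e p))
  have hev3 : ∀ᶠ y in 𝓝 (y₀.ofLp), MvPolynomial.eval y Q = 0 :=
    (PiLp.continuous_toLp 2 _).continuousAt.eventually hev2
  obtain ⟨r, hr, hball⟩ := Metric.eventually_nhds_iff_ball.1 hev3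
  refine MvPolynomial.funext_set (fun α => Metric.ball (y₀ α) r)
    (fun α => infinite_of_mem_nhds _ (Metric.ball_mem_nhds _ hr)) fun y hy => ?_
  rw [map_zero]
  refine hball y ?_
  rw [Metric.mem_ball, dist_pi_lt_iff hr]
  exact fun α => hy α (Set.mem_univ α)

/-- The auxiliary function `‖F‖² |Q(y)|⁴ exp (-s ‖y‖²)` of the maximum principle. -/
def barrier (s : ℝ) (b : Fin n → HV N) (Q : MvPolynomial (Fin n) ℂ) (F : HV N) : ℝ :=
  ‖F‖ ^ 2 * ‖MvPolynomial.eval (fun α => ycoord b F α) Q‖ ^ 4 * Real.exp (-s * ‖ycoord b F‖ ^ 2)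

theorem continuous_barrier (s : ℝ) (b : Fin n → HV N) (Q : MvPolynomial (Fin n) ℂ) :
    Continuous (barrier s b Q) := by
  have h2 : Continuous (ycoord b) := (ycoordL b).continuous
  have h4 : Continuous fun y : Cn n => MvPolynomial.eval (fun α => y α) Q :=
    continuous_iff_continuousAt.2 fun y => (analyticAt_eval Q y).continuousAt
  have h3 : Continuous fun F => MvPolynomial.eval (fun α => ycoord b F α) Q := h4.comp h2
  exact ((continuous_norm.pow 2).mul (h3.norm.pow 4)).mul
    (Real.continuous_exp.comp (continuous_const.mul (h2.norm.pow 2)))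

theorem barrier_pos {s : ℝ} {b : Fin n → HV N} {Q : MvPolynomial (Fin n) ℂ} {F : HV N}
    (hF : F ≠ 0) (hQ : MvPolynomial.eval (fun α => ycoord b F α) Q ≠ 0) : 0 < barrier s b Q F :=
  mul_pos (mul_pos (pow_pos (norm_pos_iff.2 hF) 2) (pow_pos (norm_pos_iff.2 hQ) 4))
    (Real.exp_pos _)

theorem log_barrier {s : ℝ} {b : Fin n → HV N} {Q : MvPolynomial (Fin n) ℂ} {F : HV N}
    (hF : F ≠ 0) (hQ : MvPolynomial.eval (fun α => ycoord b F α) Q ≠ 0) :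
    Real.log (barrier s b Q F) = Real.log (‖F‖ ^ 2)
      + (2 * Real.log (‖MvPolynomial.eval (fun α => ycoord b F α) Q‖ ^ 2)
        - s * ‖ycoord b F‖ ^ 2) := by
  have h1 := norm_pos_iff.2 hF
  have h2 := norm_pos_iff.2 hQ
  rw [barrier, Real.log_mul (mul_pos (pow_pos h1 2) (pow_pos h2 4)).ne' (Real.exp_pos _).ne',
    Real.log_mul (pow_pos h1 2).ne' (pow_pos h2 4).ne', Real.log_exp, Real.log_pow, Real.log_pow,
    Real.log_pow]
  push_cast
  ring

/-- The distance to the hyperplane, in terms of the normalized lift. -/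
theorem inner_div_norm_sq_mul_nlift {q : CP N} (hq : q ∈ CP.compl a) :
    (‖inner ℂ a q.vec‖ / ‖q.vec‖ ^ 1) ^ 2 * ‖CP.nlift a q‖ ^ 2 = 1 := by
  have h1 : ‖inner ℂ a q.vec‖ ≠ 0 := norm_ne_zero_iff.2 hq
  have h2 : ‖q.vec‖ ≠ 0 := norm_ne_zero_iff.2 (CP.vec_ne_zero _)
  rw [CP.nlift, norm_smul, norm_inv, pow_one]
  field_simp

/-- The barrier attains its maximum over the set where the volume identity holds. -/
theorem exists_max_barrier [CompactSpace M] (hf : ContMDiff 𝓘(ℂ, Cn n) 𝓘(ℂ, Cn N) ω f)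
    {s : ℝ} (hs0 : 0 < s) {Q : MvPolynomial (Fin n) ℂ}
    (hQ : PolyBdd {x | f x ∈ CP.compl a} (fun x => ycoord b (CP.nlift a (f x))) (fun x =>
        ‖MvPolynomial.eval (fun α => ycoord b (CP.nlift a (f x)) α) Q‖ * ‖CP.nlift a (f x)‖))
    {x₁ : M} (hx₁ : x₁ ∈ volSet κ c b a f)
    (hQx₁ : MvPolynomial.eval (fun α => ycoord b (CP.nlift a (f x₁)) α) Q ≠ 0) :
    ∃ x₀ ∈ volSet κ c b a f, 0 < barrier s b Q (CP.nlift a (f x₀)) ∧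
      ∀ x ∈ volSet κ c b a f,
        barrier s b Q (CP.nlift a (f x)) ≤ barrier s b Q (CP.nlift a (f x₀)) := by
  set ψ : M → ℝ := fun x => barrier s b Q (CP.nlift a (f x)) with hψ
  have hψc : ∀ {x}, f x ∈ CP.compl a → ContinuousAt ψ x := fun {x} hx =>
    ContinuousAt.comp (f := fun x => CP.nlift a (f x)) (continuous_barrier s b Q).continuousAt
      (continuousAt_nlift hf hx)
  -- The fourth power of `|Q| ‖F‖` is `‖F‖²` times the polynomial part of the barrier. The bound
  -- thus reads `‖F‖² ψ ≤ D`, so `ψ` tends to `0` where `‖F‖` blows up.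
  obtain ⟨D, hD0, hD⟩ := (hQ.pow (fun _ => mul_nonneg (norm_nonneg _) (norm_nonneg _))
    4).exists_le_mul_exp hs0
  have hψle : ∀ x, f x ∈ CP.compl a → ‖CP.nlift a (f x)‖ ^ 2 * ψ x ≤ D := by
    intro x hx
    refine le_trans (le_of_eq ?_) (hD x hx)
    simp only [hψ, barrier]
    ring
  set τ := ψ x₁ with hτ
  have hτ0 : 0 < τ := barrier_pos (CP.nlift_ne_zero hx₁.1) hQx₁
  -- The function here equals `‖F‖⁻²` off the hyperplane and extends continuously by `0` across it,
  -- so `K₁` is a closed subset of `M` that avoids the hyperplane.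
  set K₁ : Set M := {x | τ / D ≤ (‖inner ℂ a (f x).vec‖ / ‖(f x).vec‖ ^ 1) ^ 2} with hK₁
  have hK₁c : IsClosed K₁ := by
    refine isClosed_le continuous_const (Continuous.pow ?_ 2)
    exact continuous_norm_form_div (P := fun Z => inner ℂ a Z) hf.continuous
      (innerSL ℂ a).continuous fun t Z => by simp
  have hK₁sub : ∀ x ∈ K₁, f x ∈ CP.compl a := by
    intro x hx h0
    have h1 : τ / D ≤ (‖inner ℂ a (f x).vec‖ / ‖(f x).vec‖ ^ 1) ^ 2 := hx
    rw [h0, norm_zero, zero_div, zero_pow two_ne_zero] at h1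
    exact absurd h1 (not_le.2 (div_pos hτ0 hD0))
  set K₀ : Set M := {x | x ∈ volSet κ c b a f ∧ τ ≤ ψ x} with hK₀
  have hK₀K₁ : K₀ ⊆ K₁ := by
    rintro x ⟨hxW, hxτ⟩
    have h2 := inner_div_norm_sq_mul_nlift hxW.1
    have h3 : 0 < ‖CP.nlift a (f x)‖ ^ 2 := pow_pos (norm_pos_iff.2 (CP.nlift_ne_zero hxW.1)) 2
    have h4 : ‖CP.nlift a (f x)‖ ^ 2 * τ ≤ D :=
      (mul_le_mul_of_nonneg_left hxτ h3.le).trans (hψle x hxW.1)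
    change τ / D ≤ _
    rw [div_le_iff₀ hD0, ← mul_le_mul_iff_right₀ h3]
    refine h4.trans_eq ?_
    linear_combination (-D) * h2
  -- Limit points of `K₀` stay in `K₁`, hence off the hyperplane, where `volSet` is relatively
  -- closed and `ψ` is continuous.
  have hK₀c : IsClosed K₀ := by
    refine isClosed_of_closure_subset fun x hx => ?_
    have hxc := hK₁sub x (closure_minimal hK₀K₁ hK₁c hx)
    refine ⟨mem_volSet_of_mem_closure hf (closure_mono (fun y hy => hy.1) hx) hxc, ?_⟩
    by_contra! hlt
    obtain ⟨y, hy1, hy2⟩ := mem_closure_iff_nhds.1 hx _ ((hψc hxc).eventually (gt_mem_nhds hlt))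
    exact absurd hy2.2 (not_le.2 hy1)
  obtain ⟨x₀, hx₀, hmax⟩ := hK₀c.isCompact.exists_isMaxOn ⟨x₁, hx₁, le_rfl⟩
    (fun x hx => (hψc hx.1.1).continuousWithinAt)
  refine ⟨x₀, hx₀.1, hτ0.trans_le hx₀.2, fun x hx => ?_⟩
  rcases le_total τ (ψ x) with h | h
  · exact hmax ⟨hx, h⟩
  · exact h.trans hx₀.2

/-- At a maximum of the barrier the determinant of the metric is small. -/
theorem det_gram_re_le_of_max_barrier {g : Metric n M} (hf : IsKahlerImmersion g f) {s : ℝ}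
    {Q : MvPolynomial (Fin n) ℂ} {x₀ : M} (hx₀ : x₀ ∈ volSet κ c b a f)
    (hpos : 0 < barrier s b Q (CP.nlift a (f x₀)))
    (hmax : ∀ x ∈ volSet κ c b a f,
      barrier s b Q (CP.nlift a (f x)) ≤ barrier s b Q (CP.nlift a (f x₀))) :
    (gram (clift a f (chartAt (Cn n) x₀)) (chartAt (Cn n) x₀ x₀)).det.re
      ≤ s ^ n * ‖(jac b (clift a f (chartAt (Cn n) x₀)) (chartAt (Cn n) x₀ x₀)).det‖ ^ 2 := by
  set e := chartAt (Cn n) x₀ with he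
  have hΦ : AnalyticAt ℂ (clift a f e) (e x₀) := analyticAt_clift_chartAt hf.holomorphic hx₀.1
  have hΦF : clift a f e (e x₀) = CP.nlift a (f x₀) := by rw [clift, symm_chartAt_apply x₀]
  have hΦ0 : clift a f e (e x₀) ≠ 0 := by rw [hΦF]; exact CP.nlift_ne_zero hx₀.1
  have hqx₀ : MvPolynomial.eval (fun α => ycoord b (CP.nlift a (f x₀)) α) Q ≠ 0 := by
    intro h0
    rw [barrier, h0] at hpos
    simp at hpos
  have hqea : AnalyticAt ℂ
      (fun z => MvPolynomial.eval (fun α => ycoord b (clift a f e z) α) Q) (e x₀) :=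
    (analyticAt_eval Q _).comp_of_eq (((ycoordL b).analyticAt _).comp_of_eq hΦ rfl) rfl
  have hqe0 : MvPolynomial.eval (fun α => ycoord b (clift a f e (e x₀)) α) Q ≠ 0 := by
    rw [hΦF]; exact hqx₀
  refine det_gram_re_le_of_form_le (hform_clift_chartAt_re_pos hf hx₀.1) (jac_det_ne_zero hf hx₀)
    (hform_re_le_of_isLocalMax hΦ hΦ0 hqea hqe0 ?_)
  have h1 : Filter.Tendsto e.symm (𝓝 (e x₀)) (𝓝 x₀) := e.tendsto_symm (mem_chart_source _ x₀)
  have h2 := h1.eventually ((isOpen_volSet hf.holomorphic).mem_nhds hx₀)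
  filter_upwards [h2, hqea.continuousAt.eventually_ne hqe0] with z hz hqz
  have hz0 : CP.nlift a (f (e.symm z)) ≠ 0 := CP.nlift_ne_zero hz.1
  have h3 := log_barrier (s := s) hz0 hqz
  have h4 := log_barrier (s := s) (CP.nlift_ne_zero hx₀.1) hqx₀
  rw [hΦF]
  refine h3.symm.le.trans (le_trans ?_ h4.le)
  exact Real.log_le_log (barrier_pos hz0 hqz) (hmax _ hz)

/-- A Kähler–Einstein metric on a compact manifold which is induced by a projective immersion has
positive Einstein constant. -/
theorem einstein_constant_pos [CompactSpace M] [Nonempty M] (hn : 1 ≤ n) {g : Metric n M}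
    (hf : IsKahlerImmersion g f) (hc : IsEinstein g c) : 0 < c := by
  by_contra! hc0
  obtain ⟨p⟩ := ‹Nonempty M›
  obtain ⟨a, b, κ, ha, hκ, hp⟩ := exists_mem_volSet hf hc p
  obtain ⟨Q, hQ0, hQ⟩ := exists_denominator hf.holomorphic a b
  obtain ⟨x₁, hx₁, hQx₁⟩ := exists_eval_ne_zero hf hp hQ0
  -- Any `s` with `0 < s ≤ 1` and `s < κ` works: then `s ^ n ≤ s < κ`, as `n ≥ 1`.
  set s : ℝ := min 1 κ / 2 with hs
  have hmin := lt_min one_pos hκ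
  have hs0 : 0 < s := by linarith
  have hs1 : s ≤ 1 := by have := min_le_left 1 κ; linarith
  have hsκ : s < κ := by have := min_le_right 1 κ; linarith
  obtain ⟨x₀, hx₀, hpos, hmax⟩ := exists_max_barrier hf.holomorphic hs0 hQ hx₁ hQx₁
  have hdet := det_gram_re_le_of_max_barrier hf hx₀ hpos hmax
  have hvol := volId_of_mem_volSet hx₀
  rw [VolId] at hvol
  set e := chartAt (Cn n) x₀ with he
  -- Cauchy–Schwarz for `⟪a, F⟫ = 1` with `‖a‖ = 1`.
  have hF1 : 1 ≤ ‖clift a f e (e x₀)‖ ^ 2 := by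
    have h1 := norm_inner_le_norm (𝕜 := ℂ) a (CP.nlift a (f x₀))
    rw [CP.inner_nlift hx₀.1, ha, one_mul, norm_one] at h1
    rw [clift, symm_chartAt_apply x₀]
    exact one_le_pow₀ h1
  have hexp : Real.exp (c / 2 * Real.log (‖clift a f e (e x₀)‖ ^ 2)) ≤ 1 := by
    rw [Real.exp_le_one_iff]
    exact mul_nonpos_of_nonpos_of_nonneg (by linarith) (Real.log_nonneg hF1)
  have hgpos := gram_det_re_pos (hform_clift_chartAt_re_pos hf hx₀.1)
  have hJpos : 0 < ‖(jac b (clift a f e) (e x₀)).det‖ ^ 2 :=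
    pow_pos (norm_pos_iff.2 (jac_det_ne_zero hf hx₀)) 2
  have h1 : κ * ‖(jac b (clift a f e) (e x₀)).det‖ ^ 2 ≤ (gram (clift a f e) (e x₀)).det.re := by
    rw [← hvol]
    exact mul_le_of_le_one_right hgpos.le hexp
  have h2 : s ^ n ≤ s := (pow_le_pow_of_le_one hs0.le hs1 hn).trans_eq (pow_one s)
  have h3 := le_of_mul_le_mul_right (h1.trans hdet) hJpos
  linarith

end main

end KahlerProj

end

theorem mainTheorem7 {n : ℕ} (hn : 1 ≤ n) {M : Type*} [TopologicalSpace M] [T2Space M]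
    [CompactSpace M] [ConnectedSpace M] [ChartedSpace (KahlerProj.Cn n) M]
    [IsManifold 𝓘(ℂ, KahlerProj.Cn n) ω M]
    (g : KahlerProj.Metric n M) (hg : KahlerProj.IsKahler g)
    (c : ℝ) (hc : KahlerProj.IsEinstein g c)
    {N : ℕ} (f : M → KahlerProj.CP N) (hf : KahlerProj.IsKahlerImmersion g f) :
    0 < c :=
  KahlerProj.einstein_constant_pos hn hf hc
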